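/- **CLT for the Fourier–RQMC solution of the multivariate shortfall risk problem.** *Problem.* Let $X$ be an $\mathbb R^d$-valued random vector with a Lebesgue density, and let $\ell:\mathbb R^d\to\mathbb R$ be a loss function: componentwise nondecreasing, convex, lower semicontinuous, $\inf\ell<0$, and $\ell(x)\ge\sum_i x_i-c$ for some constant $c$. Assume $\mathbb E[\ell(t|X|)]<\infty$ for all $t>0$ ($|\cdot|$ componentwise). Suppose $\ell(x)=a_0+\langle a,x\rangle+\sum_{c}\ell_c(x_{p_c})$ is an affine function plus a finite sum of components, where $p_c\subset\{1,\dots,d\}$, $k_c=|p_c|$ and $x_{p_c}$ is the subvector. For $z=(m,\lambda)\in\mathbb R^d\times\mathbb R$ the first-order (KKT) system is $$\lambda\,\mathbb E[\nabla\ell(X-m)]=\mathbf 1,\qquad \mathbb E[\ell(X-m)]=0 .$$ Let $M\subset\mathbb R^d$ be compact, $\bar\lambda>0$, $\mathcal Z=M\times(0,\bar\lambda]$. Assume that $z^*=(m^*,\lambda^*)$, with $m^*\in\operatorname{int}M$ and $0<\lambda^*<\bar\lambda$, is the only solution in $\mathcal Z$. *Fourier representation.* Let $\Phi_{c}(y)=\mathbb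 E[e^{\mathrm i\langle y,X_{p_c}\rangle}]$, $\hat\ell_c(y)=\int e^{-\mathrm i\langle y,x\rangle}\ell_c(x)\,dx$, and let $\hat\ell^{\alpha}_c(y)=\prod_{i\in\alpha}(\mathrm i y_i)\,\hat\ell_c(y)$ be the transform of the distributional partial derivative of $\ell_c$ with respect to a list $\alpha$ of at most two coordinates ($0$ if $\alpha$ contains a coordinate outside $p_c$). For damping vectors $K_c^{(\nu)}\in\mathbb R^{k_c}$, $\nu=0,1,2$, put $$h^{(\nu),\alpha}_c(u;m)=(2\pi)^{-k_c}e^{\langle K_c^{(\nu)}-\mathrm iu,\,m_{p_c}\rangle}\,\Phi_c(u+\mathrm iK_c^{(\nu)})\,\hat\ell^{\alpha}_c(u+\mathrm iK_c^{(\nu)}).$$ Let $T_c$ be an inverse domain transformation from $(0,1)^{D_{k_c}}$ to $\mathbb R^{k_c}$ with weight $w_c\ge0$ (both measurable) such that $\int_{\mathbb R^{k_c}}f\,du=\int_{(0,1)^{D_{k_c}}}f(T_c(v))\,w_c(v)\,dv$ for all $f\ge 0$ measurable, and let $\tilde h^{(\nu),\alpha}_c(v;m)=\Re\,h^{(\nu),\alpha}_c(T_c(v);m)\,w_c(v)$.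 Assume for all $c$, all $\nu\in\{0,1,2\}$ and all lists $\alpha$ of length at most $2$: $\mathbb E[e^{-\langle K^{(\nu)}_c,X_{p_c}\rangle}]<\infty$, $e^{\langle K_c^{(\nu)},x\rangle}\ell_c(x)\in L^1$, $h_c^{(\nu),\alpha}(\cdot;m)\in L^1(\mathbb R^{k_c})$ for all $m$, and $\tilde h_c^{(\nu),\alpha}(\cdot;m)\in L^2((0,1)^{D_{k_c}})$ for $m\in M$. Write $\hat g^{(1)}_i(m)=a_i+\sum_c\Re\int h^{(1),(i)}_c(u;m)\,du$, $\hat g^{(2)}_{ij}(m)=\sum_c\Re\int h_c^{(2),(i,j)}(u;m)\,du$, and let $$\hat{\mathcal L}^{\mathrm{Fou}}_{\nabla^2_z}(z)=\begin{pmatrix}-\lambda\,\hat g^{(2)}(m)&\hat g^{(1)}(m)\\ \hat g^{(1)}(m)^\top&0\end{pmatrix}$$ be the Fourier Hessian of the Lagrangian $\sum_i m_i+\lambda\,\mathbb E[\ell(X-m)]$ (up to its overall sign). Assume that it is invertible at $z^*$. *Rate exponent.* Assume that at $m=m^*$ the transformed integrands $\tilde h=\tilde h_c^{(0),\emptyset}$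 and $\tilde h=\tilde h_c^{(1),(i)}$ have continuous mixed partial derivatives $\partial^\kappa\tilde h$, $\kappa\subset\{1,\dots,D_{k_c}\}$, on the open cube, with $|\partial^\kappa\tilde h(v)|\le C\prod_j\min(v_j,1-v_j)^{-A^{(\nu)}_{j,c}-\mathbf 1_{j\in\kappa}}$ for some constant $C$ and exponents $A^{(\nu)}_{j,c}>0$ ($\nu=0,1$ respectively). Let $A^*=\max A^{(\nu)}_{j,c}$ over $\nu\in\{0,1\}$, $c$, $j$ (with $A^*=0$ if there are no components), let $\varsigma>0$ and $r=1-A^*-\varsigma$. *RQMC estimators.* For each order $k$ let $(v^k_n)_n$ be a $(t_k,D_k)$-sequence in base $2$ for some $t_k$ (for instance a Sobol' sequence). Let $(v^{k,(s)}_n)_n$, $s=1,2,\dots$, be its i.i.d. nested uniform scramblings, independent over $k$. Let $$\mathcal G_N^{(s)}(z)=\begin{pmatrix}\mathbf 1-\lambda\big(a+\sum_c\frac1N\sum_{n\le N}\tilde h^{(1)}_c(v^{k_c,(s)}_n;m)\big)\\ a_0+\langle a,\mathbb E[X]-m\rangle+\sum_c\frac1N\sum_{n\le N}\tilde h^{(0)}_c(v_n^{k_c,(s)};m)\end{pmatrix},\qquad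 I_{N,S}(z)=\frac1S\sum_{s=1}^S\mathcal G_N^{(s)}(z),$$ where $\tilde h^{(0)}_c=\tilde h^{(0),\emptyset}_c$ and $\tilde h_c^{(1)}=(\tilde h_c^{(1),(i)})_{i=1}^d$. Let $z_{N,S}$ be a measurable random vector which almost surely is a zero of $I_{N,S}$ in $\mathcal Z$ whenever one exists, and let $z_{N,\infty}\in\mathcal Z$, $N\ge1$, satisfy $\mathbb E[\mathcal G^{(1)}_N(z_{N,\infty})]=0$. *Theorem.* Let $N=N_j\to\infty$ and $S=S_j\to\infty$ jointly in such a way that $\sqrt S\,N^r\|z_{N,\infty}-z^*\|\to0$, and suppose that there is a positive semidefinite matrix $H(z^*)$ with $$\lim_{N\to\infty}N^{2r}\operatorname{Cov}\big(\mathcal G_N^{(1)}(z^*)\big)=H(z^*).$$ Then $$\sqrt S\,N^r\,(z_{N,S}-z^*)\xrightarrow{\ \mathrm{law}\ }\mathcal N\big(0,V(z^*)\big),\qquad V(z^*)=\big(\hat{\mathcal L}^{\mathrm{Fou}}_{\nabla_z^2}(z^*)\big)^{-1}H(z^*)\big(\hat{\mathcal L}^{\mathrm{Fou}}_{\nabla_z^2}(z^*)\big)^{-1}.$$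 -/

import Mathlib

open MeasureTheory ProbabilityTheory Filter Topology

noncomputable section

namespace FourierRQMC

/-! ### Scrambled digital point sets -/

/-- The `i`-th binary digit (`i = 0, 1, …`) of `x ∈ [0,1)` after the binary point. -/
def binaryDigit (x : ℝ) (i : ℕ) : Bool := decide (⌊2 ^ (i + 1) * x⌋₊ % 2 = 1)

/-- Nested scrambling of one coordinate in base 2. A random permutation of `{0,1}` is attached to
every finite digit string; since a permutation of `{0,1}` is the addition of a bit, it is stored as
a bit `ξ w`. The `i`-th digit of `x` is permuted by the permutation attached to the string of the
digits of `x` that precede it. -/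
def scrambleCoord (ξ : List Bool → Bool) (x : ℝ) : ℝ :=
  ∑' i : ℕ,
    (if xor (binaryDigit x i) (ξ ((List.range i).map (binaryDigit x))) then (1 : ℝ) else 0)
      / 2 ^ (i + 1)

/-- `v` is a `(t, D)`-sequence in base 2: for all `q ≥ t` and all `b`, each dyadic
elementary interval of volume `2 ^ (t - q)` contains exactly `2 ^ t` of the points `v n` with
`b * 2 ^ q ≤ n < (b + 1) * 2 ^ q`. Sobol' sequences (also called `LP_τ`-sequences) are the standard
examples. -/
def IsDyadicSequence {D : ℕ} (t : ℕ) (v : ℕ → Fin D → ℝ) : Prop :=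
  (∀ n j, v n j ∈ Set.Ico (0 : ℝ) 1) ∧
  ∀ q b : ℕ, ∀ e a : Fin D → ℕ, t + ∑ j, e j = q → (∀ j, a j < 2 ^ e j) →
    {n : ℕ | n ∈ Set.Ico (b * 2 ^ q) ((b + 1) * 2 ^ q) ∧
      ∀ j, v n j ∈ Set.Ico ((a j : ℝ) / 2 ^ e j) (((a j : ℝ) + 1) / 2 ^ e j)}.ncard = 2 ^ t

/-- Independent fair bits `ξ s k j w`, indexed by the randomization `s`, the
interaction order `k`, the coordinate `j` and the digit string `w`: the randomness of the
i.i.d. nested uniform scramblings, independent over `s` and over `k`. -/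
structure IsUniformScrambling {Ω : Type*} [MeasurableSpace Ω] (P : Measure Ω) {dim : ℕ → ℕ}
    (ξ : ℕ → (k : ℕ) → Fin (dim k) → List Bool → Ω → Bool) : Prop where
  measurable : ∀ s k j w, Measurable (ξ s k j w)
  fair : ∀ s k j w, P {ω | ξ s k j w ω = true} = 1 / 2
  indep : iIndepFun
    (fun (q : ℕ × (Σ k : ℕ, Fin (dim k)) × List Bool) => ξ q.1 q.2.1.1 q.2.1.2 q.2.2) P

/-! ### Boundary growth of functions on the unit cube -/

/-- The open unit cube in dimension `D`. -/
def openCube (D : ℕ) : Set (Fin D → ℝ) := Set.univ.pi fun _ => Set.Ioo 0 1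

/-- `f` has continuous mixed partial derivatives `∂^κ f` (at most once in each coordinate) on the
open cube, and `|∂^κ f (v)| ≤ C ∏ j, min (v j) (1 - v j) ^ (-A j - 1_{j ∈ κ})`. -/
def HasBoundaryGrowth {D : ℕ} (f : (Fin D → ℝ) → ℝ) (A : Fin D → ℝ) : Prop :=
  ∃ (C : ℝ) (df : Finset (Fin D) → (Fin D → ℝ) → ℝ),
    (∀ v ∈ openCube D, df ∅ v = f v) ∧
    (∀ κ, ContinuousOn (df κ) (openCube D)) ∧
    (∀ κ, ∀ j ∉ κ, ∀ v ∈ openCube D,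
      HasDerivAt (fun x => df κ (Function.update v j x)) (df (insert j κ) v) (v j)) ∧
    ∀ κ, ∀ v ∈ openCube D,
      |df κ v| ≤ C * ∏ j, min (v j) (1 - v j) ^ (-A j - if j ∈ κ then 1 else 0)

/-! ### Loss functions and the first-order system -/

/-- Finite multivariate loss functions. -/
structure IsLossFunction {d : ℕ} (l : (Fin d → ℝ) → ℝ) : Prop where
  mono : Monotone l
  convex : ConvexOn ℝ Set.univ l
  lsc : LowerSemicontinuous l
  neg : ∃ x, l x < 0
  lower : ∃ c : ℝ, ∀ x, ∑ i, x i - c ≤ l x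

/-- Primal–dual variables `z = (m, lam)`: the allocation is `z ∘ Sum.inl`, the multiplier is
`z (Sum.inr ())`. -/
abbrev PD (d : ℕ) := Fin d ⊕ Unit

/-- The `z`-gradient of the Lagrangian `∑ i, m i + lam * g m`, written with the values
`g0 = E[l(X - m)]` and `g1 = E[∇l(X - m)] = -∇g(m)`. -/
def lagrangianGrad {d : ℕ} (lam : ℝ) (g0 : ℝ) (g1 : Fin d → ℝ) : PD d → ℝ :=
  Sum.elim (fun i => 1 - lam * g1 i) (fun _ => g0)

/-- The block matrix of the second-order terms, up to the overall sign the Hessian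
of the Lagrangian. -/
def lagrangianHess {d : ℕ} (lam : ℝ) (g1 : Fin d → ℝ) (g2 : Matrix (Fin d) (Fin d) ℝ) :
    Matrix (PD d) (PD d) ℝ :=
  Matrix.fromBlocks (-lam • g2) (Matrix.of fun i _ => g1 i) (Matrix.of fun _ i => g1 i) 0

/-- The set `M × (0, lamMax]`. -/
def pdSet {d : ℕ} (M : Set (Fin d → ℝ)) (lamMax : ℝ) : Set (PD d → ℝ) :=
  {z | (z ∘ Sum.inl) ∈ M ∧ z (Sum.inr ()) ∈ Set.Ioc 0 lamMax}

/-! ### The model -/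

/-- Data of the problem and of its Fourier representation. The loss is an affine
part (its expectation and derivatives are explicit in terms of `E[X]`) plus finitely many
components, each depending on a subset of the coordinates. -/
structure Model (d : ℕ) (C : Type*) where
  /-- the law of the loss vector `X` -/
  law : Measure (Fin d → ℝ)
  /-- the affine part of the loss -/
  const : ℝ
  slope : Fin d → ℝ
  /-- the coordinates on which a component depends; their number is its interaction order `k` -/
  supp : C → Finset (Fin d)
  /-- the loss components -/
  comp : ∀ c, (supp c → ℝ) → ℝ
  /-- damping vectors, one for each order of differentiation `0, 1, 2` and each component -/
  damp : Fin 3 → ∀ c, supp c → ℝ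
  /-- dimension of the unit cube used for the interaction order `k` -/
  dim : ℕ → ℕ
  /-- the inverse domain transformation `G⁻¹` from the unit cube -/
  trans : ∀ c, (Fin (dim (supp c).card) → ℝ) → (supp c → ℝ)
  /-- the weight of the change of variables (`|det J_{G⁻¹}|` if `G⁻¹` preserves dimension) -/
  weight : ∀ c, (Fin (dim (supp c).card) → ℝ) → ℝ

namespace Model

variable {d : ℕ} {C : Type*} [Fintype C] (𝓜 : Model d C)

/-- The coordinates of `x` that belong to the component `c` (the projection `P_{k,p} x`). -/
def proj (c : C) (x : Fin d → ℝ) : 𝓜.supp c → ℝ := fun i => x i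

/-- The loss function. -/
def loss (x : Fin d → ℝ) : ℝ :=
  𝓜.const + ∑ i, 𝓜.slope i * x i + ∑ c, 𝓜.comp c (𝓜.proj c x)

/-- `E[l(X - m)]`. -/
def g (m : Fin d → ℝ) : ℝ := ∫ x, 𝓜.loss (x - m) ∂𝓜.law

/-- `E[∂ᵢ l(X - m)]`. -/
def gGrad (m : Fin d → ℝ) (i : Fin d) : ℝ :=
  ∫ x, fderiv ℝ 𝓜.loss (x - m) (Pi.single i 1) ∂𝓜.law

/-- The exact first-order (KKT) system at `z = (m, lam)`: `lam * E[∇l(X - m)] = 1` and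
`E[l(X - m)] = 0`. -/
def IsKKT (z : PD d → ℝ) : Prop :=
  lagrangianGrad (z (Sum.inr ())) (𝓜.g (z ∘ Sum.inl)) (𝓜.gGrad (z ∘ Sum.inl)) = 0

/-- The contour `u + i K`. -/
def contour (c : C) (K u : 𝓜.supp c → ℝ) (i : 𝓜.supp c) : ℂ := (u i : ℂ) + Complex.I * (K i : ℂ)

/-- Extended characteristic function of the marginal of `X` on the coordinates of `c`. -/
def charFn (c : C) (y : 𝓜.supp c → ℂ) : ℂ :=
  ∫ x, Complex.exp (Complex.I * ∑ i, y i * (𝓜.proj c x i : ℂ)) ∂𝓜.law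

/-- Extended Fourier transform of the loss component `c`. -/
def compHat (c : C) (y : 𝓜.supp c → ℂ) : ℂ :=
  ∫ x : 𝓜.supp c → ℝ, Complex.exp (-(Complex.I * ∑ i, y i * (x i : ℂ))) * (𝓜.comp c x : ℂ)

/-- The Fourier symbol `i yᵢ` of `∂/∂xᵢ` on functions of the coordinates of `c` (and `0` for the
other coordinates). -/
def symb (c : C) (y : 𝓜.supp c → ℂ) (i : Fin d) : ℂ :=
  if h : i ∈ 𝓜.supp c then Complex.I * y ⟨i, h⟩ else 0

/-- Extended Fourier transform of the (distributional) partial derivative of the component `c`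
with respect to the coordinates listed in `α`. -/
def compHatDeriv (c : C) (α : List (Fin d)) (y : 𝓜.supp c → ℂ) : ℂ :=
  (α.map (𝓜.symb c y)).prod * 𝓜.compHat c y

/-- The Fourier integrand of the component `c` for the derivative `α`, with damping vector `K`. -/
def integrand (c : C) (K : 𝓜.supp c → ℝ) (α : List (Fin d)) (m : Fin d → ℝ)
    (u : 𝓜.supp c → ℝ) : ℂ :=
  ((2 * Real.pi : ℝ) : ℂ)⁻¹ ^ (𝓜.supp c).card
    * Complex.exp (∑ i, ((K i : ℂ) - Complex.I * (u i : ℂ)) * (𝓜.proj c m i : ℂ))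
    * 𝓜.charFn c (𝓜.contour c K u) * 𝓜.compHatDeriv c α (𝓜.contour c K u)

/-- The transformed integrand on the unit cube (real part). -/
def tIntegrand (c : C) (K : 𝓜.supp c → ℝ) (α : List (Fin d)) (m : Fin d → ℝ)
    (v : Fin (𝓜.dim (𝓜.supp c).card) → ℝ) : ℝ :=
  (𝓜.integrand c K α m (𝓜.trans c v)).re * 𝓜.weight c v

/-- Contribution of the affine part to `E[l(X - m)]`. -/
def affinePart (m : Fin d → ℝ) : ℝ :=
  𝓜.const + ∑ i, 𝓜.slope i * ((∫ x, x i ∂𝓜.law) - m i)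

/-- Fourier representation of the gradient term `E[∇l(X - m)]`. -/
def gFou1 (m : Fin d → ℝ) (i : Fin d) : ℝ :=
  𝓜.slope i + ∑ c, (∫ u, 𝓜.integrand c (𝓜.damp 1 c) [i] m u).re

/-- Fourier representation of the Hessian term. -/
def gFou2 (m : Fin d → ℝ) : Matrix (Fin d) (Fin d) ℝ :=
  Matrix.of fun i j => ∑ c, (∫ u, 𝓜.integrand c (𝓜.damp 2 c) [i, j] m u).re

/-- The Fourier Hessian of the Lagrangian at `z`. -/
def hessFou (z : PD d → ℝ) : Matrix (PD d) (PD d) ℝ :=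
  lagrangianHess (z (Sum.inr ())) (𝓜.gFou1 (z ∘ Sum.inl)) (𝓜.gFou2 (z ∘ Sum.inl))

/-- Standing assumptions: `l` is a loss function, `X` has a density and belongs to
the Orlicz heart of `l`, the damping vectors are admissible, the domain transformations turn
integrals over `ℝᵏ` into integrals over the cube, and the transformed integrands are square
integrable, for allocations in `M`. Each damping vector is admissible for all three orders of
differentiation. -/
structure IsAdmissible (M : Set (Fin d → ℝ)) : Prop where
  isLoss : IsLossFunction 𝓜.loss
  prob : IsProbabilityMeasure 𝓜.law
  density : 𝓜.law ≪ volume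
  orlicz : ∀ t : ℝ, 0 < t → Integrable (fun x : Fin d → ℝ => 𝓜.loss fun i => |t * x i|) 𝓜.law
  damp_law : ∀ ν c,
    Integrable (fun x => Real.exp (-∑ i, 𝓜.damp ν c i * 𝓜.proj c x i)) 𝓜.law
  damp_comp : ∀ ν c,
    Integrable (fun x : 𝓜.supp c → ℝ => Real.exp (∑ i, 𝓜.damp ν c i * x i) * 𝓜.comp c x)
  damp_integrand : ∀ ν c, ∀ α : List (Fin d), α.length ≤ 2 → ∀ m,
    Integrable (𝓜.integrand c (𝓜.damp ν c) α m)
  trans_measurable : ∀ c, Measurable (𝓜.trans c)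
  weight_measurable : ∀ c, Measurable (𝓜.weight c)
  weight_nonneg : ∀ c v, 0 ≤ 𝓜.weight c v
  change_of_variables : ∀ c,
    ((volume.restrict (openCube (𝓜.dim (𝓜.supp c).card))).withDensity
      fun v => ENNReal.ofReal (𝓜.weight c v)).map (𝓜.trans c) = volume
  square_integrable : ∀ ν c, ∀ α : List (Fin d), α.length ≤ 2 → ∀ m ∈ M,
    MemLp (𝓜.tIntegrand c (𝓜.damp ν c) α m) 2
      (volume.restrict (openCube (𝓜.dim (𝓜.supp c).card)))

/-- Boundary growth at the allocation `m`, with exponents `A ν c j`, of the transformed integrands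
of order `ν = 0, 1`. -/
def HasGrowthExponents (A : Fin 2 → ∀ c, Fin (𝓜.dim (𝓜.supp c).card) → ℝ)
    (m : Fin d → ℝ) : Prop :=
  (∀ ν c j, 0 < A ν c j) ∧
  (∀ c, HasBoundaryGrowth (𝓜.tIntegrand c (𝓜.damp 0 c) [] m) (A 0 c)) ∧
  ∀ c i, HasBoundaryGrowth (𝓜.tIntegrand c (𝓜.damp 1 c) [i] m) (A 1 c)

/-- The largest growth exponent. -/
def worstExponent (A : Fin 2 → ∀ c, Fin (𝓜.dim (𝓜.supp c).card) → ℝ) : ℝ :=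
  ⨆ q : Fin 2 × (Σ c, Fin (𝓜.dim (𝓜.supp c).card)), A q.1 q.2.1 q.2.2

/-! ### The randomized estimators -/

variable {Ω : Type*} (v : (k : ℕ) → ℕ → Fin (𝓜.dim k) → ℝ)
  (ξ : ℕ → (k : ℕ) → Fin (𝓜.dim k) → List Bool → Ω → Bool)

/-- The `n`-th scrambled point of the `s`-th randomization for interaction order `k`. -/
def point (s k n : ℕ) (ω : Ω) : Fin (𝓜.dim k) → ℝ :=
  fun j => scrambleCoord (fun w => ξ s k j w ω) (v k n j)

/-- The average over the first `N` points of the `s`-th randomization of the transformed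
integrands of order `ν`, summed over the components. -/
def pointAverage (N s : ℕ) (ω : Ω) (ν : Fin 3) (α : List (Fin d)) (m : Fin d → ℝ) : ℝ :=
  ∑ c, (N : ℝ)⁻¹ * ∑ n ∈ Finset.range N,
    𝓜.tIntegrand c (𝓜.damp ν c) α m (𝓜.point v ξ s (𝓜.supp c).card n ω)

/-- The estimator of the gradient of the Lagrangian from the `s`-th randomization alone. -/
def replicateGrad (N s : ℕ) (ω : Ω) (z : PD d → ℝ) : PD d → ℝ :=
  lagrangianGrad (z (Sum.inr ()))
    (𝓜.affinePart (z ∘ Sum.inl) + 𝓜.pointAverage v ξ N s ω 0 [] (z ∘ Sum.inl))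
    (fun i => 𝓜.slope i + 𝓜.pointAverage v ξ N s ω 1 [i] (z ∘ Sum.inl))

/-- The RQMC estimator of the gradient of the Lagrangian from `S` randomizations. -/
def rqmcGrad (N S : ℕ) (ω : Ω) (z : PD d → ℝ) : PD d → ℝ :=
  (S : ℝ)⁻¹ • ∑ s ∈ Finset.range S, 𝓜.replicateGrad v ξ N s ω z

end Model

end FourierRQMC

end

/-! The Gaussian limit is degenerate. Over the first `2 ^ m` points of a dyadic sequence, the
scrambled average of an integrand with boundary growth exponents at most α has mean square error
o(N^(-2r)) for every r < 1 - α. Here r = 1 - A* - ς with ς > 0, so N^(2r) times the variance of each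
entry of the gradient estimator at z* tends to zero along N = 2^m. The limit H is assumed along all
N, hence its diagonal vanishes, and a positive semidefinite matrix with zero trace is zero
(`eq_zero_of_tendsto_covariance`). The target law is therefore the point mass at 0, and it remains
to show that √S N^r (z_{N,S} - z*) tends to 0 in probability.

Variance. Scrambling makes Walsh functions with different index sets uncorrelated, even at different
points, so the error variance is a sum of squared Walsh coefficients times gain sums over the point
set. The gain sums vanish for shallow index sets (`gainSum_eq_zero`) and are O(N) for the others
(`abs_gainSum_le`). Boundary growth gives Walsh coefficients of order 2^(-(1-α)·depth) through
summation by parts (`abs_walshCoeff_le`). For α ≥ 1/2 Bessel's inequality alone is enough.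

Fourier side. Damped Fourier inversion holds for almost every allocation, and for every allocation
because `g` is convex, hence continuous (`g_eq`). Differentiating under the integral gives
`gGrad_eq` and shows that the Fourier values, summed over the components, do not depend on the
damping vector. So the estimators are centred at z*, and the derivative of the limiting system there
is minus the Fourier Hessian.

Error of the solution. A uniform weak law in the allocation (`tendsto_measure_sampleMean`) holds for
the integrands and their derivatives. Together with compactness, uniqueness of z* and a quantitative
inverse function theorem it gives, with probability tending to one, ‖z_{N,S} - z*‖ ≤ K ‖I_{N,S}(z*)‖
(`exists_tendsto_measure_norm_sub`). The right side has mean square S^(-1) times the variance of one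
randomization, so Chebyshev's inequality concludes. -/

namespace FourierRQMC

/-! ### Walsh functions of scrambled digits -/

/-- A family of independent fair bits. -/
structure IsFairBits {Ω ι : Type*} [MeasurableSpace Ω] (P : Measure Ω) (ξ : ι → Ω → Bool) :
    Prop where
  measurable : ∀ q, Measurable (ξ q)
  fair : ∀ q, P {ω | ξ q ω = true} = 1 / 2
  indep : iIndepFun ξ P

/-- The sign attached to a bit. -/
def bitSign (b : Bool) : ℝ := if b then -1 else 1

lemma bitSign_xor (a b : Bool) : bitSign (xor a b) = bitSign a * bitSign b := by
  cases a <;> cases b <;> simp [bitSign]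

lemma bitSign_mul_self (b : Bool) : bitSign b * bitSign b = 1 := by
  cases b <;> simp [bitSign]

lemma abs_bitSign (b : Bool) : |bitSign b| = 1 := by
  cases b <;> simp [bitSign]

lemma measurable_bitSign : Measurable bitSign := measurable_of_countable _

/-- The word of the first `i` binary digits of `x`. -/
noncomputable def digitWord (x : ℝ) (i : ℕ) : List Bool := (List.range i).map (binaryDigit x)

@[simp] lemma length_digitWord (x : ℝ) (i : ℕ) : (digitWord x i).length = i := by
  simp [digitWord]

lemma digitWord_eq_iff {x y : ℝ} {i : ℕ} :
    digitWord x i = digitWord y i ↔ ∀ l < i, binaryDigit x l = binaryDigit y l := by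
  simp [digitWord]

variable {D : ℕ} {Ω : Type*}

/-- The array of the binary digits of the coordinates of `x`. -/
noncomputable def digits (x : Fin D → ℝ) (q : Fin D × ℕ) : Bool := binaryDigit (x q.1) q.2

/-- The digit array of the scrambled point. -/
noncomputable def scrambledDigits (ξ : Fin D × List Bool → Ω → Bool) (x : Fin D → ℝ) (ω : Ω)
    (q : Fin D × ℕ) : Bool :=
  xor (digits x q) (ξ (q.1, digitWord (x q.1) q.2) ω)

/-- The scrambled point. -/
noncomputable def scrambledPoint (ξ : Fin D × List Bool → Ω → Bool) (x : Fin D → ℝ) (ω : Ω) :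
    Fin D → ℝ :=
  fun j => scrambleCoord (fun w => ξ (j, w) ω) (x j)

/-- The Walsh function with index set `S`, as a function of the digit array. -/
def walsh (S : Finset (Fin D × ℕ)) (b : Fin D × ℕ → Bool) : ℝ := ∏ q ∈ S, bitSign (b q)

@[simp] lemma walsh_empty (b : Fin D × ℕ → Bool) : walsh ∅ b = 1 := by simp [walsh]

lemma abs_walsh (S : Finset (Fin D × ℕ)) (b : Fin D × ℕ → Bool) : |walsh S b| = 1 := by
  simp [walsh, Finset.abs_prod, abs_bitSign]

lemma walsh_mul_self (S : Finset (Fin D × ℕ)) (b : Fin D × ℕ → Bool) :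
    walsh S b * walsh S b = 1 := by
  simp [walsh, ← Finset.prod_mul_distrib, bitSign_mul_self]

/-- Each factor is 2 where the two arrays agree and 0 elsewhere, so the Walsh–Dirichlet kernel on a
set of digits is nonnegative and supported on agreement. This positivity gives pointwise convergence
of Walsh expansions. -/
lemma prod_one_add_bitSign (I : Finset (Fin D × ℕ)) (a b : Fin D × ℕ → Bool) :
    ∏ q ∈ I, (1 + bitSign (a q) * bitSign (b q)) = ∑ S ∈ I.powerset, walsh S a * walsh S b := by
  rw [Finset.prod_one_add]
  simp [walsh, Finset.prod_mul_distrib]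

/-- The bit used for the digit `q` of the scrambled point. -/
noncomputable def scrambleSite (x : Fin D → ℝ) : Fin D × ℕ ↪ Fin D × List Bool where
  toFun q := (q.1, digitWord (x q.1) q.2)
  inj' := by
    rintro ⟨j, i⟩ ⟨j', i'⟩ h
    simp only [Prod.mk.injEq] at h
    obtain ⟨rfl, h⟩ := h
    simpa using congrArg List.length h

@[simp] lemma scrambleSite_apply (x : Fin D → ℝ) (q : Fin D × ℕ) :
    scrambleSite x q = (q.1, digitWord (x q.1) q.2) := rfl

/-- Signs turn `xor` into multiplication. Moments of scrambled Walsh functions thus reduce to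
comparing finite sets of random bits. -/
lemma walsh_scrambledDigits {ξ : Fin D × List Bool → Ω → Bool} (S : Finset (Fin D × ℕ)) (x : Fin D → ℝ) (ω : Ω) :
    walsh S (scrambledDigits ξ x ω) =
      walsh S (digits x) * ∏ q ∈ S.map (scrambleSite x), bitSign (ξ q ω) := by
  simp [walsh, scrambledDigits, bitSign_xor, Finset.prod_mul_distrib]

/-- A site stores the word of preceding digits, and the length of that word recovers the digit
position. -/
lemma map_scrambleSite_eq_iff {S T : Finset (Fin D × ℕ)} {x y : Fin D → ℝ} :
    S.map (scrambleSite x) = T.map (scrambleSite y) ↔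
      S = T ∧ ∀ q ∈ S, digitWord (x q.1) q.2 = digitWord (y q.1) q.2 := by
  constructor
  · intro h
    have key : ∀ {S T : Finset (Fin D × ℕ)} {x y : Fin D → ℝ},
        S.map (scrambleSite x) = T.map (scrambleSite y) →
        ∀ q ∈ S, q ∈ T ∧ digitWord (x q.1) q.2 = digitWord (y q.1) q.2 := by
      intro S T x y h q hq
      have : scrambleSite x q ∈ T.map (scrambleSite y) := h ▸ Finset.mem_map_of_mem _ hq
      obtain ⟨q', hq', he⟩ := Finset.mem_map.1 this
      simp only [scrambleSite_apply, Prod.mk.injEq] at he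
      have h2 : q' = q := Prod.ext he.1 (by simpa using congrArg List.length he.2)
      subst h2
      exact ⟨hq', he.2.symm⟩
    exact ⟨Finset.Subset.antisymm (fun q hq => (key h q hq).1) fun q hq => (key h.symm q hq).1,
      fun q hq => (key h q hq).2⟩
  · rintro ⟨rfl, h⟩
    rw [Finset.map_eq_image, Finset.map_eq_image]
    refine Finset.image_congr fun q hq => ?_
    simp [h q hq]

/-! ### Moments of products of random signs. -/

section

variable [MeasurableSpace Ω] {P : Measure Ω}

namespace IsFairBits

variable {ι : Type*} {ξ : ι → Ω → Bool}

lemma isProbabilityMeasure (h : IsFairBits P ξ) : IsProbabilityMeasure P :=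
  h.indep.isProbabilityMeasure

lemma precomp {κ : Type*} (h : IsFairBits P ξ) {g : κ → ι} (hg : g.Injective) :
    IsFairBits P fun q => ξ (g q) where
  measurable _ := h.measurable _
  fair _ := h.fair _
  indep := h.indep.precomp hg

lemma map_eq (h : IsFairBits P ξ) (q q' : ι) : P.map (ξ q) = P.map (ξ q') := by
  have := h.isProbabilityMeasure
  have hm : ∀ q, MeasurableSet (ξ q ⁻¹' {true}) :=
    fun q => h.measurable q (measurableSet_singleton _)
  have ht : ∀ q, P (ξ q ⁻¹' {true}) = 1 / 2 := fun q => h.fair q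
  have hf : ∀ q, P (ξ q ⁻¹' {false}) = 1 - 1 / 2 := fun q => by
    have : ξ q ⁻¹' {false} = (ξ q ⁻¹' {true})ᶜ := by ext ω; simp
    rw [this, prob_compl_eq_one_sub (hm q), ht]
  refine Measure.ext_of_singleton fun b => ?_
  rw [Measure.map_apply (h.measurable _) (measurableSet_singleton _),
    Measure.map_apply (h.measurable _) (measurableSet_singleton _)]
  cases b
  · rw [hf, hf]
  · rw [ht, ht]

/-- Disjoint groups of fair bits are independent. -/
lemma iIndepFun_curry {κ : Type*} {ξ : ι × κ → Ω → Bool} (h : IsFairBits P ξ) :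
    iIndepFun (fun i ω k => ξ (i, k) ω) P := by
  have := h.isProbabilityMeasure
  have hp : ∀ q, IsProbabilityMeasure (P.map (ξ q)) :=
    fun q => Measure.isProbabilityMeasure_map (h.measurable q).aemeasurable
  have hm : ∀ i, Measurable fun ω k => ξ (i, k) ω :=
    fun i => measurable_pi_lambda _ fun k => h.measurable _
  rw [iIndepFun_iff_map_fun_eq_infinitePi_map hm]
  have h1 := h.indep.map_fun_eq_infinitePi_map h.measurable
  have h2 : ∀ i, P.map (fun ω k => ξ (i, k) ω) =
      Measure.infinitePi fun k => P.map (ξ (i, k)) := fun i =>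
    (h.precomp (g := fun k => (i, k)) (fun a b hab => by simpa using hab)).indep
      |>.map_fun_eq_infinitePi_map fun k => h.measurable _
  have h3 := Measure.infinitePi_map_curry (ι := ι) (κ := κ) (X := Bool)
    (fun i k => P.map (ξ (i, k)))
  simp_rw [h2]
  rw [← h3, ← h1, Measure.map_map (MeasurableEquiv.measurable _)
    (measurable_pi_lambda _ h.measurable)]
  rfl

/-- Groups of fair bits with the same index set have the same law. -/
lemma map_fun_eq {κ : Type*} {ξ' : κ → Ω → Bool} {ξ : κ → Ω → Bool} (h : IsFairBits P ξ)
    (h' : IsFairBits P ξ') (hq : ∀ q, P.map (ξ q) = P.map (ξ' q)) :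
    P.map (fun ω q => ξ q ω) = P.map fun ω q => ξ' q ω := by
  rw [h.indep.map_fun_eq_infinitePi_map h.measurable,
    h'.indep.map_fun_eq_infinitePi_map h'.measurable]
  simp_rw [hq]

lemma integral_bitSign (h : IsFairBits P ξ) (q : ι) : ∫ ω, bitSign (ξ q ω) ∂P = 0 := by
  have := h.isProbabilityMeasure
  have hm : MeasurableSet {ω | ξ q ω = true} := h.measurable q (measurableSet_singleton true)
  have e : (fun ω => bitSign (ξ q ω)) = fun ω => 1 - 2 * {ω | ξ q ω = true}.indicator 1 ω := by
    ext ω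
    by_cases hω : ξ q ω = true <;> simp [bitSign, hω]; norm_num
  rw [e, integral_sub (integrable_const _)
    (((integrable_const 1).indicator hm).const_mul 2), integral_const_mul,
    integral_indicator_one hm]
  simp [Measure.real, h.fair q]

lemma integral_prod_bitSign (h : IsFairBits P ξ) [DecidableEq ι] (Q : Finset ι) :
    ∫ ω, ∏ q ∈ Q, bitSign (ξ q ω) ∂P = if Q = ∅ then 1 else 0 := by
  have := h.isProbabilityMeasure
  have h1 : iIndepFun (fun (q : Q) ω => bitSign (ξ q ω)) P :=
    (h.precomp (g := ((↑) : Q → ι)) Subtype.val_injective).indep.comp (fun _ => bitSign)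
      fun _ => measurable_bitSign
  have h2 := h1.integral_fun_prod_eq_prod_integral
    fun q => (measurable_bitSign.comp (h.measurable q)).aestronglyMeasurable
  have h3 : ∀ ω, ∏ q ∈ Q, bitSign (ξ q ω) = ∏ q : Q, bitSign (ξ q ω) := fun ω =>
    (Finset.prod_coe_sort Q fun q => bitSign (ξ q ω)).symm
  simp_rw [h3, h2, h.integral_bitSign]
  rcases Q.eq_empty_or_nonempty with rfl | hQ
  · simp
  · simp [hQ.ne_empty]

end IsFairBits

variable {ξ : Fin D × List Bool → Ω → Bool}

lemma IsFairBits.measurable_scrambledDigits (h : IsFairBits P ξ) (x : Fin D → ℝ)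
    (q : Fin D × ℕ) : Measurable fun ω => scrambledDigits ξ x ω q :=
  (measurable_of_countable (xor (digits x q))).comp (h.measurable _)

lemma IsFairBits.measurable_walsh (h : IsFairBits P ξ) (x : Fin D → ℝ)
    (S : Finset (Fin D × ℕ)) : Measurable fun ω => walsh S (scrambledDigits ξ x ω) :=
  Finset.measurable_fun_prod _ fun q _ => measurable_bitSign.comp (h.measurable_scrambledDigits x q)

open Classical in
/-- Second moments of Walsh functions at two scrambled points. -/
theorem IsFairBits.integral_walsh_mul_walsh (h : IsFairBits P ξ) (S T : Finset (Fin D × ℕ))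
    (x y : Fin D → ℝ) :
    ∫ ω, walsh S (scrambledDigits ξ x ω) * walsh T (scrambledDigits ξ y ω) ∂P =
      if S = T ∧ ∀ q ∈ S, digitWord (x q.1) q.2 = digitWord (y q.1) q.2 then
        walsh S (digits x) * walsh S (digits y) else 0 := by
  -- Bits used by both Walsh functions square to one and drop out. The product over the symmetric
  -- difference of the two site sets remains; it has mean zero unless this difference is empty.
  have e : ∀ ω, walsh S (scrambledDigits ξ x ω) * walsh T (scrambledDigits ξ y ω) =
      (walsh S (digits x) * walsh T (digits y)) *
        ∏ q ∈ symmDiff (S.map (scrambleSite x)) (T.map (scrambleSite y)), bitSign (ξ q ω) := by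
    intro ω
    rw [walsh_scrambledDigits, walsh_scrambledDigits]
    set A := S.map (scrambleSite x)
    set B := T.map (scrambleSite y)
    have hA : ∏ q ∈ A, bitSign (ξ q ω) =
        (∏ q ∈ A \ B, bitSign (ξ q ω)) * ∏ q ∈ A ∩ B, bitSign (ξ q ω) := by
      rw [mul_comm, Finset.prod_inter_mul_prod_sdiff]
    have hB : ∏ q ∈ B, bitSign (ξ q ω) =
        (∏ q ∈ B \ A, bitSign (ξ q ω)) * ∏ q ∈ A ∩ B, bitSign (ξ q ω) := by
      rw [mul_comm, Finset.inter_comm, Finset.prod_inter_mul_prod_sdiff]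
    have hI : (∏ q ∈ A ∩ B, bitSign (ξ q ω)) * ∏ q ∈ A ∩ B, bitSign (ξ q ω) = 1 := by
      simp [← Finset.prod_mul_distrib, bitSign_mul_self]
    have hs : ∏ q ∈ symmDiff A B, bitSign (ξ q ω) =
        (∏ q ∈ A \ B, bitSign (ξ q ω)) * ∏ q ∈ B \ A, bitSign (ξ q ω) := by
      rw [symmDiff_def, Finset.sup_eq_union, Finset.prod_union disjoint_sdiff_sdiff]
    rw [hA, hB, hs]
    linear_combination (walsh S (digits x) * walsh T (digits y) *
      (∏ q ∈ A \ B, bitSign (ξ q ω)) * ∏ q ∈ B \ A, bitSign (ξ q ω)) * hI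
  simp_rw [e]
  rw [integral_const_mul, h.integral_prod_bitSign]
  have : symmDiff (S.map (scrambleSite x)) (T.map (scrambleSite y)) = ∅ ↔
      S = T ∧ ∀ q ∈ S, digitWord (x q.1) q.2 = digitWord (y q.1) q.2 := by
    rw [← map_scrambleSite_eq_iff, ← Finset.bot_eq_empty, symmDiff_eq_bot]
  by_cases hc : S = T ∧ ∀ q ∈ S, digitWord (x q.1) q.2 = digitWord (y q.1) q.2
  · rw [if_pos hc, if_pos (this.2 hc), hc.1, mul_one]
  · rw [if_neg hc, if_neg (mt this.1 hc), mul_zero]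

end

end FourierRQMC

namespace FourierRQMC

/-! ### The law of a scrambled point -/

/-- The number with binary digits `b`. -/
noncomputable def bitValue (b : ℕ → Bool) : ℝ := ∑' i, (if b i then (1 : ℝ) else 0) / 2 ^ (i + 1)

/-- The integer with binary digits `b 0, …, b (L - 1)`, the most significant one first. -/
def bitPrefix (b : ℕ → Bool) : ℕ → ℕ
  | 0 => 0
  | L + 1 => 2 * bitPrefix b L + (b L).toNat

lemma bitPrefix_lt (b : ℕ → Bool) (L : ℕ) : bitPrefix b L < 2 ^ L := by
  induction L with
  | zero => simp [bitPrefix]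
  | succ L ih =>
    have : (b L).toNat ≤ 1 := Bool.toNat_le _
    rw [bitPrefix, pow_succ]; omega

lemma bitPrefix_eq_iff {a b : ℕ → Bool} {L : ℕ} :
    bitPrefix a L = bitPrefix b L ↔ ∀ i < L, a i = b i := by
  induction L with
  | zero => simp [bitPrefix]
  | succ L ih =>
    rw [Nat.forall_lt_succ_right, ← ih, bitPrefix, bitPrefix]
    cases a L <;> cases b L <;> simp <;> omega

lemma exists_bitPrefix_eq {L k : ℕ} (hk : k < 2 ^ L) : ∃ a : ℕ → Bool, bitPrefix a L = k := by
  induction L generalizing k with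
  | zero => exact ⟨fun _ => false, by simp at hk; simp [bitPrefix, hk]⟩
  | succ L ih =>
    obtain ⟨a, ha⟩ := ih (k := k / 2) (by rw [pow_succ] at hk; omega)
    refine ⟨Function.update a L (decide (k % 2 = 1)), ?_⟩
    have h1 : bitPrefix (Function.update a L (decide (k % 2 = 1))) L = bitPrefix a L :=
      bitPrefix_eq_iff.2 fun i hi => Function.update_of_ne hi.ne _ _
    rw [bitPrefix, h1, ha, Function.update_self]
    rcases Nat.mod_two_eq_zero_or_one k with h | h <;> simp [h] <;> omega

lemma summable_bitValue (b : ℕ → Bool) :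
    Summable fun i : ℕ => (if b i then (1 : ℝ) else 0) / 2 ^ (i + 1) := by
  refine Summable.of_nonneg_of_le (fun i => by split_ifs <;> positivity) (fun i => ?_)
    (summable_geometric_two' 1)
  rw [div_div, ← pow_succ']
  split_ifs
  · exact le_rfl
  · rw [zero_div]; positivity

lemma sum_range_bitValue (b : ℕ → Bool) (L : ℕ) :
    ∑ i ∈ Finset.range L, (if b i then (1 : ℝ) else 0) / 2 ^ (i + 1) = bitPrefix b L / 2 ^ L := by
  induction L with
  | zero => simp [bitPrefix]
  | succ L ih =>
    rw [Finset.sum_range_succ, ih, bitPrefix, pow_succ]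
    cases b L <;> simp <;> field_simp

lemma bitPrefix_div_le (b : ℕ → Bool) (L : ℕ) : (bitPrefix b L : ℝ) / 2 ^ L ≤ bitValue b := by
  rw [← sum_range_bitValue]
  exact (summable_bitValue b).sum_le_tsum _ fun i _ => by split_ifs <;> positivity

lemma bitValue_le (b : ℕ → Bool) (L : ℕ) : bitValue b ≤ (bitPrefix b L + 1 : ℝ) / 2 ^ L := by
  have h := (summable_bitValue b).sum_add_tsum_nat_add L
  rw [sum_range_bitValue] at h
  rw [bitValue, ← h, add_div]
  gcongr
  have hg : HasSum (fun i : ℕ => (1 : ℝ) / 2 ^ L / 2 / 2 ^ i) (1 / 2 ^ L) :=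
    hasSum_geometric_two' _
  rw [← hg.tsum_eq]
  refine Summable.tsum_le_tsum (fun i => ?_) ((summable_nat_add_iff L).2 (summable_bitValue b))
    hg.summable
  rw [div_div, div_div, ← pow_succ', ← pow_add]
  have : i + L + 1 = L + (i + 1) := by ring
  rw [this]
  gcongr
  split_ifs <;> norm_num

/-- The floor differs from the prefix only if all later digits are ones, in which case the value is
the right end point of its dyadic interval. Excluding that single value suffices. -/
lemma floor_bitValue {b : ℕ → Bool} {L : ℕ} (h : bitValue b ≠ (bitPrefix b L + 1 : ℝ) / 2 ^ L) :
    ⌊2 ^ L * bitValue b⌋₊ = bitPrefix b L := by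
  have h0 : (0 : ℝ) < 2 ^ L := by positivity
  have h1 := bitPrefix_div_le b L
  have h2 := lt_of_le_of_ne (bitValue_le b L) h
  rw [div_le_iff₀ h0] at h1
  rw [lt_div_iff₀ h0] at h2
  rw [Nat.floor_eq_iff (by nlinarith [Nat.cast_nonneg (α := ℝ) (bitPrefix b L)])]
  constructor <;> linarith

lemma binaryDigit_bitValue {b : ℕ → Bool} {i : ℕ}
    (h : bitValue b ≠ (bitPrefix b (i + 1) + 1 : ℝ) / 2 ^ (i + 1)) :
    binaryDigit (bitValue b) i = b i := by
  rw [binaryDigit, floor_bitValue h, bitPrefix]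
  cases b i <;> simp

/-! ### Independent fair digits give the uniform law. -/

section

variable {Ω : Type*} [MeasurableSpace Ω] {P : Measure Ω}

lemma measurable_bitPrefix {b : ℕ → Ω → Bool} (hb : ∀ i, Measurable (b i)) (L : ℕ) :
    Measurable fun ω => bitPrefix (fun i => b i ω) L := by
  induction L with
  | zero => exact measurable_const
  | succ L ih =>
    exact (ih.const_mul 2).add ((measurable_of_countable Bool.toNat).comp (hb L))

lemma measurable_bitValue : Measurable bitValue := by
  refine Measurable.tsum fun i => ?_
  exact (measurable_of_countable fun c : Bool => (if c then (1 : ℝ) else 0) / 2 ^ (i + 1)).comp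
    (measurable_pi_apply i)

variable {b : ℕ → Ω → Bool}

lemma IsFairBits.measure_bitPrefix_eq (h : IsFairBits P b) {L k : ℕ} (hk : k < 2 ^ L) :
    P.real {ω | bitPrefix (fun i => b i ω) L = k} = (2 ^ L)⁻¹ := by
  have := h.isProbabilityMeasure
  obtain ⟨a, rfl⟩ := exists_bitPrefix_eq hk
  have e : {ω | bitPrefix (fun i => b i ω) L = bitPrefix a L} =
      ⋂ i ∈ Finset.range L, b i ⁻¹' {a i} := by
    ext ω; simp [bitPrefix_eq_iff]
  have hb : ∀ i, P (b i ⁻¹' {a i}) = 2⁻¹ := by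
    intro i
    have ht : P (b i ⁻¹' {true}) = 2⁻¹ := (h.fair i).trans (one_div _)
    cases a i
    · have h2 : b i ⁻¹' {false} = (b i ⁻¹' {true})ᶜ := by ext ω; simp
      rw [h2, prob_compl_eq_one_sub (h.measurable i (measurableSet_singleton _)), ht,
        ENNReal.one_sub_inv_two]
    · exact ht
  rw [e, Measure.real, h.indep.meas_biInter
    fun i _ => ⟨_, measurableSet_singleton _, rfl⟩]
  simp [hb]

lemma IsFairBits.measure_bitPrefix_lt (h : IsFairBits P b) {L k : ℕ} (hk : k ≤ 2 ^ L) :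
    P.real {ω | bitPrefix (fun i => b i ω) L < k} = k / 2 ^ L := by
  have := h.isProbabilityMeasure
  induction k with
  | zero => simp
  | succ k ih =>
    have e : {ω | bitPrefix (fun i => b i ω) L < k + 1} =
        {ω | bitPrefix (fun i => b i ω) L < k} ∪ {ω | bitPrefix (fun i => b i ω) L = k} := by
      ext ω; exact Nat.lt_succ_iff_lt_or_eq
    have hd : Disjoint {ω | bitPrefix (fun i => b i ω) L < k}
        {ω | bitPrefix (fun i => b i ω) L = k} :=
      Set.disjoint_left.2 fun ω h1 h2 => h1.ne h2
    rw [e, measureReal_union hd (measurable_bitPrefix h.measurable L (measurableSet_singleton k)),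
      ih (by omega), h.measure_bitPrefix_eq (by omega)]
    push_cast; ring

/-- Distribution functions are compared. The first `L` digits are exactly uniform and determine the
value up to `2 ^ (-L)`, so the distribution function at `y` is within `2 ^ (-L)` of `y` for every
`L`. -/
theorem IsFairBits.map_bitValue (h : IsFairBits P b) :
    P.map (fun ω => bitValue fun i => b i ω) = volume.restrict (Set.Ioo 0 1) := by
  have := h.isProbabilityMeasure
  have hm : Measurable fun ω => bitValue fun i => b i ω :=
    measurable_bitValue.comp (measurable_pi_lambda _ h.measurable)
  have := Measure.isProbabilityMeasure_map (μ := P) hm.aemeasurable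
  refine Measure.ext_of_Iic _ _ fun y => ?_
  rw [← ENNReal.toReal_eq_toReal_iff' (measure_ne_top _ _) (measure_ne_top _ _),
    Measure.map_apply hm measurableSet_Iic, Measure.restrict_apply measurableSet_Iic]
  change P.real _ = volume.real _
  have h0 : ∀ ω, 0 ≤ bitValue fun i => b i ω := fun ω => by
    simpa [bitPrefix] using bitPrefix_div_le (fun i => b i ω) 0
  have h1 : ∀ ω, (bitValue fun i => b i ω) ≤ 1 := fun ω => by
    simpa [bitPrefix] using bitValue_le (fun i => b i ω) 0
  rcases lt_or_ge y 0 with hy | hy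
  · have e1 : (fun ω => bitValue fun i => b i ω) ⁻¹' Set.Iic y = ∅ := by
      ext ω; simp only [Set.mem_preimage, Set.mem_Iic, Set.mem_empty_iff_false, iff_false, not_le]
      exact hy.trans_le (h0 ω)
    have e2 : Set.Iic y ∩ Set.Ioo 0 1 = ∅ := by
      ext z; simp only [Set.mem_inter_iff, Set.mem_Iic, Set.mem_Ioo, Set.mem_empty_iff_false,
        iff_false]; rintro ⟨h2, h3, -⟩; linarith
    rw [e1, e2]; simp
  rcases le_or_gt 1 y with hy1 | hy1
  · have e1 : (fun ω => bitValue fun i => b i ω) ⁻¹' Set.Iic y = Set.univ := by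
      ext ω; simp [(h1 ω).trans hy1]
    have e2 : Set.Iic y ∩ Set.Ioo 0 1 = Set.Ioo 0 1 := by
      ext z; simp only [Set.mem_inter_iff, Set.mem_Iic, Set.mem_Ioo, and_iff_right_iff_imp]
      rintro ⟨-, h3⟩; linarith
    rw [e1, e2]; simp
  have e2 : Set.Iic y ∩ Set.Ioo 0 1 = Set.Ioc 0 y := by
    ext z; simp only [Set.mem_inter_iff, Set.mem_Iic, Set.mem_Ioo, Set.mem_Ioc]
    constructor
    · tauto
    · rintro ⟨h2, h3⟩; exact ⟨h3, h2, by linarith⟩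
  rw [e2, Real.volume_real_Ioc_of_le hy, sub_zero]
  have key : ∀ L : ℕ, |P.real ((fun ω => bitValue fun i => b i ω) ⁻¹' Set.Iic y) - y| ≤
      (1 / 2 : ℝ) ^ L := by
    intro L
    have hp : (0 : ℝ) < 2 ^ L := by positivity
    set k := ⌊2 ^ L * y⌋₊
    have hk1 : (k : ℝ) ≤ 2 ^ L * y := Nat.floor_le (by positivity)
    have hk2 : 2 ^ L * y < k + 1 := Nat.lt_floor_add_one _
    have hk3 : k < 2 ^ L := by
      rw [Nat.floor_lt (by positivity)]; push_cast; nlinarith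
    have l1 : (k : ℝ) / 2 ^ L ≤ P.real ((fun ω => bitValue fun i => b i ω) ⁻¹' Set.Iic y) := by
      rw [← h.measure_bitPrefix_lt hk3.le]
      refine measureReal_mono fun ω (hω : bitPrefix _ L < k) => ?_
      refine (bitValue_le _ L).trans ?_
      rw [div_le_iff₀ hp]
      have : (bitPrefix (fun i => b i ω) L + 1 : ℝ) ≤ k := by exact_mod_cast hω
      linarith
    have l2 : P.real ((fun ω => bitValue fun i => b i ω) ⁻¹' Set.Iic y) ≤
        ((k + 1 : ℕ) : ℝ) / 2 ^ L := by
      rw [← h.measure_bitPrefix_lt (by omega : k + 1 ≤ 2 ^ L)]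
      refine measureReal_mono fun ω (hω : bitValue _ ≤ y) => ?_
      have h3 := (bitPrefix_div_le (fun i => b i ω) L).trans hω
      rw [div_le_iff₀ hp] at h3
      have : (bitPrefix (fun i => b i ω) L : ℝ) < ((k + 1 : ℕ) : ℝ) := by push_cast; linarith
      exact_mod_cast this
    have l3 : y - (1 / 2 : ℝ) ^ L ≤ (k : ℝ) / 2 ^ L := by
      rw [le_div_iff₀ hp, sub_mul, ← mul_pow]; norm_num; linarith
    have l4 : ((k + 1 : ℕ) : ℝ) / 2 ^ L ≤ y + (1 / 2 : ℝ) ^ L := by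
      rw [div_le_iff₀ hp, add_mul, ← mul_pow]; push_cast; norm_num; linarith
    rw [abs_le]; constructor <;> linarith
  have hlim := tendsto_pow_atTop_nhds_zero_of_lt_one (r := (1 / 2 : ℝ)) (by norm_num) (by norm_num)
  have := ge_of_tendsto' hlim key
  linarith [abs_nonpos_iff.1 this]

variable {D : ℕ} {ξ : Fin D × List Bool → Ω → Bool}

/-- For a fixed point the sites are distinct, so the digits use different bits, and adding a
deterministic digit to a fair bit leaves it fair. -/
lemma IsFairBits.isFairBits_scrambledDigits (h : IsFairBits P ξ) (x : Fin D → ℝ) :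
    IsFairBits P fun q ω => scrambledDigits ξ x ω q := by
  have := h.isProbabilityMeasure
  have h1 := h.precomp (scrambleSite x).injective
  refine ⟨h.measurable_scrambledDigits x, fun q => ?_,
    h1.indep.comp (fun q c => xor (digits x q) c) fun _ => measurable_of_countable _⟩
  have h2 : P {ω | ξ (scrambleSite x q) ω = true} = 1 / 2 := h.fair _
  cases hd : digits x q
  · simpa [scrambledDigits, hd] using h2
  · have e : {ω | scrambledDigits ξ x ω q = true} =
        {ω | ξ (scrambleSite x q) ω = true}ᶜ := by
      ext ω; simp [scrambledDigits, hd]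
    have hm : MeasurableSet {ω | ξ (scrambleSite x q) ω = true} :=
      h.measurable _ (measurableSet_singleton true)
    rw [e, prob_compl_eq_one_sub hm, h2]
    simp

lemma IsFairBits.measurable_scrambledPoint (h : IsFairBits P ξ) (x : Fin D → ℝ) :
    Measurable (scrambledPoint ξ x) :=
  measurable_pi_lambda _ fun j =>
    measurable_bitValue.comp (measurable_pi_lambda _ fun i => h.measurable_scrambledDigits x (j, i))

lemma IsFairBits.map_scrambledPoint_apply (h : IsFairBits P ξ) (x : Fin D → ℝ) (j : Fin D) :
    P.map (fun ω => scrambledPoint ξ x ω j) = volume.restrict (Set.Ioo 0 1) :=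
  ((h.isFairBits_scrambledDigits x).precomp (g := fun i => (j, i))
    (fun a b hab => by simpa using hab)).map_bitValue

/-- A scrambled point is uniformly distributed. -/
theorem IsFairBits.map_scrambledPoint (h : IsFairBits P ξ) (x : Fin D → ℝ) :
    P.map (scrambledPoint ξ x) = volume.restrict (openCube D) := by
  have hi := (h.isFairBits_scrambledDigits x).iIndepFun_curry.comp (fun _ => bitValue)
    fun _ => measurable_bitValue
  have h2 := hi.map_fun_eq_pi_map fun j => (measurable_bitValue.comp
    (measurable_pi_lambda _ fun i => h.measurable_scrambledDigits x (j, i))).aemeasurable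
  change P.map (scrambledPoint ξ x) = Measure.pi fun j => P.map fun ω => scrambledPoint ξ x ω j at h2
  rw [h2]
  simp_rw [h.map_scrambledPoint_apply]
  rw [volume_pi, openCube, Measure.restrict_pi_pi]

/-- Almost surely, the scrambled digits are the digits of the scrambled point. -/
theorem IsFairBits.ae_digits_scrambledPoint (h : IsFairBits P ξ) (x : Fin D → ℝ) :
    ∀ᵐ ω ∂P, digits (scrambledPoint ξ x ω) = scrambledDigits ξ x ω := by
  -- Digits can be misread only at dyadic rationals, a countable set that the uniform law does not
  -- charge.
  have key : ∀ (j : Fin D) (i c : ℕ), ∀ᵐ ω ∂P,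
      scrambledPoint ξ x ω j ≠ (c + 1 : ℝ) / 2 ^ (i + 1) := by
    intro j i c
    have hm : Measurable fun ω => scrambledPoint ξ x ω j :=
      (measurable_pi_apply j).comp (h.measurable_scrambledPoint x)
    have h1 : ∀ᵐ z ∂(P.map fun ω => scrambledPoint ξ x ω j), z ≠ (c + 1 : ℝ) / 2 ^ (i + 1) := by
      rw [h.map_scrambledPoint_apply]
      exact Measure.ae_ne _ _
    exact ae_of_ae_map hm.aemeasurable h1
  have key' := ae_all_iff.2 fun j => ae_all_iff.2 fun i => ae_all_iff.2 fun c => key j i c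
  filter_upwards [key'] with ω hω
  ext ⟨j, i⟩
  exact binaryDigit_bitValue (b := fun i => scrambledDigits ξ x ω (j, i)) (hω j i _)

end

end FourierRQMC

namespace FourierRQMC

/-! ### Walsh expansions -/

lemma floor_two_pow_succ_div_two (x : ℝ) (i : ℕ) : ⌊2 ^ (i + 1) * x⌋₊ / 2 = ⌊2 ^ i * x⌋₊ := by
  have := Nat.floor_div_natCast (2 ^ (i + 1) * x) 2
  rw [← this]
  congr 1
  push_cast
  rw [pow_succ]; ring

lemma bitPrefix_binaryDigit {x : ℝ} (hx : x ∈ Set.Ico (0 : ℝ) 1) (L : ℕ) :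
    bitPrefix (binaryDigit x) L = ⌊2 ^ L * x⌋₊ := by
  induction L with
  | zero =>
    symm
    rw [bitPrefix, Nat.floor_eq_zero]
    simpa using hx.2
  | succ L ih =>
    rw [bitPrefix, ih, ← floor_two_pow_succ_div_two, binaryDigit]
    rcases Nat.mod_two_eq_zero_or_one ⌊2 ^ (L + 1) * x⌋₊ with h | h <;> simp [h] <;> omega

lemma digitWord_eq_iff_floor_eq {x y : ℝ} (hx : x ∈ Set.Ico (0 : ℝ) 1)
    (hy : y ∈ Set.Ico (0 : ℝ) 1) {L : ℕ} :
    digitWord x L = digitWord y L ↔ ⌊2 ^ L * x⌋₊ = ⌊2 ^ L * y⌋₊ := by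
  rw [digitWord_eq_iff, ← bitPrefix_eq_iff, bitPrefix_binaryDigit hx, bitPrefix_binaryDigit hy]

lemma abs_sub_lt_of_digits {x y : ℝ} (hx : x ∈ Set.Ico (0 : ℝ) 1) (hy : y ∈ Set.Ico (0 : ℝ) 1)
    {L : ℕ} (h : ∀ i < L, binaryDigit x i = binaryDigit y i) : |x - y| < (1 / 2) ^ L := by
  have h1 := (digitWord_eq_iff_floor_eq hx hy).1 (digitWord_eq_iff.2 h)
  have hp : (0 : ℝ) < 2 ^ L := by positivity
  have hx1 := Nat.floor_le (mul_nonneg hp.le hx.1)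
  have hx2 := Nat.lt_floor_add_one (2 ^ L * x)
  have hy1 := Nat.floor_le (mul_nonneg hp.le hy.1)
  have hy2 := Nat.lt_floor_add_one (2 ^ L * y)
  rw [h1] at hx1 hx2
  have h3 : 2 ^ L * |x - y| < 1 := by
    have : 2 ^ L * |x - y| = |2 ^ L * x - 2 ^ L * y| := by
      rw [← mul_sub, abs_mul, abs_of_pos hp]
    rw [this, abs_lt]
    constructor <;> linarith
  rw [div_pow, one_pow, lt_div_iff₀ hp]
  linarith

lemma measurable_binaryDigit (i : ℕ) : Measurable fun x => binaryDigit x i := by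
  have h1 : Measurable fun x : ℝ => ⌊2 ^ (i + 1) * x⌋₊ :=
    Nat.measurable_floor.comp (measurable_const_mul _)
  exact (measurable_of_countable fun n : ℕ => decide (n % 2 = 1)).comp h1

variable {D : ℕ}

lemma measurable_walsh_digits (S : Finset (Fin D × ℕ)) : Measurable fun y => walsh S (digits y) :=
  Finset.measurable_fun_prod _ fun q _ => measurable_bitSign.comp
    ((measurable_binaryDigit q.2).comp (measurable_pi_apply q.1))

instance isProbabilityMeasure_openCube :
    IsProbabilityMeasure (volume.restrict (openCube D)) := by
  constructor
  rw [Measure.restrict_apply_univ, openCube, Real.volume_pi_Ioo]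
  simp

lemma measurableSet_openCube : MeasurableSet (openCube D) :=
  MeasurableSet.univ_pi fun _ => measurableSet_Ioo

lemma isOpen_openCube : IsOpen (openCube D) :=
  isOpen_set_pi Set.finite_univ fun _ _ => isOpen_Ioo

/-- The first `L` digits of each coordinate. -/
def digitIndex (D L : ℕ) : Finset (Fin D × ℕ) := Finset.univ ×ˢ Finset.range L

/-- The Walsh coefficients of a function on the unit cube. -/
noncomputable def walshCoeff (f : (Fin D → ℝ) → ℝ) (S : Finset (Fin D × ℕ)) : ℝ :=
  ∫ y in openCube D, f y * walsh S (digits y)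

lemma integrable_mul_walsh {f : (Fin D → ℝ) → ℝ} {μ : Measure (Fin D → ℝ)} (hf : Integrable f μ)
    (S : Finset (Fin D × ℕ)) : Integrable (fun y => f y * walsh S (digits y)) μ :=
  hf.mul_bdd (measurable_walsh_digits S).aestronglyMeasurable
    (.of_forall fun y => (abs_walsh S (digits y)).le)

/-! ### Orthonormality, Walsh expansion and the mean square error. -/

section

variable {Ω : Type*} [MeasurableSpace Ω] {P : Measure Ω} {ξ : Fin D × List Bool → Ω → Bool}

lemma IsFairBits.measurePreserving (h : IsFairBits P ξ) (x : Fin D → ℝ) :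
    MeasurePreserving (scrambledPoint ξ x) P (volume.restrict (openCube D)) :=
  ⟨h.measurable_scrambledPoint x, h.map_scrambledPoint x⟩

lemma IsFairBits.integral_comp (h : IsFairBits P ξ) (x : Fin D → ℝ) {f : (Fin D → ℝ) → ℝ}
    (hf : AEStronglyMeasurable f (volume.restrict (openCube D))) :
    ∫ ω, f (scrambledPoint ξ x ω) ∂P = ∫ y in openCube D, f y := by
  rw [← h.map_scrambledPoint x, integral_map (h.measurable_scrambledPoint x).aemeasurable
    (by rwa [h.map_scrambledPoint x])]

lemma IsFairBits.ae_mem_openCube (h : IsFairBits P ξ) (x : Fin D → ℝ) :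
    ∀ᵐ ω ∂P, scrambledPoint ξ x ω ∈ openCube D :=
  (h.measurePreserving x).quasiMeasurePreserving.ae (ae_restrict_mem measurableSet_openCube)

/-- Orthonormality is read off from the scrambling: the scrambled point of `0` is uniform, so the
integral is a second moment at two equal points, where the agreement condition is automatic. -/
lemma IsFairBits.integral_walsh_mul_walsh_openCube [DecidableEq (Finset (Fin D × ℕ))]
    (h : IsFairBits P ξ) (S T : Finset (Fin D × ℕ)) :
    ∫ y in openCube D, walsh S (digits y) * walsh T (digits y) = if S = T then 1 else 0 := by
  rw [← h.integral_comp 0 (f := fun y => walsh S (digits y) * walsh T (digits y))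
    ((measurable_walsh_digits S).mul (measurable_walsh_digits T)).aestronglyMeasurable]
  have : ∫ ω, walsh S (digits (scrambledPoint ξ 0 ω)) * walsh T (digits (scrambledPoint ξ 0 ω)) ∂P
      = ∫ ω, walsh S (scrambledDigits ξ 0 ω) * walsh T (scrambledDigits ξ 0 ω) ∂P := by
    refine integral_congr_ae ?_
    filter_upwards [h.ae_digits_scrambledPoint 0] with ω hω
    rw [hω]
  rw [this, h.integral_walsh_mul_walsh]
  by_cases hST : S = T
  · simp [hST, walsh_mul_self]
  · simp [hST]

/-- Bessel's inequality for the Walsh system. -/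
lemma IsFairBits.sum_walshCoeff_sq_le (h : IsFairBits P ξ) {f : (Fin D → ℝ) → ℝ}
    (hf : MemLp f 2 (volume.restrict (openCube D))) (F : Finset (Finset (Fin D × ℕ))) :
    ∑ S ∈ F, walshCoeff f S ^ 2 ≤ ∫ y in openCube D, f y ^ 2 := by
  classical
  have hfi : Integrable f (volume.restrict (openCube D)) := hf.integrable (by norm_num)
  set g : (Fin D → ℝ) → ℝ := fun y => ∑ S ∈ F, walshCoeff f S * walsh S (digits y)
  have hw : ∀ S : Finset (Fin D × ℕ),
      MemLp (fun y => walsh S (digits y)) 2 (volume.restrict (openCube D)) := fun S =>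
    MemLp.of_bound (measurable_walsh_digits S).aestronglyMeasurable 1
      (.of_forall fun y => (abs_walsh S (digits y)).le)
  have hg : MemLp g 2 (volume.restrict (openCube D)) :=
    memLp_finsetSum _ fun S _ => (hw S).const_mul _
  have h1 : ∫ y in openCube D, f y * g y = ∑ S ∈ F, walshCoeff f S ^ 2 := by
    simp only [g, Finset.mul_sum]
    rw [integral_finsetSum _ fun S _ => by
      simpa [mul_left_comm] using (integrable_mul_walsh hfi S).const_mul (walshCoeff f S)]
    refine Finset.sum_congr rfl fun S _ => ?_
    simp_rw [mul_left_comm (f _), integral_const_mul, sq]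
    rfl
  have h2 : ∫ y in openCube D, g y * g y = ∑ S ∈ F, walshCoeff f S ^ 2 := by
    have e : ∀ y, g y * g y = ∑ S ∈ F, ∑ T ∈ F, (walshCoeff f S * walshCoeff f T) *
        (walsh S (digits y) * walsh T (digits y)) := fun y => by
      simp only [g, Finset.sum_mul_sum]
      refine Finset.sum_congr rfl fun S _ => Finset.sum_congr rfl fun T _ => by ring
    have hi : ∀ S T : Finset (Fin D × ℕ), Integrable (fun y => (walshCoeff f S * walshCoeff f T) *
        (walsh S (digits y) * walsh T (digits y))) (volume.restrict (openCube D)) := fun S T =>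
      ((hw S).integrable_mul (hw T)).const_mul _
    simp_rw [e]
    rw [integral_finsetSum _ fun S _ => integrable_finsetSum _ fun T _ => hi S T]
    refine Finset.sum_congr rfl fun S hS => ?_
    rw [integral_finsetSum _ fun T _ => hi S T]
    simp_rw [integral_const_mul, h.integral_walsh_mul_walsh_openCube]
    simp [hS, sq]
  have h3 : 0 ≤ ∫ y in openCube D, (f y - g y) ^ 2 := integral_nonneg fun y => sq_nonneg _
  have h4 : ∫ y in openCube D, (f y - g y) ^ 2 =
      ∫ y in openCube D, (f y ^ 2 - 2 * (f y * g y) + g y * g y) := by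
    congr 1; ext y; ring
  have hfg : IntegrableOn (fun y => 2 * (f y * g y)) (openCube D) :=
    (hf.integrable_mul hg).const_mul 2
  have hgg : IntegrableOn (fun y => g y * g y) (openCube D) := hg.integrable_mul hg
  have hsub : IntegrableOn (fun y => f y ^ 2 - 2 * (f y * g y)) (openCube D) :=
    hf.integrable_sq.sub hfg
  rw [h4, integral_add hsub hgg, integral_sub hf.integrable_sq hfg,
    integral_const_mul, h1, h2] at h3
  linarith

/-- The Walsh expansion of an integrable function converges at points of continuity. -/
lemma IsFairBits.tendsto_walsh_sum (h : IsFairBits P ξ) {f : (Fin D → ℝ) → ℝ}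
    (hf : IntegrableOn f (openCube D)) {x : Fin D → ℝ} (hx : x ∈ openCube D)
    (hfx : ContinuousAt f x) :
    Tendsto (fun L => ∑ S ∈ (digitIndex D L).powerset, walshCoeff f S * walsh S (digits x))
      atTop (𝓝 (f x)) := by
  classical
  -- The partial sum is the integral of `f` against this kernel, which is nonnegative, has mass one
  -- and vanishes off the dyadic cell of `x` with side `2 ^ (-L)`: an approximate identity.
  set K : ℕ → (Fin D → ℝ) → ℝ := fun L y =>
    ∑ S ∈ (digitIndex D L).powerset, walsh S (digits x) * walsh S (digits y)
  have hK : ∀ L y, K L y = ∏ q ∈ digitIndex D L,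
      (1 + bitSign (digits x q) * bitSign (digits y q)) := fun L y =>
    (prod_one_add_bitSign _ _ _).symm
  have hK0 : ∀ L y, 0 ≤ K L y := fun L y => by
    rw [hK]
    refine Finset.prod_nonneg fun q _ => ?_
    have := neg_abs_le (bitSign (digits x q) * bitSign (digits y q))
    rw [abs_mul, abs_bitSign, abs_bitSign] at this
    linarith
  have hKm : ∀ L, Measurable (K L) := fun L =>
    Finset.measurable_fun_sum _ fun S _ => (measurable_walsh_digits S).const_mul _
  have hKb : ∀ L y, ‖K L y‖ ≤ (digitIndex D L).powerset.card := fun L y => by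
    refine (norm_sum_le _ _).trans ?_
    simp [abs_walsh]
  have hK1 : ∀ L, ∫ y in openCube D, K L y = 1 := fun L => by
    have e : ∀ y, K L y = ∑ S ∈ (digitIndex D L).powerset, walsh S (digits x) *
      (walsh S (digits y) * walsh ∅ (digits y)) := by simp [K]
    simp_rw [e]
    rw [integral_finsetSum _ fun S _ => ?_]
    · simp_rw [integral_const_mul, h.integral_walsh_mul_walsh_openCube]
      simp
    · simpa using ((integrable_mul_walsh (integrable_const (1 : ℝ)) S).const_mul
        (walsh S (digits x)))
  have hKi : ∀ L, IntegrableOn (K L) (openCube D) := fun L =>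
    Integrable.of_bound (hKm L).aestronglyMeasurable _ (.of_forall (hKb L))
  have hfK : ∀ L, IntegrableOn (fun y => f y * K L y) (openCube D) := fun L =>
    Integrable.mul_bdd hf (hKm L).aestronglyMeasurable (.of_forall (hKb L))
  have hsum : ∀ L, ∑ S ∈ (digitIndex D L).powerset, walshCoeff f S * walsh S (digits x) =
      ∫ y in openCube D, f y * K L y := fun L => by
    simp only [K, Finset.mul_sum]
    rw [integral_finsetSum _ fun S _ => by
      simpa [mul_left_comm] using (integrable_mul_walsh hf S).const_mul (walsh S (digits x))]
    refine Finset.sum_congr rfl fun S _ => ?_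
    simp_rw [mul_left_comm (f _), integral_const_mul]
    rw [mul_comm]; rfl
  rw [Metric.tendsto_atTop]
  intro ε hε
  obtain ⟨δ, hδ, hδf⟩ := Metric.continuousAt_iff.1 hfx (ε / 2) (by positivity)
  obtain ⟨L₀, hL₀⟩ := exists_pow_lt_of_lt_one hδ (by norm_num : (1 / 2 : ℝ) < 1)
  refine ⟨L₀, fun L hL => ?_⟩
  rw [hsum, Real.dist_eq]
  have e1 : (∫ y in openCube D, f y * K L y) - f x = ∫ y in openCube D, (f y - f x) * K L y := by
    simp_rw [sub_mul]
    rw [integral_sub (hfK L) ((hKi L).const_mul _), integral_const_mul, hK1, mul_one]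
  have hcube : ∀ {y : Fin D → ℝ}, y ∈ openCube D → ∀ j, y j ∈ Set.Ico (0 : ℝ) 1 :=
    fun hy j => Set.Ioo_subset_Ico_self (hy j trivial)
  rw [e1]
  calc |∫ y in openCube D, (f y - f x) * K L y|
      ≤ ∫ y in openCube D, ε / 2 * K L y := by
        rw [← Real.norm_eq_abs]
        refine norm_integral_le_of_norm_le ((hKi L).const_mul _) ?_
        filter_upwards [ae_restrict_mem measurableSet_openCube] with y hy
        rw [norm_mul, Real.norm_of_nonneg (hK0 L y)]
        rcases (hK0 L y).eq_or_lt with h0 | h0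
        · rw [← h0]; simp
        refine mul_le_mul_of_nonneg_right ?_ h0.le
        rw [← dist_eq_norm]
        refine (hδf ?_).le
        refine lt_of_le_of_lt ?_ hL₀
        rw [dist_comm, dist_pi_le_iff (by positivity)]
        intro j
        refine (abs_sub_lt_of_digits (hcube hx j) (hcube hy j) fun i hi => ?_).le.trans
          (pow_le_pow_of_le_one (by norm_num) (by norm_num) hL)
        by_contra hne
        refine h0.ne' ?_
        rw [hK]
        refine Finset.prod_eq_zero (i := (j, i)) (by simp [digitIndex, hi]) ?_
        change 1 + bitSign (binaryDigit (x j) i) * bitSign (binaryDigit (y j) i) = 0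
        revert hne
        cases binaryDigit (x j) i <;> cases binaryDigit (y j) i <;> simp [bitSign]
    _ = ε / 2 := by rw [integral_const_mul, hK1, mul_one]
    _ < ε := by linarith

open Classical in
/-- The double sum over the point set that governs the contribution of the Walsh function `S`
to the variance of the scrambled average. -/
noncomputable def gainSum (N : ℕ) (v : ℕ → Fin D → ℝ) (S : Finset (Fin D × ℕ)) : ℝ :=
  ∑ n ∈ Finset.range N, ∑ n' ∈ Finset.range N,
    if ∀ q ∈ S, digitWord (v n q.1) q.2 = digitWord (v n' q.1) q.2 then
      walsh S (digits (v n)) * walsh S (digits (v n')) else 0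

/-- All cross terms between different index sets vanish, so the second moment is diagonal in the
Walsh coefficients. -/
lemma IsFairBits.integral_sq_walsh_average (h : IsFairBits P ξ) (N : ℕ) (v : ℕ → Fin D → ℝ)
    (F : Finset (Finset (Fin D × ℕ))) (c : Finset (Fin D × ℕ) → ℝ) :
    ∫ ω, ((N : ℝ)⁻¹ * ∑ n ∈ Finset.range N,
      ∑ S ∈ F, c S * walsh S (scrambledDigits ξ (v n) ω)) ^ 2 ∂P =
      (N : ℝ)⁻¹ ^ 2 * ∑ S ∈ F, c S ^ 2 * gainSum N v S := by
  classical
  have := h.isProbabilityMeasure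
  have e : ∀ ω, ((N : ℝ)⁻¹ * ∑ n ∈ Finset.range N,
      ∑ S ∈ F, c S * walsh S (scrambledDigits ξ (v n) ω)) ^ 2 = (N : ℝ)⁻¹ ^ 2 *
      ∑ n ∈ Finset.range N, ∑ n' ∈ Finset.range N, ∑ S ∈ F, ∑ T ∈ F, (c S * c T) *
        (walsh S (scrambledDigits ξ (v n) ω) * walsh T (scrambledDigits ξ (v n') ω)) := by
    intro ω
    rw [mul_pow, sq (∑ n ∈ Finset.range N, _), Finset.sum_mul_sum]
    simp_rw [Finset.sum_mul_sum]
    congr 1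
    refine Finset.sum_congr rfl fun n _ => Finset.sum_congr rfl fun n' _ =>
      Finset.sum_congr rfl fun S _ => Finset.sum_congr rfl fun T _ => by ring
  have hi : ∀ n n' S T, Integrable (fun ω => (c S * c T) *
      (walsh S (scrambledDigits ξ (v n) ω) * walsh T (scrambledDigits ξ (v n') ω))) P := by
    intro n n' S T
    refine Integrable.const_mul (Integrable.of_bound
      ((h.measurable_walsh _ S).mul (h.measurable_walsh _ T)).aestronglyMeasurable 1
      (.of_forall fun ω => ?_)) _
    simp [abs_walsh]
  simp_rw [e]
  rw [integral_const_mul, integral_finsetSum _ fun n _ => integrable_finsetSum _ fun n' _ =>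
    integrable_finsetSum _ fun S _ => integrable_finsetSum _ fun T _ => hi n n' S T]
  congr 1
  have e2 : ∀ n n', ∫ ω, ∑ S ∈ F, ∑ T ∈ F, (c S * c T) *
      (walsh S (scrambledDigits ξ (v n) ω) * walsh T (scrambledDigits ξ (v n') ω)) ∂P =
      ∑ S ∈ F, c S ^ 2 * if ∀ q ∈ S, digitWord (v n q.1) q.2 = digitWord (v n' q.1) q.2 then
      walsh S (digits (v n)) * walsh S (digits (v n')) else 0 := by
    intro n n'
    rw [integral_finsetSum _ fun S _ => integrable_finsetSum _ fun T _ => hi n n' S T]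
    refine Finset.sum_congr rfl fun S hS => ?_
    rw [integral_finsetSum _ fun T _ => hi n n' S T]
    simp_rw [integral_const_mul, h.integral_walsh_mul_walsh]
    rw [Finset.sum_eq_single S (fun T _ hT => by simp [hT.symm]) (fun h => absurd hS h)]
    simp [sq]
  calc _ = ∑ n ∈ Finset.range N, ∑ n' ∈ Finset.range N, ∑ S ∈ F, c S ^ 2 *
        if ∀ q ∈ S, digitWord (v n q.1) q.2 = digitWord (v n' q.1) q.2 then
        walsh S (digits (v n)) * walsh S (digits (v n')) else 0 := by
        refine Finset.sum_congr rfl fun n _ => ?_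
        rw [integral_finsetSum _ fun n' _ => integrable_finsetSum _ fun S _ =>
          integrable_finsetSum _ fun T _ => hi n n' S T]
        exact Finset.sum_congr rfl fun n' _ => e2 n n'
    _ = _ := by
        simp_rw [gainSum, Finset.mul_sum]
        simp_rw [Finset.sum_comm (s := Finset.range N) (t := F)]

/-- The mean square error of a scrambled average, bounded through the Walsh coefficients. -/
theorem IsFairBits.lintegral_sq_error_le (h : IsFairBits P ξ) {N : ℕ} (hN : N ≠ 0)
    (v : ℕ → Fin D → ℝ) {f : (Fin D → ℝ) → ℝ} (hf : IntegrableOn f (openCube D))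
    (hfc : ContinuousOn f (openCube D)) {B : ℝ}
    (hB : ∀ L, (N : ℝ)⁻¹ ^ 2 * ∑ S ∈ (digitIndex D L).powerset.erase ∅,
      walshCoeff f S ^ 2 * gainSum N v S ≤ B) :
    ∫⁻ ω, ENNReal.ofReal (((N : ℝ)⁻¹ * ∑ n ∈ Finset.range N, f (scrambledPoint ξ (v n) ω) -
      ∫ y in openCube D, f y) ^ 2) ∂P ≤ ENNReal.ofReal B := by
  classical
  have := h.isProbabilityMeasure
  -- The error of the truncated expansion: the empty index set is removed because its coefficient is
  -- the integral of `f`.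
  set G : ℕ → Ω → ℝ := fun L ω => (N : ℝ)⁻¹ * ∑ n ∈ Finset.range N,
      ∑ S ∈ (digitIndex D L).powerset.erase ∅,
        walshCoeff f S * walsh S (scrambledDigits ξ (v n) ω)
  have hGm : ∀ L, Measurable (G L) := fun L =>
    (Finset.measurable_fun_sum _ fun n _ => Finset.measurable_fun_sum _ fun S _ =>
      (h.measurable_walsh _ S).const_mul _).const_mul _
  have hG : ∀ L, ∫⁻ ω, ENNReal.ofReal (G L ω ^ 2) ∂P ≤ ENNReal.ofReal B := by
    intro L
    rw [← ofReal_integral_eq_lintegral_ofReal ?_ (.of_forall fun ω => sq_nonneg _)]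
    · refine ENNReal.ofReal_le_ofReal ?_
      simp only [G]
      rw [h.integral_sq_walsh_average]
      exact hB L
    · refine Integrable.of_bound ((hGm L).pow_const 2).aestronglyMeasurable
        (((N : ℝ)⁻¹ * ∑ n ∈ Finset.range N, ∑ S ∈ (digitIndex D L).powerset.erase ∅,
          |walshCoeff f S|) ^ 2) (.of_forall fun ω => ?_)
      rw [norm_pow, Real.norm_eq_abs]
      refine pow_le_pow_left₀ (abs_nonneg _) ?_ 2
      simp only [G]
      rw [abs_mul, abs_of_nonneg (by positivity : (0 : ℝ) ≤ (N : ℝ)⁻¹)]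
      gcongr
      refine (Finset.abs_sum_le_sum_abs _ _).trans (Finset.sum_le_sum fun n _ => ?_)
      refine (Finset.abs_sum_le_sum_abs _ _).trans (Finset.sum_le_sum fun S _ => ?_)
      rw [abs_mul, abs_walsh, mul_one]
  have hlim : ∀ᵐ ω ∂P, Tendsto (fun L => ENNReal.ofReal (G L ω ^ 2)) atTop
      (𝓝 (ENNReal.ofReal (((N : ℝ)⁻¹ * ∑ n ∈ Finset.range N, f (scrambledPoint ξ (v n) ω) -
      ∫ y in openCube D, f y) ^ 2))) := by
    have h1 := ae_all_iff.2 fun n => h.ae_mem_openCube (v n)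
    have h2 := ae_all_iff.2 fun n => h.ae_digits_scrambledPoint (v n)
    filter_upwards [h1, h2] with ω hω1 hω2
    refine (ENNReal.continuous_ofReal.tendsto _).comp (Tendsto.pow ?_ 2)
    have e : ∀ L, G L ω = (N : ℝ)⁻¹ * ∑ n ∈ Finset.range N,
        (∑ S ∈ (digitIndex D L).powerset,
          walshCoeff f S * walsh S (digits (scrambledPoint ξ (v n) ω))) -
        ∫ y in openCube D, f y := by
      intro L
      have hc : walshCoeff f ∅ = ∫ y in openCube D, f y := by simp [walshCoeff]
      have he : ∀ n, ∑ S ∈ (digitIndex D L).powerset.erase ∅,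
          walshCoeff f S * walsh S (scrambledDigits ξ (v n) ω) =
          (∑ S ∈ (digitIndex D L).powerset,
            walshCoeff f S * walsh S (digits (scrambledPoint ξ (v n) ω))) -
          ∫ y in openCube D, f y := by
        intro n
        rw [hω2 n, ← Finset.add_sum_erase _ _ (Finset.empty_mem_powerset _), walsh_empty, hc]
        ring
      simp only [G, he]
      rw [Finset.sum_sub_distrib]
      have : (N : ℝ) ≠ 0 := by exact_mod_cast hN
      simp only [Finset.sum_const, Finset.card_range, nsmul_eq_mul]
      field_simp
    simp_rw [e]
    refine Tendsto.sub_const (Tendsto.const_mul _ (tendsto_finsetSum _ fun n _ => ?_)) _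
    exact h.tendsto_walsh_sum hf (hω1 n) (hfc.continuousAt (isOpen_openCube.mem_nhds (hω1 n)))
  -- Fatou's lemma: almost surely all scrambled points are interior points of continuity, so the
  -- truncated errors converge pointwise, and only an upper bound for the limit is needed.
  calc _ = ∫⁻ ω, liminf (fun L => ENNReal.ofReal (G L ω ^ 2)) atTop ∂P :=
        lintegral_congr_ae (hlim.mono fun ω hω => hω.liminf_eq.symm)
    _ ≤ liminf (fun L => ∫⁻ ω, ENNReal.ofReal (G L ω ^ 2) ∂P) atTop :=
        lintegral_liminf_le fun L => ((hGm L).pow_const 2).ennreal_ofReal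
    _ ≤ ENNReal.ofReal B := liminf_le_of_le (by isBoundedDefault) fun b hb => by
        obtain ⟨L, hL⟩ := hb.exists
        exact hL.trans (hG L)

end

end FourierRQMC

namespace FourierRQMC

/-! ### Equidistribution and gain coefficients -/

lemma floor_two_pow_add_div (x : ℝ) (i k : ℕ) : ⌊2 ^ (i + k) * x⌋₊ / 2 ^ k = ⌊2 ^ i * x⌋₊ := by
  induction k with
  | zero => simp
  | succ k ih => rw [pow_succ', ← Nat.div_div_eq_div_mul, ← add_assoc,
      floor_two_pow_succ_div_two, ih]

lemma binaryDigit_eq_of_lt (x : ℝ) {i κ : ℕ} (hi : i < κ) :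
    binaryDigit x i = decide (⌊2 ^ κ * x⌋₊ / 2 ^ (κ - 1 - i) % 2 = 1) := by
  rw [binaryDigit, ← floor_two_pow_add_div x (i + 1) (κ - 1 - i)]
  have : i + 1 + (κ - 1 - i) = κ := by omega
  rw [this]

lemma mem_dyadic_Ico_iff {x : ℝ} (hx : 0 ≤ x) (e a : ℕ) :
    x ∈ Set.Ico ((a : ℝ) / 2 ^ e) (((a : ℝ) + 1) / 2 ^ e) ↔ ⌊2 ^ e * x⌋₊ = a := by
  have hp : (0 : ℝ) < 2 ^ e := by positivity
  rw [Nat.floor_eq_iff (by positivity), Set.mem_Ico, div_le_iff₀ hp, lt_div_iff₀ hp,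
    mul_comm x]

variable {D : ℕ}

/-- The indices of the dyadic cell of `x` with side lengths `2 ^ (-e j)`. -/
noncomputable def cellIndex (e : Fin D → ℕ) (x : Fin D → ℝ) (j : Fin D) : ℕ := ⌊2 ^ e j * x j⌋₊

lemma floor_two_pow_lt {x : ℝ} (hx : x ∈ Set.Ico (0 : ℝ) 1) (e : ℕ) : ⌊2 ^ e * x⌋₊ < 2 ^ e := by
  rw [← bitPrefix_binaryDigit hx]; exact bitPrefix_lt _ _

namespace IsDyadicSequence

variable {t : ℕ} {v : ℕ → Fin D → ℝ}

/-- The defining property concerns blocks of length `2 ^ q` with `q = t + ∑ j, e j`. The first `2 ^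
m` indices split into `2 ^ (m - q)` such blocks, each with `2 ^ t` points in the cell. -/
lemma card_cell (h : IsDyadicSequence t v) {m : ℕ} {e a : Fin D → ℕ} (he : t + ∑ j, e j ≤ m)
    (ha : ∀ j, a j < 2 ^ e j) :
    ((Finset.range (2 ^ m)).filter fun n => cellIndex e (v n) = a).card = 2 ^ (m - ∑ j, e j) := by
  set q := t + ∑ j, e j
  have hq : 0 < 2 ^ q := by positivity
  have hmq : 2 ^ m = 2 ^ (m - q) * 2 ^ q := by rw [← pow_add]; congr 1; omega
  rw [Finset.card_eq_sum_card_fiberwise (f := fun n => n / 2 ^ q) (t := Finset.range (2 ^ (m - q)))]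
  · have : ∀ b ∈ Finset.range (2 ^ (m - q)), (((Finset.range (2 ^ m)).filter
        fun n => cellIndex e (v n) = a).filter fun n => n / 2 ^ q = b).card = 2 ^ t := by
      intro b hb
      rw [← h.2 q b e a rfl ha, ← Set.ncard_coe_finset]
      congr 1
      ext n
      simp only [Finset.coe_filter, Finset.mem_filter, Finset.mem_range, Set.mem_ofPred_eq,
        Set.mem_Ico, Nat.div_eq_iff hq]
      rw [Finset.mem_range] at hb
      have hb' : (b + 1) * 2 ^ q ≤ 2 ^ m := by rw [hmq]; exact Nat.mul_le_mul_right _ hb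
      have hb'' : (b + 1) * 2 ^ q = b * 2 ^ q + 2 ^ q := by ring
      constructor
      · rintro ⟨⟨h1, h2⟩, h3, h4⟩
        exact ⟨⟨h3, by omega⟩, fun j => (mem_dyadic_Ico_iff (h.1 n j).1 _ _).2 (congrFun h2 j)⟩
      · rintro ⟨⟨h1, h2⟩, h3⟩
        exact ⟨⟨by omega, funext fun j => (mem_dyadic_Ico_iff (h.1 n j).1 _ _).1 (h3 j)⟩, h1,
          by omega⟩
    rw [Finset.sum_congr rfl this]
    simp only [Finset.sum_const, Finset.card_range, smul_eq_mul]
    rw [← pow_add]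
    congr 1
    omega
  · intro n hn
    have hn' : n < 2 ^ m := by simpa using (Finset.mem_filter.1 hn).1
    rw [Finset.mem_coe, Finset.mem_range, Nat.div_lt_iff_lt_mul hq, ← hmq]
    exact hn'

lemma sum_cellIndex (h : IsDyadicSequence t v) {m : ℕ} {e : Fin D → ℕ}
    (he : t + ∑ j, e j ≤ m) (g : (Fin D → ℕ) → ℝ) :
    ∑ n ∈ Finset.range (2 ^ m), g (cellIndex e (v n)) =
      2 ^ (m - ∑ j, e j) * ∑ a ∈ Fintype.piFinset fun j => Finset.range (2 ^ e j), g a := by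
  rw [← Finset.sum_fiberwise_of_maps_to (g := fun n => cellIndex e (v n))
    (t := Fintype.piFinset fun j => Finset.range (2 ^ e j)), Finset.mul_sum]
  · refine Finset.sum_congr rfl fun a ha => ?_
    rw [Finset.sum_congr rfl fun n hn => by rw [(Finset.mem_filter.1 hn).2], Finset.sum_const,
      h.card_cell he fun j => by simpa using Fintype.mem_piFinset.1 ha j]
    simp
  · intro n _
    rw [Fintype.mem_piFinset]
    exact fun j => Finset.mem_range.2 (floor_two_pow_lt (h.1 n j) _)

end IsDyadicSequence

/-- One more than the largest digit position in the coordinate `j` that occurs in `S`. -/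
def walshDepth (S : Finset (Fin D × ℕ)) (j : Fin D) : ℕ :=
  (S.filter fun q => q.1 = j).sup fun q => q.2 + 1

lemma lt_walshDepth {S : Finset (Fin D × ℕ)} {q : Fin D × ℕ} (hq : q ∈ S) :
    q.2 < walshDepth S q.1 :=
  Finset.le_sup (f := fun q : Fin D × ℕ => q.2 + 1) (Finset.mem_filter.2 ⟨hq, rfl⟩)

lemma mem_of_walshDepth_pos {S : Finset (Fin D × ℕ)} {j : Fin D} (h : 0 < walshDepth S j) :
    (j, walshDepth S j - 1) ∈ S := by
  have hne : (S.filter fun q => q.1 = j).Nonempty := by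
    by_contra hne
    rw [Finset.not_nonempty_iff_eq_empty] at hne
    simp [walshDepth, hne] at h
  obtain ⟨q, hq, hq2⟩ := Finset.exists_mem_eq_sup _ hne fun q => q.2 + 1
  rw [Finset.mem_filter] at hq
  have : q = (j, walshDepth S j - 1) := by
    ext
    · rw [hq.2]
    · simp [walshDepth, hq2]
  exact this ▸ hq.1

/-- Agreement of all digit words that occur in `S`. -/
lemma digitWord_agree_iff {S : Finset (Fin D × ℕ)} {x y : Fin D → ℝ} :
    (∀ q ∈ S, digitWord (x q.1) q.2 = digitWord (y q.1) q.2) ↔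
      ∀ j, digitWord (x j) (walshDepth S j - 1) = digitWord (y j) (walshDepth S j - 1) := by
  constructor
  · intro h j
    -- A coordinate absent from `S` has depth 0, and truncated subtraction then yields the empty
    -- word, on which any two points agree.
    rcases Nat.eq_zero_or_pos (walshDepth S j) with h0 | h0
    · simp [h0, digitWord]
    · exact h _ (mem_of_walshDepth_pos h0)
  · intro h q hq
    rw [digitWord_eq_iff]
    have h1 := digitWord_eq_iff.1 (h q.1)
    have h2 := lt_walshDepth hq
    exact fun l hl => h1 l (by omega)

/-- Lowering a positive entry by one lowers the sum by one, so all smaller sums are attained. This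
is used to enlarge a dyadic cell to a volume that the point set resolves. -/
lemma exists_le_sum_eq {ι : Type*} [Fintype ι] (e : ι → ℕ) {n : ℕ} (hn : n ≤ ∑ j, e j) :
    ∃ e' ≤ e, ∑ j, e' j = n := by
  classical
  obtain ⟨k, hk⟩ := Nat.exists_eq_add_of_le hn
  induction k generalizing e with
  | zero => exact ⟨e, le_rfl, hk⟩
  | succ k ih =>
    obtain ⟨j, -, hj⟩ : ∃ j ∈ Finset.univ, e j ≠ 0 := by
      by_contra! h0
      rw [Finset.sum_eq_zero h0] at hk
      omega
    have h1 : ∑ i, (Function.update e j (e j - 1)) i + 1 = ∑ i, e i := by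
      rw [Finset.sum_update_of_mem (Finset.mem_univ j), Finset.sdiff_singleton_eq_erase,
        ← Finset.add_sum_erase _ e (Finset.mem_univ j)]
      omega
    obtain ⟨e', he', hs⟩ := ih (Function.update e j (e j - 1)) (by omega) (by omega)
    refine ⟨e', he'.trans ?_, hs⟩
    exact update_le_self_iff.2 (Nat.sub_le _ _)

/-- Switching the last binary digit. -/
def flipLast (k : ℕ) : ℕ := if k % 2 = 0 then k + 1 else k - 1

lemma flipLast_div_two (k : ℕ) : flipLast k / 2 = k / 2 := by
  rw [flipLast]; split_ifs <;> omega

lemma flipLast_flipLast (k : ℕ) : flipLast (flipLast k) = k := by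
  simp only [flipLast]; split_ifs <;> omega

lemma flipLast_mod_two (k : ℕ) : flipLast k % 2 = 1 ↔ ¬ k % 2 = 1 := by
  rw [flipLast]; split_ifs <;> omega

lemma flipLast_lt {k κ : ℕ} (hκ : 0 < κ) (hk : k < 2 ^ κ) : flipLast k < 2 ^ κ := by
  obtain ⟨κ, rfl⟩ := Nat.exists_eq_succ_of_ne_zero hκ.ne'
  rw [Nat.pow_succ] at hk ⊢
  rw [flipLast]; split_ifs <;> omega

/-- Two indices contribute only if their points share the dyadic cell with sides `2 ^ (-(depth -
1))`. Such a cell contains at most `2 ^ (t + D)` of the points, and each contribution is a sign. -/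
lemma abs_gainSum_le {t : ℕ} {v : ℕ → Fin D → ℝ} (h : IsDyadicSequence t v) {m : ℕ} (hm : t ≤ m)
    {S : Finset (Fin D × ℕ)} (hS : m < t + ∑ j, walshDepth S j) :
    |gainSum (2 ^ m) v S| ≤ 2 ^ m * 2 ^ (t + D) := by
  classical
  set e : Fin D → ℕ := fun j => walshDepth S j - 1
  have hes : ∑ j, walshDepth S j ≤ ∑ j, e j + D := by
    have : ∑ j, walshDepth S j ≤ ∑ j, (e j + 1) :=
      Finset.sum_le_sum fun j _ => by simp only [e]; omega
    simpa [Finset.sum_add_distrib] using this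
  -- The cell is enlarged, if necessary, to volume `2 ^ (t - m)`, where it holds `2 ^ t` points.
  -- Otherwise the missing last digit of up to `D` coordinates costs at most a factor `2 ^ D`.
  obtain ⟨e', he', hs⟩ := exists_le_sum_eq e (min_le_left (∑ j, e j) (m - t))
  have hle : t + ∑ j, e' j ≤ m := by rw [hs]; omega
  rw [gainSum]
  refine (Finset.abs_sum_le_sum_abs _ _).trans ?_
  have key : ∀ n ∈ Finset.range (2 ^ m), |∑ n' ∈ Finset.range (2 ^ m),
      if ∀ q ∈ S, digitWord (v n q.1) q.2 = digitWord (v n' q.1) q.2 then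
      walsh S (digits (v n)) * walsh S (digits (v n')) else 0| ≤ (2 : ℝ) ^ (t + D) := by
    intro n _
    refine (Finset.abs_sum_le_sum_abs _ _).trans ?_
    calc _ ≤ ∑ n' ∈ Finset.range (2 ^ m),
          if cellIndex e' (v n') = cellIndex e' (v n) then (1 : ℝ) else 0 := by
          refine Finset.sum_le_sum fun n' _ => ?_
          split_ifs with h1 h2 h2
          · simp [abs_walsh]
          · refine absurd (funext fun j => ?_) h2
            rw [digitWord_agree_iff] at h1
            refine ((digitWord_eq_iff_floor_eq (h.1 n j) (h.1 n' j)).1 ?_).symm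
            exact digitWord_eq_iff.2 fun l hl => digitWord_eq_iff.1 (h1 j) l
              (hl.trans_le (he' j))
          · simp
          · simp
      _ = (2 : ℝ) ^ (m - ∑ j, e' j) := by
          rw [Finset.sum_ite, Finset.sum_const_zero, add_zero, Finset.sum_const, nsmul_eq_mul,
            mul_one, h.card_cell (a := cellIndex e' (v n)) hle fun j => floor_two_pow_lt (h.1 n j) _]
          push_cast; rfl
      _ ≤ 2 ^ (t + D) := pow_le_pow_right₀ (by norm_num) (by rw [hs]; omega)
  refine (Finset.sum_le_sum key).trans ?_
  simp

/-- If the points are equidistributed over the cells with sides `2 ^ (-depth)`, the inner sum is a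
multiple of a sum over all cells. Flipping the deepest digit of `S` in one coordinate keeps the
agreement condition, which involves earlier digits only, but reverses the sign of the Walsh
function, so the cells cancel in pairs. -/
lemma gainSum_eq_zero {t : ℕ} {v : ℕ → Fin D → ℝ} (h : IsDyadicSequence t v) {m : ℕ}
    {S : Finset (Fin D × ℕ)} (hne : S ≠ ∅) (hS : t + ∑ j, walshDepth S j ≤ m) :
    gainSum (2 ^ m) v S = 0 := by
  classical
  set κ := walshDepth S
  obtain ⟨q₀, hq₀⟩ := Finset.nonempty_iff_ne_empty.2 hne
  set j₀ := q₀.1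
  have hκ0 : 0 < κ j₀ := (Nat.zero_le _).trans_lt (lt_walshDepth hq₀)
  rw [gainSum]
  refine Finset.sum_eq_zero fun n _ => ?_
  -- The summand as a function of the cell. The exponent `κ j - (κ j - 1)` is 1 for a coordinate
  -- occurring in `S` and 0, by truncated subtraction, for an absent one.
  set G : (Fin D → ℕ) → ℝ := fun a =>
    if ∀ j, a j / 2 ^ (κ j - (κ j - 1)) = ⌊2 ^ (κ j - 1) * v n j⌋₊ then
      walsh S fun q => decide (a q.1 / 2 ^ (κ q.1 - 1 - q.2) % 2 = 1) else 0 with hG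
  have hrw : ∀ n', (if ∀ q ∈ S, digitWord (v n q.1) q.2 = digitWord (v n' q.1) q.2 then
      walsh S (digits (v n)) * walsh S (digits (v n')) else 0) =
      walsh S (digits (v n)) * G (cellIndex κ (v n')) := by
    intro n'
    have hw : walsh S (digits (v n')) = walsh S fun q =>
        decide (cellIndex κ (v n') q.1 / 2 ^ (κ q.1 - 1 - q.2) % 2 = 1) := by
      refine Finset.prod_congr rfl fun q hq => ?_
      rw [digits, binaryDigit_eq_of_lt _ (lt_walshDepth hq)]
      rfl
    have hc : (∀ q ∈ S, digitWord (v n q.1) q.2 = digitWord (v n' q.1) q.2) ↔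
        ∀ j, cellIndex κ (v n') j / 2 ^ (κ j - (κ j - 1)) = ⌊2 ^ (κ j - 1) * v n j⌋₊ := by
      rw [digitWord_agree_iff]
      refine forall_congr' fun j => ?_
      rw [digitWord_eq_iff_floor_eq (h.1 n j) (h.1 n' j), cellIndex]
      have := floor_two_pow_add_div (v n' j) (κ j - 1) (κ j - (κ j - 1))
      rw [show κ j - 1 + (κ j - (κ j - 1)) = κ j by omega] at this
      rw [this]
      exact eq_comm
    simp only [G, hc]
    split_ifs
    · rw [hw]
    · rw [mul_zero]
  simp_rw [hrw, ← Finset.mul_sum]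
  rw [h.sum_cellIndex hS G]
  suffices hsum : ∑ a ∈ Fintype.piFinset fun j => Finset.range (2 ^ κ j), G a = 0 by
    rw [hsum, mul_zero, mul_zero]
  -- The fixed-point free pairing of cells: switch the last digit in the coordinate `j₀`.
  set σ : (Fin D → ℕ) → Fin D → ℕ := fun a => Function.update a j₀ (flipLast (a j₀))
  have hσ : ∀ a, G (σ a) = - G a := by
    intro a
    have hc : (∀ j, σ a j / 2 ^ (κ j - (κ j - 1)) = ⌊2 ^ (κ j - 1) * v n j⌋₊) ↔
        ∀ j, a j / 2 ^ (κ j - (κ j - 1)) = ⌊2 ^ (κ j - 1) * v n j⌋₊ := by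
      refine forall_congr' fun j => ?_
      by_cases hj : j = j₀
      · subst hj
        rw [show κ j₀ - (κ j₀ - 1) = 1 by omega, pow_one]
        simp only [σ, Function.update_self, flipLast_div_two]
      · simp only [σ, Function.update_of_ne hj]
    have hw : (walsh S fun q => decide (σ a q.1 / 2 ^ (κ q.1 - 1 - q.2) % 2 = 1)) =
        -walsh S fun q => decide (a q.1 / 2 ^ (κ q.1 - 1 - q.2) % 2 = 1) := by
      have hmem : (j₀, κ j₀ - 1) ∈ S := mem_of_walshDepth_pos hκ0
      rw [walsh, walsh, ← Finset.mul_prod_erase _ _ hmem, ← Finset.mul_prod_erase _ _ hmem,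
        ← neg_mul]
      congr 1
      · simp only [σ, Function.update_self, Nat.sub_self, pow_zero, Nat.div_one,
          flipLast_mod_two, bitSign, decide_not]
        by_cases h1 : a j₀ % 2 = 1 <;> simp [h1]
      · refine Finset.prod_congr rfl fun q hq => ?_
        obtain ⟨hq1, hq2⟩ := Finset.mem_erase.1 hq
        by_cases hj : q.1 = j₀
        · have hlt : q.2 < κ q.1 := lt_walshDepth hq2
          have hne2 : q.2 ≠ κ j₀ - 1 := fun h2 => hq1 (Prod.ext hj h2)
          rw [hj] at hlt ⊢
          obtain ⟨k, hk⟩ : ∃ k, κ j₀ - 1 - q.2 = k + 1 := ⟨κ j₀ - 1 - q.2 - 1, by omega⟩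
          simp only [σ, Function.update_self, hk]
          rw [pow_succ', ← Nat.div_div_eq_div_mul, ← Nat.div_div_eq_div_mul, flipLast_div_two]
        · simp only [σ, Function.update_of_ne hj]
    simp only [G, hc, hw]
    split_ifs <;> simp
  refine Finset.sum_involution (fun a _ => σ a) (fun a _ => ?_) (fun a _ hne ha => ?_)
    (fun a ha => ?_) (fun a _ => ?_)
  · rw [hσ]; ring
  · have := hσ a
    rw [ha] at this
    exact hne (by linarith)
  · rw [Fintype.mem_piFinset] at ha ⊢
    intro j
    by_cases hj : j = j₀
    · subst hj
      simp only [σ, Function.update_self, Finset.mem_range]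
      exact flipLast_lt hκ0 (Finset.mem_range.1 (ha _))
    · simp only [σ, Function.update_of_ne hj]
      exact ha j
  · simp [σ, flipLast_flipLast]

end FourierRQMC

namespace FourierRQMC

/-! ### Mixed differences of functions with boundary growth -/

variable {D : ℕ}

/-- The point `x` shifted by `h` in the coordinates of `V`. -/
def shiftOn (V : Finset (Fin D)) (h x : Fin D → ℝ) (j : Fin D) : ℝ :=
  if j ∈ V then x j + h j else x j

/-- The mixed difference of `f` at `x` with steps `h` in the coordinates of `U`. -/
def mixedDiff (f : (Fin D → ℝ) → ℝ) (U : Finset (Fin D)) (h x : Fin D → ℝ) : ℝ :=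
  ∑ V ∈ U.powerset, (-1) ^ V.card * f (shiftOn V h x)

lemma mixedDiff_insert (f : (Fin D → ℝ) → ℝ) {U : Finset (Fin D)} {j : Fin D} (hj : j ∉ U)
    (h x : Fin D → ℝ) : mixedDiff f (insert j U) h x =
      mixedDiff f U h x - mixedDiff f U h (Function.update x j (x j + h j)) := by
  rw [mixedDiff, Finset.sum_powerset_insert hj, mixedDiff, mixedDiff, sub_eq_add_neg,
    ← Finset.sum_neg_distrib]
  congr 1
  refine Finset.sum_congr rfl fun V hV => ?_
  have hjV : j ∉ V := fun h1 => hj (Finset.mem_powerset.1 hV h1)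
  rw [Finset.card_insert_of_notMem hjV, pow_succ]
  have : shiftOn (insert j V) h x = shiftOn V h (Function.update x j (x j + h j)) := by
    ext i
    by_cases hi : i = j
    · subst hi; simp [shiftOn, hjV]
    · simp [shiftOn, hi]
  rw [this]; ring

lemma shiftOn_update {V : Finset (Fin D)} {j : Fin D} (hj : j ∉ V) (h x : Fin D → ℝ) (s : ℝ) :
    shiftOn V h (Function.update x j s) = Function.update (shiftOn V h x) j s := by
  ext i
  by_cases hi : i = j
  · subst hi; simp [shiftOn, hj]
  · simp [shiftOn, hi]

/-- The size of a difference with step `h` of a function with growth exponent `α`, at distance `z`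
from the boundary. -/
noncomputable def diffBound (α h z : ℝ) : ℝ := if z < h then 2 * z ^ (-α) else h * z ^ (-(α + 1))

lemma diffBound_nonneg {α h z : ℝ} (hh : 0 ≤ h) (hz : 0 ≤ z) : 0 ≤ diffBound α h z := by
  rw [diffBound]; split_ifs <;> positivity

/-- The bound for the factor of one coordinate in `abs_mixedDiff_le`. -/
noncomputable def coordBound (α : ℝ) (h : Fin D → ℝ) (U κ : Finset (Fin D)) (i : Fin D) (y : ℝ) : ℝ :=
  if i ∈ U then diffBound α (h i) (min y (1 - h i - y))
  else if i ∈ κ then (min y (1 - y)) ^ (-(α + 1)) else (min y (1 - y)) ^ (-α)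

lemma coordBound_nonneg {α : ℝ} {h : Fin D → ℝ} {U : Finset (Fin D)} (κ : Finset (Fin D))
    {i : Fin D} {y : ℝ} (hh : 0 < h i) (hy : y ∈ Set.Ioo (0 : ℝ) 1) (hU : i ∈ U → y + h i < 1) :
    0 ≤ coordBound α h U κ i y := by
  have h1 : 0 ≤ min y (1 - y) := le_min hy.1.le (by linarith [hy.2])
  rw [coordBound]
  split_ifs with h2
  · exact diffBound_nonneg hh.le (le_min hy.1.le (by linarith [hU h2]))
  · positivity
  · positivity

/-- The directions of `U` are removed one at a time. If the segment comes closer to the boundary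
than its length, its two end values are bounded separately; otherwise the mean value inequality
trades the difference for a derivative. Induction for all `κ` at once is what allows this derivative
to be added to `κ`. -/
theorem abs_mixedDiff_le {α C : ℝ} (hα : 0 < α) (hC : 0 ≤ C)
    {df : Finset (Fin D) → (Fin D → ℝ) → ℝ}
    (hderiv : ∀ κ, ∀ j ∉ κ, ∀ v ∈ openCube D,
      HasDerivAt (fun x => df κ (Function.update v j x)) (df (insert j κ) v) (v j))
    (hbound : ∀ κ, ∀ v ∈ openCube D, |df κ v| ≤ C * ∏ j,
      (if j ∈ κ then (min (v j) (1 - v j)) ^ (-(α + 1)) else (min (v j) (1 - v j)) ^ (-α)))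
    {h : Fin D → ℝ} (hh : ∀ j, 0 < h j) (U κ : Finset (Fin D)) (hUκ : Disjoint U κ)
    {x : Fin D → ℝ} (hx : x ∈ openCube D) (hxU : ∀ j ∈ U, x j + h j < 1) :
    |mixedDiff (df κ) U h x| ≤ C * ∏ i, coordBound α h U κ i (x i) := by
  induction U using Finset.induction_on generalizing κ x with
  | empty =>
    have : shiftOn ∅ h x = x := by ext i; simp [shiftOn]
    simpa [mixedDiff, this, coordBound] using hbound κ x hx
  | insert j U hj ih =>
    rw [Finset.disjoint_insert_left] at hUκ
    obtain ⟨hjκ, hUκ⟩ := hUκ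
    have hx' : ∀ i, x i ∈ Set.Ioo (0 : ℝ) 1 := fun i => hx i trivial
    have hxj : x j + h j < 1 := hxU j (Finset.mem_insert_self _ _)
    have hupd : ∀ s ∈ Set.Icc (x j) (x j + h j), Function.update x j s ∈ openCube D := by
      intro s hs i _
      by_cases hi : i = j
      · subst hi
        rw [Function.update_self]
        exact ⟨(hx' i).1.trans_le hs.1, hs.2.trans_lt hxj⟩
      · rw [Function.update_of_ne hi]; exact hx' i
    have hupdU : ∀ s, ∀ i ∈ U, Function.update x j s i + h i < 1 := by
      intro s i hi
      have : i ≠ j := fun h1 => hj (h1 ▸ hi)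
      rw [Function.update_of_ne this]
      exact hxU i (Finset.mem_insert_of_mem hi)
    set R := ∏ i ∈ Finset.univ.erase j, coordBound α h (insert j U) κ i (x i)
    have hR : 0 ≤ R := Finset.prod_nonneg fun i _ =>
      coordBound_nonneg κ (hh i) (hx' i) (hxU i)
    have hcoord : ∀ κ' : Finset (Fin D), (∀ i ≠ j, i ∈ κ' ↔ i ∈ κ) → ∀ s,
        ∏ i, coordBound α h U κ' i (Function.update x j s i) =
          coordBound α h U κ' j s * R := by
      intro κ' hκ' s
      rw [← Finset.mul_prod_erase _ _ (Finset.mem_univ j), Function.update_self]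
      congr 1
      refine Finset.prod_congr rfl fun i hi => ?_
      have hij : i ≠ j := Finset.ne_of_mem_erase hi
      simp only [coordBound, Function.update_of_ne hij, Finset.mem_insert, hij, false_or, hκ' i hij]
    have hprod : ∏ i, coordBound α h (insert j U) κ i (x i) =
        diffBound α (h j) (min (x j) (1 - h j - x j)) * R := by
      rw [← Finset.mul_prod_erase _ _ (Finset.mem_univ j)]
      simp [coordBound, R]
    rw [mixedDiff_insert _ hj, hprod]
    -- The distance from the boundary of the whole segment over which the difference is taken.
    set z := min (x j) (1 - h j - x j)
    have hz : 0 < z := lt_min (hx' j).1 (by linarith)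
    have hzle : ∀ s ∈ Set.Icc (x j) (x j + h j), z ≤ min s (1 - s) := fun s hs =>
      le_min ((min_le_left _ _).trans hs.1) ((min_le_right _ _).trans (by linarith [hs.2]))
    have hzpow : ∀ s ∈ Set.Icc (x j) (x j + h j), ∀ β : ℝ, 0 < β →
        (min s (1 - s)) ^ (-β) ≤ z ^ (-β) :=
      fun s hs β hβ => Real.rpow_le_rpow_of_nonpos hz (hzle s hs) (by linarith)
    have hl : x j ∈ Set.Icc (x j) (x j + h j) := ⟨le_rfl, by linarith [hh j]⟩
    have hr : x j + h j ∈ Set.Icc (x j) (x j + h j) := ⟨by linarith [hh j], le_rfl⟩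
    rw [diffBound]
    split_ifs with hzh
    · have key : ∀ s ∈ Set.Icc (x j) (x j + h j),
          |mixedDiff (df κ) U h (Function.update x j s)| ≤ C * (z ^ (-α) * R) := by
        intro s hs
        refine (ih κ hUκ (hupd s hs) (hupdU s)).trans ?_
        rw [hcoord κ (fun _ _ => Iff.rfl)]
        gcongr
        simpa [coordBound, hj, hjκ] using hzpow s hs α hα
      have k1 := key _ hl
      have k2 := key _ hr
      rw [Function.update_eq_self] at k1
      calc _ ≤ _ := abs_sub _ _
        _ ≤ C * (z ^ (-α) * R) + C * (z ^ (-α) * R) := add_le_add k1 k2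
        _ = _ := by ring
    · have hd : ∀ s ∈ Set.Icc (x j) (x j + h j),
          HasDerivWithinAt (fun s => mixedDiff (df κ) U h (Function.update x j s))
            (mixedDiff (df (insert j κ)) U h (Function.update x j s))
            (Set.Icc (x j) (x j + h j)) s := by
        intro s hs
        refine HasDerivAt.hasDerivWithinAt ?_
        refine HasDerivAt.fun_sum fun V hV => HasDerivAt.const_mul _ ?_
        have hVU := Finset.mem_powerset.1 hV
        have hjV : j ∉ V := fun h1 => hj (hVU h1)
        have hmem : shiftOn V h (Function.update x j s) ∈ openCube D := by
          intro i _
          have h1 := hupd s hs i trivial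
          rw [shiftOn]
          split_ifs with hi
          · exact ⟨by linarith [h1.1, hh i], hupdU s i (hVU hi)⟩
          · exact h1
        have h2 := hderiv κ j hjκ _ hmem
        rw [shiftOn_update hjV] at h2 ⊢
        simp only [Function.update_idem, Function.update_self] at h2
        simpa only [shiftOn_update hjV] using h2
      have hb : ∀ s ∈ Set.Icc (x j) (x j + h j),
          ‖mixedDiff (df (insert j κ)) U h (Function.update x j s)‖ ≤
            C * (z ^ (-(α + 1)) * R) := by
        intro s hs
        refine (ih (insert j κ) ?_ (hupd s hs) (hupdU s)).trans ?_
        · rw [Finset.disjoint_insert_right]; exact ⟨hj, hUκ⟩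
        rw [hcoord (insert j κ) (fun i hi => by simp [hi])]
        gcongr
        simpa [coordBound, hj, add_comm] using hzpow s hs (α + 1) (by linarith)
      have := (convex_Icc (x j) (x j + h j)).norm_image_sub_le_of_norm_hasDerivWithin_le hd hb hr hl
      rw [Function.update_eq_self] at this
      calc _ ≤ _ := this
        _ = _ := by
          rw [sub_add_cancel_left, norm_neg, Real.norm_of_nonneg (hh j).le]; ring

/-! ### Integrals of the bounds -/

/-- The part below `h` contributes `2 h ^ (1 - α) / (1 - α)` and the tail `h ^ (1 - α) / α`. Here
the growth exponent turns into the decay exponent `1 - α`; integrability at zero requires `α < 1`.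
-/
lemma integrableOn_diffBound {α h : ℝ} (hα : 0 < α) (hα1 : α < 1) (hh : 0 < h) :
    IntegrableOn (diffBound α h) (Set.Ioi 0) ∧
      ∫ z in Set.Ioi 0, diffBound α h z = (2 / (1 - α) + 1 / α) * h ^ (1 - α) := by
  have e1 : Set.EqOn (diffBound α h) (fun z => 2 * z ^ (-α)) (Set.Ioo 0 h) := fun z hz => by
    simp [diffBound, hz.2]
  have e2 : Set.EqOn (diffBound α h) (fun z => h * z ^ (-(α + 1))) (Set.Ici h) := fun z hz => by
    simp only [diffBound, if_neg (not_lt.2 (Set.mem_Ici.1 hz))]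
  have i1 : IntegrableOn (fun z : ℝ => 2 * z ^ (-α)) (Set.Ioo 0 h) :=
    ((intervalIntegral.integrableOn_Ioo_rpow_iff hh).2 (by linarith)).const_mul 2
  have i2 : IntegrableOn (fun z : ℝ => h * z ^ (-(α + 1))) (Set.Ici h) :=
    ((integrableOn_Ici_iff_integrableOn_Ioi (by finiteness)).2
      (integrableOn_Ioi_rpow_of_lt (by linarith) hh)).const_mul h
  have j1 := i1.congr_fun e1.symm measurableSet_Ioo
  have j2 := i2.congr_fun e2.symm measurableSet_Ici
  have hU : Set.Ioi 0 = Set.Ioo 0 h ∪ Set.Ici h := by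
    rw [Set.Ioo_union_Ici_eq_Ioi hh]
  refine ⟨hU ▸ j1.union j2, ?_⟩
  rw [hU, setIntegral_union (by
      rw [Set.disjoint_left]; rintro z ⟨_, h1⟩ h2; exact (not_lt.2 h2) h1) measurableSet_Ici j1 j2,
    setIntegral_congr_fun measurableSet_Ioo e1, setIntegral_congr_fun measurableSet_Ici e2,
    integral_const_mul, integral_const_mul, integral_Ici_eq_integral_Ioi,
    integral_Ioi_rpow_of_lt (by linarith) hh, ← integral_Ioc_eq_integral_Ioo,
    ← intervalIntegral.integral_of_le hh.le, integral_rpow (.inl (by linarith))]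
  have h1 : h ^ (-α) = h ^ (1 - α) * h⁻¹ := by
    rw [← Real.rpow_neg_one h, ← Real.rpow_add hh]; congr 1; ring
  rw [show -(α + 1) + 1 = -α by ring, h1, Real.zero_rpow (by linarith), show -α + 1 = 1 - α by ring]
  have : (1 : ℝ) - α ≠ 0 := by linarith
  field_simp
  ring

lemma integrableOn_diffBound_min {α h : ℝ} (hα : 0 < α) (hα1 : α < 1) (hh : 0 < h) :
    IntegrableOn (fun y => diffBound α h (min y (1 - h - y))) (Set.Ioo 0 (1 - h)) ∧
      ∫ y in Set.Ioo 0 (1 - h), diffBound α h (min y (1 - h - y)) ≤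
        2 * (2 / (1 - α) + 1 / α) * h ^ (1 - α) := by
  obtain ⟨i0, v0⟩ := integrableOn_diffBound hα hα1 hh
  have i1 : IntegrableOn (diffBound α h) (Set.Ioo 0 (1 - h)) := i0.mono_set fun y hy => hy.1
  have hmp : MeasurePreserving (fun y : ℝ => 1 - h - y) volume volume :=
    Measure.measurePreserving_sub_left volume (1 - h)
  have hpre : (fun y : ℝ => 1 - h - y) ⁻¹' Set.Ioo 0 (1 - h) = Set.Ioo 0 (1 - h) := by
    ext y; simp only [Set.mem_preimage, Set.mem_Ioo]; constructor <;> rintro ⟨h1, h2⟩ <;>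
      constructor <;> linarith
  have hemb : MeasurableEmbedding (fun y : ℝ => 1 - h - y) :=
    (MeasurableEquiv.subLeft (1 - h)).measurableEmbedding
  have i2 : IntegrableOn (fun y => diffBound α h (1 - h - y)) (Set.Ioo 0 (1 - h)) := by
    have := (hmp.integrableOn_comp_preimage hemb (f := diffBound α h) (s := Set.Ioo 0 (1 - h))).2 i1
    rwa [hpre] at this
  have v2 : ∫ y in Set.Ioo 0 (1 - h), diffBound α h (1 - h - y) =
      ∫ y in Set.Ioo 0 (1 - h), diffBound α h y := by
    have := hmp.setIntegral_preimage_emb hemb (diffBound α h) (Set.Ioo 0 (1 - h))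
    rwa [hpre] at this
  have hle : ∀ y ∈ Set.Ioo 0 (1 - h), diffBound α h (min y (1 - h - y)) ≤
      diffBound α h y + diffBound α h (1 - h - y) := by
    rintro y ⟨h1, h2⟩
    have n1 := diffBound_nonneg (α := α) hh.le h1.le
    have n2 := diffBound_nonneg (α := α) hh.le (z := 1 - h - y) (by linarith)
    rcases min_choice y (1 - h - y) with h3 | h3 <;> rw [h3] <;> linarith
  have hmeas : Measurable fun y : ℝ => diffBound α h (min y (1 - h - y)) := by
    refine Measurable.ite (measurableSet_lt (by fun_prop) measurable_const) ?_ ?_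
    · exact ((by fun_prop : Measurable fun y : ℝ => min y (1 - h - y)).pow_const _).const_mul 2
    · exact ((by fun_prop : Measurable fun y : ℝ => min y (1 - h - y)).pow_const _).const_mul h
  have i3 : IntegrableOn (fun y => diffBound α h (min y (1 - h - y))) (Set.Ioo 0 (1 - h)) := by
    refine Integrable.mono' (i1.add i2) hmeas.aestronglyMeasurable ?_
    filter_upwards [ae_restrict_mem measurableSet_Ioo] with y hy
    rw [Real.norm_of_nonneg (diffBound_nonneg hh.le (le_min hy.1.le (by linarith [hy.2])))]
    exact hle y hy
  refine ⟨i3, ?_⟩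
  calc _ ≤ ∫ y in Set.Ioo 0 (1 - h), (diffBound α h y + diffBound α h (1 - h - y)) :=
        setIntegral_mono_on i3 (i1.add i2) measurableSet_Ioo hle
    _ = 2 * ∫ y in Set.Ioo 0 (1 - h), diffBound α h y := by
        rw [integral_add i1 i2, v2]; ring
    _ ≤ 2 * ((2 / (1 - α) + 1 / α) * h ^ (1 - α)) := by
        rw [← v0]
        refine mul_le_mul_of_nonneg_left (setIntegral_mono_set i0 ?_ ?_) (by norm_num)
        · filter_upwards [ae_restrict_mem measurableSet_Ioi] with z hz
          exact diffBound_nonneg hh.le (le_of_lt hz)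
        · exact Eventually.of_forall fun y hy => hy.1
    _ = _ := by ring

/-- The bound is weaker than the computation gives: it is chosen equal to the constant of
`integrableOn_diffBound_min`, so that coordinates with and without a difference share `growthConst`.
-/
lemma integrableOn_min_rpow {α : ℝ} (hα : 0 < α) (hα1 : α < 1) :
    IntegrableOn (fun y : ℝ => (min y (1 - y)) ^ (-α)) (Set.Ioo 0 1) ∧
      ∫ y in Set.Ioo 0 1, (min y (1 - y)) ^ (-α) ≤ 2 * (2 / (1 - α) + 1 / α) := by
  have i1 : IntegrableOn (fun y : ℝ => y ^ (-α)) (Set.Ioo 0 1) :=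
    (intervalIntegral.integrableOn_Ioo_rpow_iff one_pos).2 (by linarith)
  have v1 : ∫ y in Set.Ioo (0 : ℝ) 1, y ^ (-α) = 1 / (1 - α) := by
    rw [← integral_Ioc_eq_integral_Ioo, ← intervalIntegral.integral_of_le zero_le_one,
      integral_rpow (.inl (by linarith)), Real.one_rpow, Real.zero_rpow (by linarith), sub_zero,
      show -α + 1 = 1 - α by ring]
  have hmp : MeasurePreserving (fun y : ℝ => 1 - y) volume volume :=
    Measure.measurePreserving_sub_left volume 1
  have hpre : (fun y : ℝ => 1 - y) ⁻¹' Set.Ioo 0 1 = Set.Ioo 0 1 := by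
    ext y; simp only [Set.mem_preimage, Set.mem_Ioo]; constructor <;> rintro ⟨h1, h2⟩ <;>
      constructor <;> linarith
  have hemb : MeasurableEmbedding (fun y : ℝ => 1 - y) :=
    (MeasurableEquiv.subLeft (1 : ℝ)).measurableEmbedding
  have i2 : IntegrableOn (fun y : ℝ => (1 - y) ^ (-α)) (Set.Ioo 0 1) := by
    have := (hmp.integrableOn_comp_preimage hemb (f := fun y : ℝ => y ^ (-α))
      (s := Set.Ioo 0 1)).2 i1
    rwa [hpre] at this
  have v2 : ∫ y in Set.Ioo (0 : ℝ) 1, (1 - y) ^ (-α) = 1 / (1 - α) := by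
    have := hmp.setIntegral_preimage_emb hemb (fun y : ℝ => y ^ (-α)) (Set.Ioo 0 1)
    rwa [hpre, v1] at this
  have hle : ∀ y ∈ Set.Ioo (0 : ℝ) 1, (min y (1 - y)) ^ (-α) ≤ y ^ (-α) + (1 - y) ^ (-α) := by
    rintro y ⟨h1, h2⟩
    have n1 : 0 ≤ y ^ (-α) := by positivity
    have n2 : 0 ≤ (1 - y) ^ (-α) := Real.rpow_nonneg (by linarith) _
    rcases min_choice y (1 - y) with h3 | h3 <;> rw [h3] <;> linarith
  have hmeas : Measurable fun y : ℝ => (min y (1 - y)) ^ (-α) :=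
    (by fun_prop : Measurable fun y : ℝ => min y (1 - y)).pow_const _
  have i3 : IntegrableOn (fun y : ℝ => (min y (1 - y)) ^ (-α)) (Set.Ioo 0 1) := by
    refine Integrable.mono' (i1.add i2) hmeas.aestronglyMeasurable ?_
    filter_upwards [ae_restrict_mem measurableSet_Ioo] with y hy
    rw [Real.norm_of_nonneg (Real.rpow_nonneg (le_min hy.1.le (by linarith [hy.2])) _)]
    exact hle y hy
  refine ⟨i3, ?_⟩
  calc _ ≤ ∫ y in Set.Ioo (0 : ℝ) 1, (y ^ (-α) + (1 - y) ^ (-α)) :=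
        setIntegral_mono_on i3 (i1.add i2) measurableSet_Ioo hle
    _ = 2 * (1 / (1 - α)) := by rw [integral_add i1 i2, v1, v2]; ring
    _ ≤ _ := by
        have h1 : 0 < 1 - α := by linarith
        have h2 : 1 / (1 - α) ≤ 2 / (1 - α) := by gcongr; norm_num
        have h3 : 0 < 1 / α := by positivity
        linarith

end FourierRQMC

namespace FourierRQMC

/-! ### Decay of Walsh coefficients -/

/-- A zero digit can be raised to one without a carry, so no earlier digit moves. -/
lemma binaryDigit_add_half_pow {s : ℝ} (hs : s ∈ Set.Ico (0 : ℝ) 1) {κ : ℕ} (hκ : 0 < κ)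
    (hd : binaryDigit s (κ - 1) = false) :
    s + (1 / 2) ^ κ ∈ Set.Ico (0 : ℝ) 1 ∧ binaryDigit (s + (1 / 2) ^ κ) (κ - 1) = true ∧
      ∀ i < κ - 1, binaryDigit (s + (1 / 2) ^ κ) i = binaryDigit s i := by
  set n := ⌊2 ^ κ * s⌋₊
  have hp : (0 : ℝ) < 2 ^ κ := by positivity
  have hmul : (2 : ℝ) ^ κ * (1 / 2) ^ κ = 1 := by rw [← mul_pow]; norm_num
  have hfl : ⌊2 ^ κ * (s + (1 / 2) ^ κ)⌋₊ = n + 1 := by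
    rw [mul_add, hmul, Nat.floor_add_one (mul_nonneg hp.le hs.1)]
  have hn : n % 2 = 0 := by
    rw [binaryDigit_eq_of_lt s (by omega : κ - 1 < κ)] at hd
    simpa using hd
  have hlt : n < 2 ^ κ := floor_two_pow_lt hs κ
  have hlt2 : n + 1 < 2 ^ κ := by
    have : 2 ∣ 2 ^ κ := dvd_pow_self 2 hκ.ne'
    omega
  refine ⟨⟨by have := hs.1; positivity, ?_⟩, ?_, fun i hi => ?_⟩
  · have h1 := Nat.lt_floor_add_one (2 ^ κ * (s + (1 / 2) ^ κ))
    rw [hfl] at h1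
    have h2 : ((n + 1 : ℕ) : ℝ) + 1 ≤ 2 ^ κ := by exact_mod_cast hlt2
    have h3 : 2 ^ κ * (s + (1 / 2) ^ κ) < 2 ^ κ * 1 := by linarith
    exact lt_of_mul_lt_mul_left h3 hp.le
  · rw [binaryDigit_eq_of_lt _ (by omega : κ - 1 < κ), hfl, Nat.sub_self, pow_zero, Nat.div_one]
    simp; omega
  · rw [binaryDigit_eq_of_lt _ (by omega : i < κ), binaryDigit_eq_of_lt s (by omega : i < κ), hfl]
    obtain ⟨k, hk⟩ : ∃ k, κ - 1 - i = k + 1 := ⟨κ - 1 - i - 1, by omega⟩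
    rw [hk, pow_succ', ← Nat.div_div_eq_div_mul, ← Nat.div_div_eq_div_mul]
    congr 4
    omega

lemma binaryDigit_sub_half_pow {s : ℝ} (hs : s ∈ Set.Ico (0 : ℝ) 1) {κ : ℕ} (hκ : 0 < κ)
    (hd : binaryDigit s (κ - 1) = true) :
    s - (1 / 2) ^ κ ∈ Set.Ico (0 : ℝ) 1 ∧ binaryDigit (s - (1 / 2) ^ κ) (κ - 1) = false := by
  set n := ⌊2 ^ κ * s⌋₊
  have hp : (0 : ℝ) < 2 ^ κ := by positivity
  have hmul : (2 : ℝ) ^ κ * (1 / 2) ^ κ = 1 := by rw [← mul_pow]; norm_num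
  have hn : n % 2 = 1 := by
    rw [binaryDigit_eq_of_lt s (by omega : κ - 1 < κ)] at hd
    simpa using hd
  have hn1 : (1 : ℝ) ≤ 2 ^ κ * s := by
    refine le_trans ?_ (Nat.floor_le (mul_nonneg hp.le hs.1))
    have h1 : 1 ≤ n := by omega
    calc (1 : ℝ) = ((1 : ℕ) : ℝ) := by norm_num
      _ ≤ n := Nat.cast_le.2 h1
  have hfl : ⌊2 ^ κ * (s - (1 / 2) ^ κ)⌋₊ = n - 1 := by
    rw [mul_sub, hmul, Nat.floor_sub_one]
  have h0 : 0 ≤ s - (1 / 2) ^ κ := by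
    have : 0 ≤ 2 ^ κ * (s - (1 / 2) ^ κ) := by rw [mul_sub, hmul]; linarith
    exact nonneg_of_mul_nonneg_right this hp
  refine ⟨⟨h0, ?_⟩, ?_⟩
  · have : (0 : ℝ) < (1 / 2) ^ κ := by positivity
    linarith [hs.2]
  · rw [binaryDigit_eq_of_lt _ (by omega : κ - 1 < κ), hfl, Nat.sub_self, pow_zero, Nat.div_one]
    simp; omega

variable {D : ℕ}

/-- The factor of the Walsh function `S` that depends on the coordinate `j`. -/
noncomputable def walshFactor (S : Finset (Fin D × ℕ)) (j : Fin D) (s : ℝ) : ℝ :=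
  ∏ q ∈ S.filter fun q => q.1 = j, bitSign (binaryDigit s q.2)

lemma walsh_digits_eq_prod (S : Finset (Fin D × ℕ)) (y : Fin D → ℝ) :
    walsh S (digits y) = ∏ j, walshFactor S j (y j) := by
  rw [walsh, ← Finset.prod_fiberwise S fun q : Fin D × ℕ => q.1]
  refine Finset.prod_congr rfl fun j _ => Finset.prod_congr rfl fun q hq => ?_
  rw [digits, (Finset.mem_filter.1 hq).2]

lemma abs_walshFactor (S : Finset (Fin D × ℕ)) (j : Fin D) (s : ℝ) : |walshFactor S j s| = 1 := by
  simp [walshFactor, Finset.abs_prod, abs_bitSign]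

lemma walshFactor_add {S : Finset (Fin D × ℕ)} {j : Fin D} (hj : 0 < walshDepth S j) {s : ℝ}
    (hs : s ∈ Set.Ico (0 : ℝ) 1) (hd : binaryDigit s (walshDepth S j - 1) = false) :
    walshFactor S j (s + (1 / 2) ^ walshDepth S j) = -walshFactor S j s := by
  obtain ⟨-, h2, h3⟩ := binaryDigit_add_half_pow hs hj hd
  have hmem : (j, walshDepth S j - 1) ∈ S.filter fun q => q.1 = j :=
    Finset.mem_filter.2 ⟨mem_of_walshDepth_pos hj, rfl⟩
  rw [walshFactor, walshFactor, ← Finset.mul_prod_erase _ _ hmem,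
    ← Finset.mul_prod_erase _ _ hmem, ← neg_mul, h2, hd]
  have he : bitSign true = -bitSign false := by simp [bitSign]
  rw [he]
  congr 1
  refine Finset.prod_congr rfl fun q hq => ?_
  obtain ⟨hq1, hq2⟩ := Finset.mem_erase.1 hq
  obtain ⟨hq3, hq4⟩ := Finset.mem_filter.1 hq2
  have h5 := lt_walshDepth hq3
  rw [hq4] at h5
  have h6 : q.2 ≠ walshDepth S j - 1 := fun h7 => hq1 (Prod.ext hq4 h7)
  rw [h3 q.2 (by omega)]

/-- The restriction of `walshFactor` to the left halves of the dyadic intervals on which it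
changes sign once. -/
noncomputable def leftFactor (S : Finset (Fin D × ℕ)) (j : Fin D) (s : ℝ) : ℝ :=
  (Set.Ico (0 : ℝ) 1).indicator (fun s => if 0 < walshDepth S j ∧
    binaryDigit s (walshDepth S j - 1) = true then 0 else walshFactor S j s) s

lemma measurable_walshFactor (S : Finset (Fin D × ℕ)) (j : Fin D) :
    Measurable (walshFactor S j) :=
  Finset.measurable_fun_prod _ fun q _ => measurable_bitSign.comp (measurable_binaryDigit q.2)

lemma measurable_leftFactor (S : Finset (Fin D × ℕ)) (j : Fin D) : Measurable (leftFactor S j) := by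
  refine Measurable.indicator (Measurable.ite ?_ measurable_const (measurable_walshFactor S j))
    measurableSet_Ico
  exact (MeasurableSet.const _).inter (measurable_binaryDigit _ (measurableSet_singleton true))

lemma abs_leftFactor_le (S : Finset (Fin D × ℕ)) (j : Fin D) (s : ℝ) : |leftFactor S j s| ≤ 1 := by
  rw [leftFactor, Set.indicator_apply]
  split_ifs <;> simp [abs_walshFactor]

lemma leftFactor_ne_zero {S : Finset (Fin D × ℕ)} {j : Fin D} {s : ℝ} (h : leftFactor S j s ≠ 0) :
    s ∈ Set.Ico (0 : ℝ) 1 ∧ (0 < walshDepth S j → s + (1 / 2) ^ walshDepth S j < 1) := by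
  rw [leftFactor, Set.indicator_apply] at h
  split_ifs at h with h1 h2
  · exact absurd rfl h
  · refine ⟨h1, fun h3 => ?_⟩
    rw [not_and, Bool.not_eq_true] at h2
    exact (binaryDigit_add_half_pow h1 h3 (h2 h3)).1.2
  · exact absurd rfl h

/-- On each dyadic interval of length `2 ^ (1 - depth)` the factor is constant on either half, with
opposite signs. It is thus the left-half part minus its translate, a difference that summation by
parts can move onto the integrand. -/
lemma indicator_walshFactor (S : Finset (Fin D × ℕ)) (j : Fin D) (s : ℝ) :
    (Set.Ico (0 : ℝ) 1).indicator (walshFactor S j) s = leftFactor S j s -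
      if 0 < walshDepth S j then leftFactor S j (s - (1 / 2) ^ walshDepth S j) else 0 := by
  by_cases hj : 0 < walshDepth S j
  swap
  · simp [leftFactor, hj, Set.indicator_apply]
  set h : ℝ := (1 / 2) ^ walshDepth S j
  simp only [hj, if_true]
  have key : s - h ∈ Set.Ico (0 : ℝ) 1 → binaryDigit (s - h) (walshDepth S j - 1) = false →
      s ∈ Set.Ico (0 : ℝ) 1 ∧ binaryDigit s (walshDepth S j - 1) = true := by
    intro h1 h2
    have := binaryDigit_add_half_pow h1 hj h2
    rw [sub_add_cancel] at this
    exact ⟨this.1, this.2.1⟩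
  by_cases hs : s ∈ Set.Ico (0 : ℝ) 1
  · cases hd : binaryDigit s (walshDepth S j - 1)
    · have h0 : leftFactor S j (s - h) = 0 := by
        rw [leftFactor, Set.indicator_apply]
        split_ifs with h1 h2
        · rfl
        · rw [not_and, Bool.not_eq_true] at h2
          have := (key h1 (h2 hj)).2
          rw [hd] at this; exact absurd this (by simp)
        · rfl
      rw [h0, leftFactor, Set.indicator_of_mem hs, Set.indicator_of_mem hs]
      simp [hd]
    · obtain ⟨h1, h2⟩ := binaryDigit_sub_half_pow hs hj hd
      have h3 := walshFactor_add hj h1 h2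
      rw [sub_add_cancel] at h3
      rw [leftFactor, leftFactor, Set.indicator_of_mem hs, Set.indicator_of_mem hs,
        Set.indicator_of_mem h1, h3, if_pos ⟨hj, hd⟩, if_neg (by simp only [h2]; simp)]
      ring
  · have h0 : leftFactor S j (s - h) = 0 := by
      rw [leftFactor, Set.indicator_apply]
      split_ifs with h1 h2
      · rfl
      · rw [not_and, Bool.not_eq_true] at h2
        exact absurd (key h1 (h2 hj)).1 hs
      · rfl
    rw [h0, leftFactor, Set.indicator_of_notMem hs, Set.indicator_of_notMem hs, sub_zero]

lemma mixedDiff_prod (l : Fin D → ℝ → ℝ) (U : Finset (Fin D)) (h y : Fin D → ℝ) :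
    mixedDiff (fun y => ∏ j, l j (y j)) U h y =
      ∏ j, (l j (y j) - if j ∈ U then l j (y j + h j) else 0) := by
  induction U using Finset.induction_on generalizing y with
  | empty =>
    have : shiftOn ∅ h y = y := by ext i; simp [shiftOn]
    simp [mixedDiff, this]
  | insert j U hj ih =>
    rw [mixedDiff_insert _ hj, ih, ih, ← Finset.mul_prod_erase _ _ (Finset.mem_univ j),
      ← Finset.mul_prod_erase _ _ (Finset.mem_univ j),
      ← Finset.mul_prod_erase _ _ (Finset.mem_univ j)]
    have e : ∀ i ∈ Finset.univ.erase j, (l i (Function.update y j (y j + h j) i) -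
        if i ∈ U then l i (Function.update y j (y j + h j) i + h i) else 0) =
        l i (y i) - if i ∈ U then l i (y i + h i) else 0 := by
      intro i hi
      rw [Function.update_of_ne (Finset.ne_of_mem_erase hi)]
    have e' : ∀ i ∈ Finset.univ.erase j, (l i (y i) -
        if i ∈ insert j U then l i (y i + h i) else 0) =
        l i (y i) - if i ∈ U then l i (y i + h i) else 0 := by
      intro i hi
      simp [Finset.ne_of_mem_erase hi]
    rw [Finset.prod_congr rfl e, Finset.prod_congr rfl e']
    simp [hj]
    ring

lemma shiftOn_eq_add (V : Finset (Fin D)) (h x : Fin D → ℝ) :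
    shiftOn V h x = x + fun j => if j ∈ V then h j else 0 := by
  ext j; simp only [shiftOn, Pi.add_apply]; split_ifs <;> simp

lemma shiftOn_neg_eq_sub (V : Finset (Fin D)) (h x : Fin D → ℝ) :
    shiftOn V (-h) x = x - fun j => if j ∈ V then h j else 0 := by
  ext j; simp only [shiftOn, Pi.sub_apply, Pi.neg_apply]; split_ifs <;> simp [sub_eq_add_neg]

/-- Summation by parts for mixed differences. -/
lemma integral_mul_mixedDiff {f l : (Fin D → ℝ) → ℝ} (hf : Integrable f) (hl : Measurable l)
    {B : ℝ} (hB : ∀ y, |l y| ≤ B) (U : Finset (Fin D)) (h : Fin D → ℝ) :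
    ∫ y, f y * mixedDiff l U (-h) y = ∫ y, mixedDiff f U h y * l y := by
  have i1 : ∀ V : Finset (Fin D), Integrable fun y => f y * ((-1) ^ V.card *
      l (y - fun j => if j ∈ V then h j else 0)) := fun V =>
    hf.mul_bdd (c := B) ((hl.comp (measurable_id.sub_const _)).const_mul _).aestronglyMeasurable
      (.of_forall fun y => by
        rw [norm_mul, norm_pow, norm_neg, norm_one, one_pow, one_mul]; exact hB _)
  have i2 : ∀ V : Finset (Fin D), Integrable fun y => (-1) ^ V.card *
      f (y + fun j => if j ∈ V then h j else 0) * l y := fun V =>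
    ((hf.comp_add_right _).const_mul _).mul_bdd (c := B) hl.aestronglyMeasurable (.of_forall hB)
  simp_rw [mixedDiff, shiftOn_neg_eq_sub, shiftOn_eq_add, Finset.mul_sum, Finset.sum_mul]
  rw [integral_finsetSum _ fun V _ => i1 V, integral_finsetSum _ fun V _ => i2 V]
  refine Finset.sum_congr rfl fun V _ => ?_
  rw [← integral_add_right_eq_self _ (fun j => if j ∈ V then h j else 0)]
  congr 1
  ext y
  rw [add_sub_cancel_right]
  ring

/-- The constant in the bound for the integrals of `diffBound`. -/
noncomputable def growthConst (α : ℝ) : ℝ := 2 * (2 / (1 - α) + 1 / α)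

lemma growthConst_nonneg {α : ℝ} (hα : 0 < α) (hα1 : α < 1) : 0 ≤ growthConst α := by
  have : 0 < 1 - α := by linarith
  rw [growthConst]; positivity

/-- Decay of the Walsh coefficients of a function with boundary growth. -/
theorem abs_walshCoeff_le {α C : ℝ} (hα : 0 < α) (hα1 : α < 1) (hC : 0 ≤ C)
    {f : (Fin D → ℝ) → ℝ} (hf : IntegrableOn f (openCube D))
    {df : Finset (Fin D) → (Fin D → ℝ) → ℝ} (hdf : ∀ v ∈ openCube D, df ∅ v = f v)
    (hderiv : ∀ κ, ∀ j ∉ κ, ∀ v ∈ openCube D,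
      HasDerivAt (fun x => df κ (Function.update v j x)) (df (insert j κ) v) (v j))
    (hbound : ∀ κ, ∀ v ∈ openCube D, |df κ v| ≤ C * ∏ j,
      (if j ∈ κ then (min (v j) (1 - v j)) ^ (-(α + 1)) else (min (v j) (1 - v j)) ^ (-α)))
    (S : Finset (Fin D × ℕ)) :
    |walshCoeff f S| ≤ C * ∏ j, (growthConst α * ((1 / 2 : ℝ) ^ walshDepth S j) ^ (1 - α)) := by
  set κ := walshDepth S
  set h : Fin D → ℝ := fun j => (1 / 2) ^ κ j
  have hh : ∀ j, 0 < h j := fun j => by positivity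
  -- Differences are taken only in coordinates that occur in `S`; in the others the Walsh factor is
  -- constant and there is no cancellation.
  set U : Finset (Fin D) := Finset.univ.filter fun j => 0 < κ j
  set F : (Fin D → ℝ) → ℝ := (openCube D).indicator f
  set Λ : (Fin D → ℝ) → ℝ := fun y => ∏ j, leftFactor S j (y j)
  have hF : Integrable F := hf.integrable_indicator measurableSet_openCube
  have hΛm : Measurable Λ := Finset.measurable_fun_prod _ fun j _ =>
    (measurable_leftFactor S j).comp (measurable_pi_apply j)
  have hΛ1 : ∀ y, |Λ y| ≤ 1 := fun y => by
    rw [Finset.abs_prod]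
    exact Finset.prod_le_one (fun _ _ => abs_nonneg _) fun j _ => abs_leftFactor_le S j _
  -- On the cube the Walsh function is the mixed difference, with steps `-h`, of the product of left
  -- factors. Summation by parts moves the difference to the extension of `f` by zero.
  have e1 : walshCoeff f S = ∫ y, mixedDiff F U h y * Λ y := by
    rw [← integral_mul_mixedDiff hF hΛm hΛ1, walshCoeff, ← integral_indicator measurableSet_openCube]
    congr 1
    ext y
    by_cases hy : y ∈ openCube D
    · simp only [F, Set.indicator_of_mem hy]
      rw [mixedDiff_prod, walsh_digits_eq_prod]
      congr 1
      refine Finset.prod_congr rfl fun j _ => ?_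
      have h1 := indicator_walshFactor S j (y j)
      rw [Set.indicator_of_mem (Set.Ioo_subset_Ico_self (hy j trivial))] at h1
      rw [h1]
      simp [U, κ, h, sub_eq_add_neg]
    · simp [F, hy]
  set β : Fin D → ℝ → ℝ := fun j => if j ∈ U then
      (Set.Ioo 0 (1 - h j)).indicator (fun y => diffBound α (h j) (min y (1 - h j - y)))
    else (Set.Ioo 0 1).indicator fun y => (min y (1 - y)) ^ (-α)
  have hβ0 : ∀ j s, 0 ≤ β j s := by
    intro j s
    simp only [β]
    split_ifs
    · refine Set.indicator_nonneg (fun y hy => ?_) s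
      exact diffBound_nonneg (hh j).le (le_min hy.1.le (by linarith [hy.2]))
    · refine Set.indicator_nonneg (fun y hy => ?_) s
      exact Real.rpow_nonneg (le_min hy.1.le (by linarith [hy.2])) _
  have hβi : ∀ j, Integrable (β j) := by
    intro j
    simp only [β]
    split_ifs
    · exact (integrableOn_diffBound_min hα hα1 (hh j)).1.integrable_indicator measurableSet_Ioo
    · exact (integrableOn_min_rpow hα hα1).1.integrable_indicator measurableSet_Ioo
  have hβv : ∀ j, ∫ s, β j s ≤ growthConst α * (h j) ^ (1 - α) := by
    intro j
    simp only [β]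
    split_ifs with hj
    · rw [integral_indicator measurableSet_Ioo]
      exact (integrableOn_diffBound_min hα hα1 (hh j)).2
    · rw [integral_indicator measurableSet_Ioo]
      have : κ j = 0 := by simpa [U] using hj
      simp only [h, this, pow_zero, Real.one_rpow, mul_one]
      exact (integrableOn_min_rpow hα hα1).2
  -- The left factors live on the half-open interval, so the null set where a coordinate is 0 must
  -- be removed to stay in the open cube.
  have hne : ∀ᵐ y : Fin D → ℝ, ∀ j, y j ≠ 0 := by
    rw [ae_all_iff]
    intro j
    exact (Measure.tendsto_eval_ae_ae (μ := fun _ : Fin D => (volume : Measure ℝ)) (i := j)).eventually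
      (Measure.ae_ne volume 0)
  have hpt : ∀ᵐ y : Fin D → ℝ, ‖mixedDiff F U h y * Λ y‖ ≤ C * ∏ j, β j (y j) := by
    filter_upwards [hne] with y hy
    by_cases h0 : Λ y = 0
    · rw [h0, mul_zero, norm_zero]
      exact mul_nonneg hC (Finset.prod_nonneg fun j _ => hβ0 j _)
    have hl : ∀ j, leftFactor S j (y j) ≠ 0 := fun j hj =>
      h0 (Finset.prod_eq_zero (Finset.mem_univ j) hj)
    have hy' : ∀ j, y j ∈ Set.Ioo (0 : ℝ) 1 := fun j =>
      ⟨lt_of_le_of_ne (leftFactor_ne_zero (hl j)).1.1 (hy j).symm, (leftFactor_ne_zero (hl j)).1.2⟩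
    have hyU : ∀ j ∈ U, y j + h j < 1 := fun j hj =>
      (leftFactor_ne_zero (hl j)).2 (Finset.mem_filter.1 hj).2
    have e2 : mixedDiff F U h y = mixedDiff (df ∅) U h y := by
      refine Finset.sum_congr rfl fun V hV => ?_
      have hmem : shiftOn V h y ∈ openCube D := by
        intro j _
        rw [shiftOn]
        split_ifs with hj
        · exact ⟨by linarith [(hy' j).1, hh j], hyU j (Finset.mem_powerset.1 hV hj)⟩
        · exact hy' j
      simp only [F, Set.indicator_of_mem hmem, hdf _ hmem]
    rw [norm_mul, e2]
    refine (mul_le_of_le_one_right (norm_nonneg _) (hΛ1 y)).trans ?_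
    refine (abs_mixedDiff_le hα hC hderiv hbound hh U ∅ (Finset.disjoint_empty_right _)
      (fun j _ => hy' j) hyU).trans_eq ?_
    congr 1
    refine Finset.prod_congr rfl fun j _ => ?_
    simp only [coordBound, β, Finset.notMem_empty, if_false]
    split_ifs with hj
    · have hm : y j ∈ Set.Ioo 0 (1 - h j) := ⟨(hy' j).1, by linarith [hyU j hj]⟩
      rw [Set.indicator_of_mem hm]
    · rw [Set.indicator_of_mem (hy' j)]
  rw [e1, ← Real.norm_eq_abs]
  refine (norm_integral_le_of_norm_le ((Integrable.fintype_prod hβi).const_mul C) hpt).trans ?_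
  rw [integral_const_mul, integral_fintype_prod_eq_prod]
  exact mul_le_mul_of_nonneg_left (Finset.prod_le_prod (fun j _ => integral_nonneg (hβ0 j))
    fun j _ => hβv j) hC

end FourierRQMC

namespace FourierRQMC

/-! ### Convergence rates of scrambled averages -/

variable {D : ℕ}

lemma gainSum_le {t : ℕ} {v : ℕ → Fin D → ℝ} (h : IsDyadicSequence t v) {m : ℕ} (hm : t ≤ m)
    {S : Finset (Fin D × ℕ)} (hne : S ≠ ∅) : gainSum (2 ^ m) v S ≤ 2 ^ m * 2 ^ (t + D) := by
  rcases le_or_gt (t + ∑ j, walshDepth S j) m with h1 | h1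
  · rw [gainSum_eq_zero h hne h1]; positivity
  · exact (le_abs_self _).trans (abs_gainSum_le h hm h1)

/-- The index sets of given depth. -/
lemma card_walshDepth_eq_le (F : Finset (Finset (Fin D × ℕ))) (κ : Fin D → ℕ) :
    (F.filter fun S => walshDepth S = κ).card ≤ 2 ^ ∑ j, κ j := by
  classical
  set I : Finset (Fin D × ℕ) := Finset.univ.biUnion fun j => {j} ×ˢ Finset.range (κ j)
  have hI : I.card ≤ ∑ j, κ j := by
    refine Finset.card_biUnion_le.trans (Finset.sum_le_sum fun j _ => ?_)
    simp
  have hsub : (F.filter fun S => walshDepth S = κ) ⊆ I.powerset := by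
    intro S hS
    obtain ⟨-, hS2⟩ := Finset.mem_filter.1 hS
    rw [Finset.mem_powerset]
    intro q hq
    refine Finset.mem_biUnion.2 ⟨q.1, Finset.mem_univ _, ?_⟩
    have := lt_walshDepth hq
    rw [hS2] at this
    simp [this]
  refine (Finset.card_le_card hsub).trans ?_
  rw [Finset.card_powerset]
  exact Nat.pow_le_pow_right (by norm_num) hI

/-- At most `2 ^ ∑ j, κ j` index sets have depth `κ`, which consumes the exponent 1 in `1 + η`. What
is left is a product of `D` geometric series of ratio `2 ^ (-η)`, bounded independently of `F`. -/
lemma sum_prod_walshDepth_le {F : Finset (Finset (Fin D × ℕ))} {η : ℝ} (hη : 0 < η) :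
    ∑ S ∈ F, (2 : ℝ) ^ (-(1 + η) * ((∑ j, walshDepth S j : ℕ) : ℝ)) ≤
      ((1 - 2 ^ (-η))⁻¹) ^ D := by
  classical
  have h2 : (0 : ℝ) < 2 := by norm_num
  have hq0 : (0 : ℝ) ≤ 2 ^ (-η) := by positivity
  have hq1 : (2 : ℝ) ^ (-η) < 1 := Real.rpow_lt_one_of_one_lt_of_neg (by norm_num) (by linarith)
  set L := F.sup fun S => Finset.univ.sup (walshDepth S)
  have hmaps : ∀ S ∈ F, walshDepth S ∈ Fintype.piFinset fun _ : Fin D => Finset.range (L + 1) := by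
    intro S hS
    rw [Fintype.mem_piFinset]
    intro j
    rw [Finset.mem_range, Nat.lt_succ_iff]
    exact (Finset.le_sup (f := walshDepth S) (Finset.mem_univ j)).trans
      (Finset.le_sup (f := fun S => Finset.univ.sup (walshDepth S)) hS)
  rw [← Finset.sum_fiberwise_of_maps_to hmaps]
  calc _ ≤ ∑ κ ∈ Fintype.piFinset fun _ : Fin D => Finset.range (L + 1),
        ∏ j, ((2 : ℝ) ^ (-η)) ^ κ j := by
        refine Finset.sum_le_sum fun κ _ => ?_
        rw [Finset.sum_congr rfl fun S hS => by rw [(Finset.mem_filter.1 hS).2],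
          Finset.sum_const, nsmul_eq_mul, Finset.prod_pow_eq_pow_sum]
        have h1 : ((F.filter fun S => walshDepth S = κ).card : ℝ) ≤ 2 ^ ((∑ j, κ j : ℕ) : ℝ) := by
          rw [Real.rpow_natCast]
          exact_mod_cast card_walshDepth_eq_le F κ
        refine (mul_le_mul_of_nonneg_right h1 (by positivity)).trans_eq ?_
        rw [← Real.rpow_natCast, ← Real.rpow_mul h2.le, ← Real.rpow_add h2]
        congr 1; ring
    _ = ∏ _j : Fin D, ∑ k ∈ Finset.range (L + 1), ((2 : ℝ) ^ (-η)) ^ k := by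
        rw [Finset.prod_univ_sum]
    _ ≤ _ := by
        rw [Finset.prod_const, Finset.card_univ, Fintype.card_fin]
        refine pow_le_pow_left₀ (Finset.sum_nonneg fun k _ => by positivity) ?_ D
        rw [← tsum_geometric_of_lt_one hq0 hq1]
        exact (summable_geometric_of_lt_one hq0 hq1).sum_le_tsum _ fun k _ => by positivity

/-! ### Mean square errors along powers of two. -/

section

variable {Ω : Type*} [MeasurableSpace Ω] {P : Measure Ω} {ξ : Fin D × List Bool → Ω → Bool}
  {v : ℕ → Fin D → ℝ} {t : ℕ} {f : (Fin D → ℝ) → ℝ}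

/-- The mean square error of the average of `f` over the first `N` scrambled points. -/
noncomputable def meanSquareError (P : Measure Ω) (ξ : Fin D × List Bool → Ω → Bool)
    (v : ℕ → Fin D → ℝ) (f : (Fin D → ℝ) → ℝ) (N : ℕ) : ℝ :=
  ∫ ω, ((N : ℝ)⁻¹ * ∑ n ∈ Finset.range N, f (scrambledPoint ξ (v n) ω) -
    ∫ y in openCube D, f y) ^ 2 ∂P

lemma IsFairBits.meanSquareError_le (h : IsFairBits P ξ) {N : ℕ} (hN : N ≠ 0)
    (hf : IntegrableOn f (openCube D)) (hfc : ContinuousOn f (openCube D)) {B : ℝ} (hB0 : 0 ≤ B)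
    (hB : ∀ L, (N : ℝ)⁻¹ ^ 2 * ∑ S ∈ (digitIndex D L).powerset.erase ∅,
      walshCoeff f S ^ 2 * gainSum N v S ≤ B) : meanSquareError P ξ v f N ≤ B := by
  have h1 := h.lintegral_sq_error_le hN v hf hfc hB
  have hm : AEStronglyMeasurable (fun ω => ((N : ℝ)⁻¹ * ∑ n ∈ Finset.range N,
      f (scrambledPoint ξ (v n) ω) - ∫ y in openCube D, f y) ^ 2) P := by
    refine AEStronglyMeasurable.pow (AEStronglyMeasurable.sub (AEStronglyMeasurable.const_mul
      ?_ _) aestronglyMeasurable_const) 2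
    refine Finset.aestronglyMeasurable_fun_sum _ fun n _ => ?_
    exact hf.aestronglyMeasurable.comp_measurePreserving (h.measurePreserving (v n))
  rw [meanSquareError, integral_eq_lintegral_of_nonneg_ae (.of_forall fun ω => sq_nonneg _) hm]
  exact ENNReal.toReal_le_of_le_ofReal hB0 h1

/-- Only the uniform bound on the gain sums and Bessel's inequality enter, which gives the Monte
Carlo order `1 / N` without any smoothness. -/
lemma IsFairBits.meanSquareError_le_of_memLp (h : IsFairBits P ξ) (hv : IsDyadicSequence t v)
    (hf : MemLp f 2 (volume.restrict (openCube D))) (hfc : ContinuousOn f (openCube D)) {m : ℕ}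
    (hm : t ≤ m) :
    meanSquareError P ξ v f (2 ^ m) ≤ (2 ^ (t + D) * ∫ y in openCube D, f y ^ 2) * (2 ^ m)⁻¹ := by
  have h0 : 0 ≤ ∫ y in openCube D, f y ^ 2 := integral_nonneg fun y => sq_nonneg _
  refine h.meanSquareError_le (by positivity) (hf.integrable (by norm_num)) hfc (by positivity)
    fun L => ?_
  calc _ ≤ ((2 ^ m : ℕ) : ℝ)⁻¹ ^ 2 * ∑ S ∈ (digitIndex D L).powerset.erase ∅,
        walshCoeff f S ^ 2 * (2 ^ m * 2 ^ (t + D)) := by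
        gcongr with S hS
        exact gainSum_le hv hm (Finset.ne_of_mem_erase hS)
    _ = ((2 : ℝ) ^ m)⁻¹ * 2 ^ (t + D) * ∑ S ∈ (digitIndex D L).powerset.erase ∅,
        walshCoeff f S ^ 2 := by
        rw [← Finset.sum_mul]; push_cast; field_simp
    _ ≤ ((2 : ℝ) ^ m)⁻¹ * 2 ^ (t + D) * ∫ y in openCube D, f y ^ 2 := by
        gcongr; exact h.sum_walshCoeff_sq_le hf _
    _ = _ := by ring

/-- Only index sets of total depth above `m - t` contribute. Of their decay exponent `2 - 2 * α` a
part `1 + η` pays for summation over index sets and the rest is evaluated at depth `m - t`; the gain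
bound contributes the further factor `1 / N`. -/
lemma IsFairBits.meanSquareError_le_of_walshCoeff (h : IsFairBits P ξ)
    (hv : IsDyadicSequence t v) (hf : IntegrableOn f (openCube D))
    (hfc : ContinuousOn f (openCube D)) {α K η : ℝ} (hη : 0 < η) (hηα : η ≤ 1 - 2 * α)
    (hc : ∀ S, |walshCoeff f S| ≤ K * 2 ^ (-(1 - α) * ((∑ j, walshDepth S j : ℕ) : ℝ)))
    {m : ℕ} (hm : t ≤ m) :
    meanSquareError P ξ v f (2 ^ m) ≤ (2 ^ (t + D) * K ^ 2 * ((1 - 2 ^ (-η))⁻¹) ^ D *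
      2 ^ ((1 - 2 * α - η) * t)) * 2 ^ (-(2 - 2 * α - η) * m) := by
  have h2 : (0 : ℝ) < 2 := by norm_num
  have hq1 : (2 : ℝ) ^ (-η) < 1 := Real.rpow_lt_one_of_one_lt_of_neg (by norm_num) (by linarith)
  have hq2 : 0 ≤ ((1 : ℝ) - 2 ^ (-η))⁻¹ := inv_nonneg.2 (by linarith)
  refine h.meanSquareError_le (by positivity) hf hfc (by positivity) fun L => ?_
  have key : ∀ S ∈ (digitIndex D L).powerset.erase ∅, walshCoeff f S ^ 2 * gainSum (2 ^ m) v S ≤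
      (2 ^ m * 2 ^ (t + D) * K ^ 2 * 2 ^ (-(1 - 2 * α - η) * (m - t))) *
        2 ^ (-(1 + η) * ((∑ j, walshDepth S j : ℕ) : ℝ)) := by
    intro S hS
    rcases le_or_gt (t + ∑ j, walshDepth S j) m with h1 | h1
    · rw [gainSum_eq_zero hv (Finset.ne_of_mem_erase hS) h1, mul_zero]
      positivity
    · set k : ℝ := ((∑ j, walshDepth S j : ℕ) : ℝ)
      have hk : (m : ℝ) - t ≤ k := by
        have : (m : ℝ) ≤ ((t + ∑ j, walshDepth S j : ℕ) : ℝ) := Nat.cast_le.2 h1.le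
        rw [Nat.cast_add] at this
        linarith
      have h3 : walshCoeff f S ^ 2 ≤ K ^ 2 * 2 ^ (-(2 - 2 * α) * k) := by
        rw [← sq_abs]
        refine (pow_le_pow_left₀ (abs_nonneg _) (hc S) 2).trans_eq ?_
        rw [mul_pow, ← Real.rpow_natCast (2 ^ _) 2, ← Real.rpow_mul h2.le]
        congr 2; rw [Nat.cast_ofNat]; ring
      -- Splitting of the exponent; `η ≤ 1 - 2 * α` makes the part evaluated at `k ≥ m - t`
      -- nonincreasing in `k`.
      have h4 : (2 : ℝ) ^ (-(2 - 2 * α) * k) ≤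
          2 ^ (-(1 - 2 * α - η) * (m - t)) * 2 ^ (-(1 + η) * k) := by
        rw [← Real.rpow_add h2]
        refine Real.rpow_le_rpow_of_exponent_le (by norm_num) ?_
        nlinarith
      calc walshCoeff f S ^ 2 * gainSum (2 ^ m) v S
          ≤ walshCoeff f S ^ 2 * (2 ^ m * 2 ^ (t + D)) := by
            gcongr; exact gainSum_le hv hm (Finset.ne_of_mem_erase hS)
        _ ≤ (K ^ 2 * (2 ^ (-(1 - 2 * α - η) * (m - t)) * 2 ^ (-(1 + η) * k))) *
            (2 ^ m * 2 ^ (t + D)) := by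
            gcongr; exact h3.trans (by gcongr)
        _ = _ := by ring
  calc _ ≤ ((2 ^ m : ℕ) : ℝ)⁻¹ ^ 2 * ∑ S ∈ (digitIndex D L).powerset.erase ∅,
        (2 ^ m * 2 ^ (t + D) * K ^ 2 * 2 ^ (-(1 - 2 * α - η) * (m - t))) *
          (2 : ℝ) ^ (-(1 + η) * ((∑ j, walshDepth S j : ℕ) : ℝ)) := by
        exact mul_le_mul_of_nonneg_left (Finset.sum_le_sum key) (by positivity)
    _ ≤ ((2 ^ m : ℕ) : ℝ)⁻¹ ^ 2 * ((2 ^ m * 2 ^ (t + D) * K ^ 2 *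
        2 ^ (-(1 - 2 * α - η) * (m - t))) * ((1 - 2 ^ (-η))⁻¹) ^ D) := by
        rw [← Finset.mul_sum]
        gcongr
        exact sum_prod_walshDepth_le hη
    _ = 2 ^ (t + D) * K ^ 2 * ((1 - 2 ^ (-η))⁻¹) ^ D *
        (((2 : ℝ) ^ m)⁻¹ * 2 ^ (-(1 - 2 * α - η) * (m - t))) := by
        push_cast; field_simp
    _ = _ := by
        rw [mul_assoc _ (2 ^ ((1 - 2 * α - η) * t))]
        congr 1
        rw [← Real.rpow_natCast, ← Real.rpow_neg h2.le, ← Real.rpow_add h2, ← Real.rpow_add h2]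
        congr 1; ring

lemma tendsto_two_rpow_mul {a : ℝ} (ha : a < 0) :
    Tendsto (fun m : ℕ => (2 : ℝ) ^ (a * m)) atTop (𝓝 0) := by
  have h1 : (2 : ℝ) ^ a < 1 := Real.rpow_lt_one_of_one_lt_of_neg (by norm_num) ha
  have := tendsto_pow_atTop_nhds_zero_of_lt_one (by positivity : (0 : ℝ) ≤ 2 ^ a) h1
  refine this.congr fun m => ?_
  rw [← Real.rpow_natCast, ← Real.rpow_mul (by norm_num)]

/-- Scrambled averages of a square integrable function with boundary growth exponents at most
`α` converge faster than `N ^ (-r)` for `r < 1 - α`, along the sample sizes `N = 2 ^ m`. -/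
theorem IsFairBits.tendsto_meanSquareError (h : IsFairBits P ξ) (hv : IsDyadicSequence t v)
    {A : Fin D → ℝ} (hg : HasBoundaryGrowth f A)
    (hf : MemLp f 2 (volume.restrict (openCube D)))
    {α r : ℝ} (hAα : ∀ j, A j ≤ α) (hα : 0 ≤ α) (hr : r < 1 - α) :
    Tendsto (fun m : ℕ => ((2 ^ m : ℕ) : ℝ) ^ (2 * r) * meanSquareError P ξ v f (2 ^ m))
      atTop (𝓝 0) := by
  have h2 : (0 : ℝ) < 2 := by norm_num
  obtain ⟨C, df, hdf, hdfc, hderiv, hbound⟩ := hg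
  have hfc : ContinuousOn f (openCube D) := (hdfc ∅).congr fun v hv => (hdf v hv).symm
  have hfi : IntegrableOn f (openCube D) := hf.integrable (by norm_num)
  have hnn : ∀ m, 0 ≤ ((2 ^ m : ℕ) : ℝ) ^ (2 * r) * meanSquareError P ξ v f (2 ^ m) := fun m =>
    mul_nonneg (by positivity) (integral_nonneg fun ω => sq_nonneg _)
  have hpow : ∀ m : ℕ, ((2 ^ m : ℕ) : ℝ) ^ (2 * r) = 2 ^ (2 * r * m) := fun m => by
    push_cast
    rw [← Real.rpow_natCast, ← Real.rpow_mul h2.le, mul_comm]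
  suffices hB : ∃ B a : ℝ, a < 0 ∧ ∀ m, t ≤ m →
      ((2 ^ m : ℕ) : ℝ) ^ (2 * r) * meanSquareError P ξ v f (2 ^ m) ≤ B * 2 ^ (a * m) by
    obtain ⟨B, a, ha, hB⟩ := hB
    refine tendsto_of_tendsto_of_tendsto_of_le_of_le' tendsto_const_nhds
      (by simpa using (tendsto_two_rpow_mul ha).const_mul B) (.of_forall hnn) ?_
    filter_upwards [eventually_ge_atTop t] with m hm using hB m hm
  -- For `α ≥ 1 / 2` one has `r < 1 / 2`, and the order `1 / N` suffices.
  rcases le_or_gt (1 / 2) α with hα2 | hα2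
  · refine ⟨2 ^ (t + D) * ∫ y in openCube D, f y ^ 2, 2 * r - 1, by linarith, fun m hm => ?_⟩
    refine (mul_le_mul_of_nonneg_left (h.meanSquareError_le_of_memLp hv hf hfc hm)
      (by positivity)).trans_eq ?_
    rw [hpow, ← Real.rpow_natCast 2 m, ← Real.rpow_neg h2.le, mul_left_comm, ← Real.rpow_add h2]
    congr 2; ring
  -- A slightly larger exponent `β` is used: it is positive even if `α = 0`, and still satisfies `r
  -- < 1 - β`. Enlarging exponents is harmless because distances to the boundary are at most 1.
  · obtain ⟨β, hβ0, hαβ, hβr, hβ2⟩ : ∃ β : ℝ, 0 < β ∧ α ≤ β ∧ r < 1 - β ∧ β < 1 / 2 := by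
      obtain ⟨β, h1, h3⟩ := exists_between (lt_min (by linarith : α < 1 - r) hα2)
      exact ⟨β, hα.trans_lt h1, h1.le, by linarith [min_le_left (1 - r) (1 / 2)],
        h3.trans_le (min_le_right _ _)⟩
    have hbound' : ∀ κ, ∀ v ∈ openCube D, |df κ v| ≤ max C 0 * ∏ j,
        (if j ∈ κ then (min (v j) (1 - v j)) ^ (-(β + 1)) else (min (v j) (1 - v j)) ^ (-β)) := by
      intro κ v hv
      have hz : ∀ j, 0 < min (v j) (1 - v j) ∧ min (v j) (1 - v j) ≤ 1 := fun j =>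
        ⟨lt_min (hv j trivial).1 (by linarith [(hv j trivial).2]),
          (min_le_left _ _).trans (hv j trivial).2.le⟩
      refine (hbound κ v hv).trans ?_
      have hp : 0 ≤ ∏ j, min (v j) (1 - v j) ^ (-A j - if j ∈ κ then 1 else 0) :=
        Finset.prod_nonneg fun j _ => Real.rpow_nonneg (hz j).1.le _
      refine (mul_le_mul_of_nonneg_right (le_max_left C 0) hp).trans ?_
      refine mul_le_mul_of_nonneg_left (Finset.prod_le_prod
        (fun j _ => Real.rpow_nonneg (hz j).1.le _) fun j _ => ?_) (le_max_right _ _)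
      split_ifs
      · exact Real.rpow_le_rpow_of_exponent_ge (hz j).1 (hz j).2 (by linarith [hAα j])
      · exact Real.rpow_le_rpow_of_exponent_ge (hz j).1 (hz j).2 (by linarith [hAα j])
    have hβ1 : β < 1 := by linarith
    have hc := abs_walshCoeff_le hβ0 hβ1 (le_max_right C 0) hfi hdf hderiv hbound'
    set K := max C 0 * growthConst β ^ D
    have hK : 0 ≤ K := mul_nonneg (le_max_right _ _) (pow_nonneg (growthConst_nonneg hβ0 hβ1) _)
    have hc' : ∀ S, |walshCoeff f S| ≤
        K * 2 ^ (-(1 - β) * ((∑ j, walshDepth S j : ℕ) : ℝ)) := by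
      intro S
      refine (hc S).trans_eq ?_
      rw [Finset.prod_mul_distrib, Finset.prod_const, Finset.card_univ, Fintype.card_fin,
        ← mul_assoc, Real.finsetProd_rpow _ _ fun j _ => by positivity,
        Finset.prod_pow_eq_pow_sum, one_div, inv_pow, ← Real.rpow_natCast 2,
        ← Real.rpow_neg h2.le, ← Real.rpow_mul h2.le]
      congr 2; ring
    -- The first bound is the one required above; the second leaves the total exponent `2 * r - (2 -
    -- 2 * β - η) ≤ r - (1 - β) < 0`.
    set η := min (1 - 2 * β) (1 - β - r)
    have hη : 0 < η := lt_min (by linarith) (by linarith)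
    refine ⟨2 ^ (t + D) * K ^ 2 * ((1 - 2 ^ (-η))⁻¹) ^ D * 2 ^ ((1 - 2 * β - η) * t),
      2 * r - (2 - 2 * β - η), ?_, fun m hm => ?_⟩
    · have : η ≤ 1 - β - r := min_le_right _ _
      linarith
    · refine (mul_le_mul_of_nonneg_left (h.meanSquareError_le_of_walshCoeff hv hfi hfc hη
        (min_le_left _ _) hc' hm) (by positivity)).trans_eq ?_
      rw [hpow, mul_left_comm, ← Real.rpow_add h2]
      congr 2; ring

end

end FourierRQMC

namespace FourierRQMC

/-! ### Fourier inversion almost everywhere -/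

open scoped FourierTransform RealInnerProductSpace

section Inversion

variable {V : Type*} [NormedAddCommGroup V] [InnerProductSpace ℝ V] [FiniteDimensional ℝ V]
  [MeasurableSpace V] [BorelSpace V]

lemma integral_fourier_mul_eq_of_integrable {f g : V → ℂ} (hf : Integrable f) (hg : Integrable g) :
    ∫ x, 𝓕 f x * g x = ∫ x, f x * 𝓕 g x := by
  simpa using! VectorFourier.integral_fourierIntegral_smul_eq_flip (L := innerₗ V)
    Real.continuous_fourierChar continuous_inner hf hg

lemma continuous_fourier_of_integrable {f : V → ℂ} (hf : Integrable f) : Continuous (𝓕 f) :=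
  VectorFourier.fourierIntegral_continuous Real.continuous_fourierChar
    (innerSL ℝ).continuous₂ hf

/-- An integrable function with integrable Fourier transform is almost everywhere equal to the
inverse transform of its Fourier transform. -/
theorem ae_fourierInv_fourier_eq {f : V → ℂ} (hf : Integrable f) (hf' : Integrable (𝓕 f)) :
    ∀ᵐ x, f x = 𝓕⁻ (𝓕 f) x := by
  have hneg : Integrable (fun x => 𝓕 f (-x)) := hf'.comp_neg
  have hcont : Continuous (𝓕⁻ (𝓕 f)) := by
    rw [Real.fourierInv_eq_fourier_comp_neg]
    exact continuous_fourier_of_integrable hneg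
  -- Both sides are tested against smooth functions of compact support. For these, inversion holds
  -- in the Schwartz space, and the self-adjointness of the transform carries it over to `f`.
  refine ae_eq_of_integral_contDiff_smul_eq hf.locallyIntegrable
    hcont.locallyIntegrable fun g hg hgs => ?_
  have hgs' : HasCompactSupport (fun x => (g x : ℂ)) :=
    hgs.comp_left (g := fun x : ℝ => (x : ℂ)) (by simp)
  set G : SchwartzMap V ℂ := hgs'.toSchwartzMap (Complex.ofRealCLM.contDiff.comp hg) with hG
  have hGc : (G : V → ℂ) = fun x => (g x : ℂ) := rfl
  have e1 : ∫ x, g x • f x = ∫ x, 𝓕⁻ (G : V → ℂ) x * 𝓕 f x := by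
    rw [← SchwartzMap.fourierInv_coe,
      ← integral_fourier_mul_eq_of_integrable (SchwartzMap.integrable _) hf,
      ← SchwartzMap.fourier_coe, FourierTransform.fourier_fourierInv_eq, hGc]
    simp
  have e2 : ∫ x, g x • 𝓕⁻ (𝓕 f) x = ∫ x, 𝓕⁻ (G : V → ℂ) x * 𝓕 f x := by
    calc ∫ x, g x • 𝓕⁻ (𝓕 f) x = ∫ x, (G : V → ℂ) x * 𝓕 (fun x => 𝓕 f (-x)) x := by
          rw [hGc, Real.fourierInv_eq_fourier_comp_neg]; simp
      _ = ∫ x, 𝓕 (G : V → ℂ) x * 𝓕 f (-x) :=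
          (integral_fourier_mul_eq_of_integrable (SchwartzMap.integrable _) hneg).symm
      _ = ∫ x, 𝓕 (G : V → ℂ) (-x) * 𝓕 f (- -x) :=
          (integral_neg_eq_self (fun x => 𝓕 (G : V → ℂ) x * 𝓕 f (-x)) volume).symm
      _ = _ := by simp [Real.fourierInv_eq_fourier_neg]
  rw [e1, e2]

end Inversion

section Pi

variable {ι : Type*} [Fintype ι]

/-- Fourier inversion almost everywhere in the convention with `exp (i⟨u, x⟩)`. -/
theorem ae_eq_integral_exp_mul {f F : (ι → ℝ) → ℂ} (hf : Integrable f) (hF : Integrable F)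
    (h : ∀ u, F u = ∫ x : ι → ℝ, Complex.exp (Complex.I * ∑ i, (u i : ℂ) * (x i : ℂ)) * f x) :
    ∀ᵐ m : ι → ℝ, f m = ((2 * Real.pi : ℝ) : ℂ)⁻¹ ^ (Fintype.card ι) *
      ∫ u, Complex.exp (-(Complex.I * ∑ i, (u i : ℂ) * (m i : ℂ))) * F u := by
  have mp := EuclideanSpace.volume_preserving_symm_measurableEquiv_toLp ι
  have mp' := mp.symm
  set e := (MeasurableEquiv.toLp 2 (ι → ℝ)).symm with he
  set fE : EuclideanSpace ℝ ι → ℂ := fun x => f (e x) with hfE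
  have hfE_int : Integrable fE := (mp.integrable_comp_emb e.measurableEmbedding).2 hf
  -- The two conventions differ by the substitution `u = -2πw`, whose Jacobian produces the power of
  -- `2π`.
  have hft : ∀ w : EuclideanSpace ℝ ι, 𝓕 fE w = F ((-(2 * Real.pi)) • e w) := by
    intro w
    rw [Real.fourier_eq', h, ← mp.integral_comp' (f := e)]
    refine integral_congr_ae (Eventually.of_forall fun x => ?_)
    simp only [hfE, smul_eq_mul]
    congr 2
    simp only [PiLp.inner_apply, he]
    push_cast
    rw [Finset.mul_sum, Finset.sum_mul, Finset.mul_sum]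
    refine Finset.sum_congr rfl fun i _ => ?_
    simp
    ring
  have hne : (-(2 * Real.pi)) ≠ 0 := by simp [Real.pi_ne_zero]
  have hFs : Integrable fun u : ι → ℝ => F ((-(2 * Real.pi)) • u) := hF.comp_smul hne
  have hft_int : Integrable (𝓕 fE) := by
    have : Integrable fun w : EuclideanSpace ℝ ι => F ((-(2 * Real.pi)) • e w) :=
      (mp.integrable_comp_emb e.measurableEmbedding).2 hFs
    exact this.congr (Eventually.of_forall fun w => (hft w).symm)
  have key := ae_fourierInv_fourier_eq hfE_int hft_int
  have key' := mp'.quasiMeasurePreserving.ae key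
  filter_upwards [key'] with m hm
  have hm' : f m = 𝓕⁻ (𝓕 fE) (e.symm m) := by rw [← hm]; simp [hfE]
  rw [hm', Real.fourierInv_eq']
  have : ∀ w : EuclideanSpace ℝ ι,
      Complex.exp ((↑(2 * Real.pi * ⟪w, e.symm m⟫) * Complex.I)) • 𝓕 fE w
      = (fun u : ι → ℝ => Complex.exp (-(Complex.I * ∑ i, (u i : ℂ) * (m i : ℂ))) * F u)
        ((-(2 * Real.pi)) • e w) := by
    intro w
    rw [hft, smul_eq_mul]
    congr 2
    simp only [PiLp.inner_apply, he]
    push_cast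
    rw [Finset.mul_sum, Finset.sum_mul, Finset.mul_sum, ← Finset.sum_neg_distrib]
    refine Finset.sum_congr rfl fun i _ => ?_
    simp
    ring
  simp_rw [this]
  rw [mp.integral_comp' (f := e) (g := fun y => (fun u : ι → ℝ =>
    Complex.exp (-(Complex.I * ∑ i, (u i : ℂ) * (m i : ℂ))) * F u) ((-(2 * Real.pi)) • y)),
    Measure.integral_comp_smul volume (fun u : ι → ℝ =>
      Complex.exp (-(Complex.I * ∑ i, (u i : ℂ) * (m i : ℂ))) * F u)]
  rw [Complex.real_smul]
  congr 1
  rw [Module.finrank_fintype_fun_eq_card, abs_inv, abs_pow, abs_neg,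
    abs_of_pos (by positivity : (0:ℝ) < 2 * Real.pi)]
  push_cast
  rw [inv_pow]

end Pi

end FourierRQMC

namespace FourierRQMC

/-! ### Damped Fourier representation of expectations -/

section Damped

variable {ι : Type*} [Fintype ι] {μ : Measure (ι → ℝ)} [SFinite μ] {K : ι → ℝ}
  {l : (ι → ℝ) → ℝ}

/-- Up to the factor `exp ⟨K, m⟩`, the map `m ↦ E[l(X - m)]` is the convolution of the tilted law
with the reflected damped function. Both are integrable, hence so is the convolution integrand. -/
lemma integrable_damped_convolution
    (hμ : Integrable (fun x => Real.exp (-∑ i, K i * x i)) μ)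
    (hl : Integrable fun x : ι → ℝ => Real.exp (∑ i, K i * x i) * l x) :
    Integrable (fun p : (ι → ℝ) × (ι → ℝ) => Real.exp (-∑ i, K i * p.2 i) *
      (Real.exp (∑ i, K i * (p.2 - p.1) i) * l (p.2 - p.1))) ((volume : Measure (ι → ℝ)).prod μ) := by
  have := hμ.convolution_integrand (ContinuousLinearMap.mul ℝ ℝ) (hl.comp_neg)
  refine this.congr (Eventually.of_forall fun p => ?_)
  simp only [ContinuousLinearMap.mul_apply', neg_sub]

/-- For almost every shift, the expectation of a damped function is the inverse Fourier integral
of the product of the transforms. -/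
theorem ae_integral_sub_eq_fourier
    (hμ : Integrable (fun x => Real.exp (-∑ i, K i * x i)) μ)
    (hl : Integrable fun x : ι → ℝ => Real.exp (∑ i, K i * x i) * l x)
    (hprod : Integrable fun u : ι → ℝ =>
      (∫ x, Complex.exp (Complex.I * ∑ i, ((u i : ℂ) + Complex.I * (K i : ℂ)) * (x i : ℂ)) ∂μ) *
      ∫ x : ι → ℝ, Complex.exp (-(Complex.I * ∑ i, ((u i : ℂ) + Complex.I * (K i : ℂ)) * (x i : ℂ)))
        * (l x : ℂ)) :
    ∀ᵐ m : ι → ℝ, Integrable (fun x => l (x - m)) μ ∧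
      ((∫ x, l (x - m) ∂μ : ℝ) : ℂ) = ((2 * Real.pi : ℝ) : ℂ)⁻¹ ^ (Fintype.card ι) *
        ∫ u : ι → ℝ, Complex.exp (∑ i, ((K i : ℂ) - Complex.I * (u i : ℂ)) * (m i : ℂ)) *
      ((∫ x, Complex.exp (Complex.I * ∑ i, ((u i : ℂ) + Complex.I * (K i : ℂ)) * (x i : ℂ)) ∂μ) *
      ∫ x : ι → ℝ, Complex.exp (-(Complex.I * ∑ i, ((u i : ℂ) + Complex.I * (K i : ℂ)) * (x i : ℂ)))
        * (l x : ℂ)) := by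
  have hconv := integrable_damped_convolution hμ hl
  set W : (ι → ℝ) × (ι → ℝ) → ℝ := fun p => Real.exp (-∑ i, K i * p.2 i) *
      (Real.exp (∑ i, K i * (p.2 - p.1) i) * l (p.2 - p.1)) with hW
  have hsplit : ∀ m x : ι → ℝ, l (x - m) = Real.exp (∑ i, K i * m i) * W (m, x) := by
    intro m x
    simp only [hW]
    rw [← mul_assoc, ← mul_assoc, ← Real.exp_add, ← Real.exp_add]
    have : ∑ i, K i * m i + -∑ i, K i * x i + ∑ i, K i * (x - m) i = 0 := by
      rw [← Finset.sum_neg_distrib, ← Finset.sum_add_distrib, ← Finset.sum_add_distrib]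
      exact Finset.sum_eq_zero fun i _ => by simp; ring
    rw [this, Real.exp_zero, one_mul]
  -- The expectation with its exponential factor in `m` removed. It is integrable, and by Fubini its
  -- transform is the product of the two damped transforms, so inversion applies to it.
  set ψ : (ι → ℝ) → ℂ := fun m => ((∫ x, W (m, x) ∂μ : ℝ) : ℂ) with hψ
  have hψint : Integrable ψ := hconv.integral_prod_left.ofReal
  have hker : ∀ u : ι → ℝ, Integrable (fun p : (ι → ℝ) × (ι → ℝ) =>
      Complex.exp (Complex.I * ∑ i, (u i : ℂ) * (p.1 i : ℂ)) * (W p : ℂ))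
      ((volume : Measure (ι → ℝ)).prod μ) := by
    intro u
    refine hconv.ofReal.bdd_mul (c := 1) (Continuous.aestronglyMeasurable (by fun_prop))
      (Eventually.of_forall fun p => ?_)
    rw [Complex.norm_exp]
    simp [Complex.mul_re]
  have hft := ae_eq_integral_exp_mul hψint hprod (fun u => ?_)
  · have hae := hconv.prod_right_ae
    filter_upwards [hft, hae] with m hm hm'
    refine ⟨(hm'.const_mul (Real.exp (∑ i, K i * m i))).congr
      (Eventually.of_forall fun x => (hsplit m x).symm), ?_⟩
    simp_rw [hsplit m]
    rw [integral_const_mul, Complex.ofReal_mul]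
    change _ * ψ m = _
    rw [hm, ← mul_assoc, mul_comm (((Real.exp _ : ℝ)) : ℂ), mul_assoc, ← integral_const_mul]
    congr 1
    refine integral_congr_ae (Eventually.of_forall fun u => ?_)
    dsimp only
    rw [← mul_assoc]
    congr 1
    rw [Complex.ofReal_exp, ← Complex.exp_add]
    congr 1
    push_cast
    rw [Finset.mul_sum, ← sub_eq_add_neg, ← Finset.sum_sub_distrib]
    exact Finset.sum_congr rfl fun i _ => by ring
  · symm
    calc ∫ m : ι → ℝ, Complex.exp (Complex.I * ∑ i, (u i : ℂ) * (m i : ℂ)) * ψ m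
        = ∫ m : ι → ℝ, ∫ x, Complex.exp (Complex.I * ∑ i, (u i : ℂ) * (m i : ℂ)) *
            (W (m, x) : ℂ) ∂μ := by
          refine integral_congr_ae (Eventually.of_forall fun m => ?_)
          dsimp only
          rw [hψ, integral_const_mul, integral_complex_ofReal]
      _ = ∫ x, (∫ m : ι → ℝ, Complex.exp (Complex.I * ∑ i, (u i : ℂ) * (m i : ℂ)) *
            (W (m, x) : ℂ)) ∂μ := integral_integral_swap (hker u)
      _ = ∫ x, Complex.exp (Complex.I * ∑ i, ((u i : ℂ) + Complex.I * (K i : ℂ)) * (x i : ℂ)) *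
            (∫ y : ι → ℝ, Complex.exp (-(Complex.I * ∑ i, ((u i : ℂ) + Complex.I * (K i : ℂ))
              * (y i : ℂ))) * (l y : ℂ)) ∂μ := by
          refine integral_congr_ae (Eventually.of_forall fun x => ?_)
          dsimp only
          rw [← integral_const_mul, ← integral_sub_left_eq_self _ volume x]
          refine integral_congr_ae (Eventually.of_forall fun y => ?_)
          simp only [hW]
          push_cast
          rw [sub_sub_cancel]
          simp only [← mul_assoc]
          simp only [← Complex.exp_add]
          congr 2
          simp only [Finset.mul_sum, ← Finset.sum_neg_distrib, ← Finset.sum_add_distrib]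
          refine Finset.sum_congr rfl fun i _ => ?_
          simp only [Pi.sub_apply]
          push_cast
          linear_combination ((K i : ℂ) * (x i - y i)) * (- Complex.I_mul_I)
      _ = _ := integral_mul_const _ _

end Damped

end FourierRQMC

namespace FourierRQMC

/-! ### Fourier integrals of the model -/

namespace Model

variable {d : ℕ} {C : Type*} (𝓜 : Model d C)

lemma measurable_proj (c : C) : Measurable (𝓜.proj c) :=
  measurable_pi_lambda _ fun i => measurable_pi_apply (i : Fin d)

/-- Preimages of null sets are null, so a statement for almost every subvector holds for almost
every allocation. -/
lemma quasiMeasurePreserving_proj (c : C) :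
    Measure.QuasiMeasurePreserving (𝓜.proj c) volume volume := by
  have := Measure.quasiMeasurePreserving_fst.comp
    (volume_preserving_piEquivPiSubtypeProd (fun _ : Fin d => ℝ)
      (· ∈ 𝓜.supp c)).quasiMeasurePreserving
  convert this
  · rfl
  · rfl

/-- The Fourier integral of the component `c` for the derivative `α`. -/
noncomputable def fourierValue (c : C) (ν : Fin 3) (α : List (Fin d)) (m : Fin d → ℝ) : ℂ :=
  ∫ u, 𝓜.integrand c (𝓜.damp ν c) α m u

/-- Since i(u + iK) = iu - K, the exponent is minus the pairing of the symbols with the allocation.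
Differentiating in `m j` therefore prepends `j` to the list of derivatives, with a minus sign. -/
lemma integrand_zero_exponent (c : C) (K u : 𝓜.supp c → ℝ) (m : Fin d → ℝ) :
    ∑ i, ((K i : ℂ) - Complex.I * (u i : ℂ)) * (𝓜.proj c m i : ℂ)
      = -∑ j, 𝓜.symb c (𝓜.contour c K u) j * (m j : ℂ) := by
  rw [← Finset.sum_subset (f := fun j => 𝓜.symb c (𝓜.contour c K u) j * (m j : ℂ))
    (Finset.subset_univ (𝓜.supp c)), ← Finset.sum_coe_sort (𝓜.supp c), ← Finset.sum_neg_distrib]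
  · refine Finset.sum_congr rfl fun i _ => ?_
    simp only [symb, contour, proj, Finset.coe_mem, dif_pos]
    linear_combination ((K i : ℂ) * m i) * Complex.I_mul_I
  · intro j _ hj
    simp [symb, hj]

lemma integrand_add (c : C) (K : 𝓜.supp c → ℝ) (α : List (Fin d)) (m h : Fin d → ℝ)
    (u : 𝓜.supp c → ℝ) : 𝓜.integrand c K α (m + h) u = 𝓜.integrand c K α m u *
      Complex.exp (-∑ j, 𝓜.symb c (𝓜.contour c K u) j * (h j : ℂ)) := by
  simp only [integrand, integrand_zero_exponent]
  have : -∑ j, 𝓜.symb c (𝓜.contour c K u) j * ((m + h) j : ℂ)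
      = -∑ j, 𝓜.symb c (𝓜.contour c K u) j * (m j : ℂ) +
        -∑ j, 𝓜.symb c (𝓜.contour c K u) j * (h j : ℂ) := by
    rw [← neg_add, ← Finset.sum_add_distrib]
    congr 1
    refine Finset.sum_congr rfl fun j _ => ?_
    simp only [Pi.add_apply]
    push_cast
    ring
  rw [this, Complex.exp_add]
  ring

lemma integrand_cons (c : C) (K : 𝓜.supp c → ℝ) (j : Fin d) (α : List (Fin d)) (m : Fin d → ℝ)
    (u : 𝓜.supp c → ℝ) : 𝓜.integrand c K (j :: α) m u =
      𝓜.symb c (𝓜.contour c K u) j * 𝓜.integrand c K α m u := by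
  simp only [integrand, compHatDeriv, List.map_cons, List.prod_cons]
  ring

lemma integrand_swap (c : C) (K : 𝓜.supp c → ℝ) (i j : Fin d) (m : Fin d → ℝ)
    (u : 𝓜.supp c → ℝ) : 𝓜.integrand c K [i, j] m u = 𝓜.integrand c K [j, i] m u := by
  simp only [integrand_cons]
  ring

lemma norm_exp_symb (c : C) (K : 𝓜.supp c → ℝ) (h : Fin d → ℝ) (u : 𝓜.supp c → ℝ) :
    ‖Complex.exp (-∑ j, 𝓜.symb c (𝓜.contour c K u) j * (h j : ℂ))‖
      = Real.exp (∑ i, K i * 𝓜.proj c h i) := by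
  rw [← integrand_zero_exponent, Complex.norm_exp]
  congr 1
  simp [Complex.mul_re, Complex.sub_re]

lemma sum_mul_proj_le (c : C) (K : 𝓜.supp c → ℝ) (h : Fin d → ℝ) :
    ∑ i, K i * 𝓜.proj c h i ≤ (∑ i, |K i|) * ‖h‖ := by
  rw [Finset.sum_mul]
  refine Finset.sum_le_sum fun i _ => (le_abs_self _).trans ?_
  rw [abs_mul]
  gcongr
  exact norm_le_pi_norm h (i : Fin d)

/-- The modulus changes only by a real exponential that does not involve `u`, so one integrable
majorant serves a neighbourhood of allocations. -/
lemma norm_integrand_add_le (c : C) (K : 𝓜.supp c → ℝ) (α : List (Fin d)) (m h : Fin d → ℝ)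
    (u : 𝓜.supp c → ℝ) : ‖𝓜.integrand c K α (m + h) u‖ ≤
      Real.exp ((∑ i, |K i|) * ‖h‖) * ‖𝓜.integrand c K α m u‖ := by
  rw [integrand_add, norm_mul, norm_exp_symb, mul_comm]
  gcongr
  exact sum_mul_proj_le _ _ _ _

/-- The derivative of the integrand with respect to the allocation. -/
lemma hasFDerivAt_integrand (c : C) (K : 𝓜.supp c → ℝ) (α : List (Fin d)) (m : Fin d → ℝ)
    (u : 𝓜.supp c → ℝ) :
    HasFDerivAt (fun m => 𝓜.integrand c K α m u)
      (-∑ j, (ContinuousLinearMap.proj (R := ℝ) (φ := fun _ : Fin d => ℝ) j).smulRight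
        (𝓜.integrand c K (j :: α) m u)) m := by
  have h1 : HasFDerivAt (fun m : Fin d → ℝ =>
      -∑ j, 𝓜.symb c (𝓜.contour c K u) j * (m j : ℂ))
      (-∑ j, (ContinuousLinearMap.proj (R := ℝ) (φ := fun _ : Fin d => ℝ) j).smulRight
        (𝓜.symb c (𝓜.contour c K u) j)) m := by
    have : (fun m : Fin d → ℝ => -∑ j, 𝓜.symb c (𝓜.contour c K u) j * (m j : ℂ))
      = (-∑ j, (ContinuousLinearMap.proj (R := ℝ) (φ := fun _ : Fin d => ℝ) j).smulRight
        (𝓜.symb c (𝓜.contour c K u) j) : (Fin d → ℝ) →L[ℝ] ℂ) := by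
      ext m
      simp [mul_comm]
    rw [this]
    exact ContinuousLinearMap.hasFDerivAt _
  have h2 : (fun m => 𝓜.integrand c K α m u) = fun m => 𝓜.integrand c K α 0 u *
      Complex.exp (-∑ j, 𝓜.symb c (𝓜.contour c K u) j * (m j : ℂ)) := by
    ext m
    rw [← integrand_add, zero_add]
  rw [h2]
  refine (h1.cexp.const_mul _).congr_fderiv ?_
  ext x
  have h3 := congrFun h2 m
  simp only [integrand_cons, h3]
  simp only [smul_apply, neg_apply,
    sum_apply, ContinuousLinearMap.smulRight_apply,
    ContinuousLinearMap.proj_apply, smul_eq_mul, Complex.real_smul, mul_neg, Finset.mul_sum]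
  congr 1
  exact Finset.sum_congr rfl fun j _ => by ring

/-- On the unit ball around `m` the integrands are dominated. -/
lemma norm_integrand_le_of_mem_ball (c : C) (K : 𝓜.supp c → ℝ) (α : List (Fin d))
    {m m' : Fin d → ℝ} (hm : m' ∈ Metric.ball m 1) (u : 𝓜.supp c → ℝ) :
    ‖𝓜.integrand c K α m' u‖ ≤ Real.exp (∑ i, |K i|) * ‖𝓜.integrand c K α m u‖ := by
  have h1 := 𝓜.norm_integrand_add_le c K α m (m' - m) u
  rw [add_sub_cancel] at h1
  refine h1.trans ?_
  gcongr
  have : ‖m' - m‖ ≤ 1 := (mem_ball_iff_norm.1 hm).le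
  exact mul_le_of_le_one_right (Finset.sum_nonneg fun _ _ => abs_nonneg _) this

lemma continuous_affinePart : Continuous 𝓜.affinePart := by
  unfold affinePart
  fun_prop

lemma hasFDerivAt_affinePart (m : Fin d → ℝ) : HasFDerivAt 𝓜.affinePart
    (-∑ j, (ContinuousLinearMap.proj (R := ℝ) (φ := fun _ : Fin d => ℝ) j).smulRight
      (𝓜.slope j)) m := by
  have : 𝓜.affinePart = fun m => 𝓜.affinePart 0 +
      (-∑ j, (ContinuousLinearMap.proj (R := ℝ) (φ := fun _ : Fin d => ℝ) j).smulRight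
      (𝓜.slope j) : (Fin d → ℝ) →L[ℝ] ℝ) m := by
    ext m
    simp only [affinePart, neg_apply, sum_apply, ContinuousLinearMap.smulRight_apply,
      ContinuousLinearMap.proj_apply, smul_eq_mul, Pi.zero_apply, sub_zero, mul_sub,
      Finset.sum_sub_distrib, mul_comm (m _)]
    ring
  rw [this]
  exact (ContinuousLinearMap.hasFDerivAt _).const_add _

end Model

end FourierRQMC

/-! ### Fourier representation of the expected loss. -/

namespace FourierRQMC

namespace Model

variable {d : ℕ} {C : Type*} [Fintype C] {𝓜 : Model d C} {M : Set (Fin d → ℝ)}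

lemma IsAdmissible.continuous_loss (h : 𝓜.IsAdmissible M) : Continuous 𝓜.loss :=
  h.isLoss.convex.locallyLipschitz.continuous

lemma IsAdmissible.integrable_coord (h : 𝓜.IsAdmissible M) (i : Fin d) :
    Integrable (fun x : Fin d → ℝ => x i) 𝓜.law := by
  obtain ⟨c, hc⟩ := h.isLoss.lower
  have := h.prob
  refine Integrable.mono' ((h.orlicz 1 one_pos).add (integrable_const c))
    (measurable_pi_apply i).aestronglyMeasurable (Eventually.of_forall fun x => ?_)
  have h1 := hc fun i => |1 * x i|
  have h2 : |1 * x i| ≤ ∑ i, |1 * x i| :=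
    Finset.single_le_sum (f := fun i => |1 * x i|) (fun _ _ => abs_nonneg _) (Finset.mem_univ i)
  simp only [one_mul] at h1 h2
  simp only [Real.norm_eq_abs, Pi.add_apply, one_mul]
  linarith

/-- From below the affine minorant is integrable. From above, x - m ≤ ½|2x| + ½|2m| componentwise,
and monotonicity with convexity reduce the bound to the Orlicz condition at `t = 2`. -/
lemma IsAdmissible.integrable_loss_sub (h : 𝓜.IsAdmissible M) (m : Fin d → ℝ) :
    Integrable (fun x => 𝓜.loss (x - m)) 𝓜.law := by
  obtain ⟨c, hc⟩ := h.isLoss.lower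
  have := h.prob
  have hlow : Integrable (fun x : Fin d → ℝ => ∑ i, (x i - m i) - c) 𝓜.law :=
    (integrable_finsetSum _ fun i _ =>
      (h.integrable_coord i).sub (integrable_const _)).sub (integrable_const _)
  have hup : Integrable (fun x : Fin d → ℝ => (1 / 2 : ℝ) * 𝓜.loss (fun i => |2 * x i|) +
      (1 / 2 : ℝ) * 𝓜.loss (fun i => |2 * m i|)) 𝓜.law :=
    ((h.orlicz 2 two_pos).const_mul _).add (integrable_const _)
  refine integrable_of_le_of_le
    (h.continuous_loss.comp (by fun_prop)).aestronglyMeasurable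
    (Eventually.of_forall fun x => hc (x - m)) (Eventually.of_forall fun x => ?_) hlow hup
  dsimp only
  refine (h.isLoss.mono (?_ : x - m ≤ (1 / 2 : ℝ) • (fun i => |2 * x i|) +
    (1 / 2 : ℝ) • (fun i => |2 * m i|))).trans ?_
  · intro i
    simp only [Pi.sub_apply, Pi.add_apply, Pi.smul_apply, smul_eq_mul, abs_mul, abs_two]
    have := le_abs_self (x i)
    have := neg_abs_le (m i)
    linarith
  · have := h.isLoss.convex.2 (Set.mem_univ fun i => |2 * x i|) (Set.mem_univ fun i => |2 * m i|)
      (by norm_num : (0:ℝ) ≤ 1 / 2) (by norm_num : (0:ℝ) ≤ 1 / 2) (by norm_num)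
    simpa only [smul_eq_mul] using this

/-- Convexity is wanted for the continuity of `g`, which upgrades the Fourier representation from
almost every to every allocation. -/
lemma IsAdmissible.convexOn_g (h : 𝓜.IsAdmissible M) : ConvexOn ℝ Set.univ 𝓜.g := by
  refine ⟨convex_univ, fun m _ m' _ a b ha hb hab => ?_⟩
  simp only [g, smul_eq_mul]
  rw [← integral_const_mul, ← integral_const_mul,
    ← integral_add ((h.integrable_loss_sub m).const_mul a) ((h.integrable_loss_sub m').const_mul b)]
  refine integral_mono (h.integrable_loss_sub _)
    (((h.integrable_loss_sub m).const_mul a).add ((h.integrable_loss_sub m').const_mul b))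
    fun x => ?_
  have := h.isLoss.convex.2 (Set.mem_univ (x - m)) (Set.mem_univ (x - m')) ha hb hab
  have e : x - (a • m + b • m') = a • (x - m) + b • (x - m') := by
    rw [smul_sub, smul_sub, sub_add_sub_comm, ← add_smul, hab, one_smul]
  dsimp only
  rw [e]
  simpa only [smul_eq_mul] using this

/-- Damped inversion is applied to the marginal law of the subvector and pulled back to full
allocations. -/
lemma IsAdmissible.ae_comp_eq (h : 𝓜.IsAdmissible M) (ν : Fin 3) (c : C) :
    ∀ᵐ m, Integrable (fun x => 𝓜.comp c (𝓜.proj c (x - m))) 𝓜.law ∧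
      ((∫ x, 𝓜.comp c (𝓜.proj c (x - m)) ∂𝓜.law : ℝ) : ℂ) = 𝓜.fourierValue c ν [] m := by
  have := h.prob
  have hp := 𝓜.measurable_proj c
  set μ := 𝓜.law.map (𝓜.proj c) with hμ
  have hprob : IsProbabilityMeasure μ := Measure.isProbabilityMeasure_map hp.aemeasurable
  have hchar : ∀ u, 𝓜.charFn c (𝓜.contour c (𝓜.damp ν c) u) = ∫ x, Complex.exp (Complex.I *
      ∑ i, ((u i : ℂ) + Complex.I * (𝓜.damp ν c i : ℂ)) * (x i : ℂ)) ∂μ := by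
    intro u
    rw [hμ, integral_map hp.aemeasurable (Continuous.aestronglyMeasurable (by fun_prop))]
    rfl
  have hmarg : Integrable (fun x => Real.exp (-∑ i, 𝓜.damp ν c i * x i)) μ := by
    rw [hμ, integrable_map_measure (Continuous.aestronglyMeasurable (by fun_prop)) hp.aemeasurable]
    exact h.damp_law ν c
  -- At `m = 0` the exponential factor is 1, so the integrand is a nonzero constant times the
  -- product of the two transforms; this supplies the integrability that inversion requires.
  have hprod := (h.damp_integrand ν c [] (by simp) 0).const_mul
    ((((2 * Real.pi : ℝ) : ℂ)⁻¹ ^ (𝓜.supp c).card)⁻¹)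
  have hpi : (((2 * Real.pi : ℝ) : ℂ)⁻¹ ^ (𝓜.supp c).card) ≠ 0 := by
    simp [Real.pi_ne_zero]
  have key := ae_integral_sub_eq_fourier hmarg (h.damp_comp ν c) (hprod.congr
    (Eventually.of_forall fun u => ?_))
  · filter_upwards [(𝓜.quasiMeasurePreserving_proj c).ae key] with m hm
    obtain ⟨h1, h2⟩ := hm
    have hmeas := h1.aestronglyMeasurable
    rw [integrable_map_measure hmeas hp.aemeasurable] at h1
    rw [hμ, integral_map hp.aemeasurable hmeas] at h2
    refine ⟨h1, ?_⟩
    change ((∫ x, 𝓜.comp c (𝓜.proj c x - 𝓜.proj c m) ∂𝓜.law : ℝ) : ℂ) = _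
    rw [h2, fourierValue, Fintype.card_coe, ← integral_const_mul]
    refine integral_congr_ae (Eventually.of_forall fun u => ?_)
    dsimp only
    rw [← hμ, ← hchar]
    simp only [integrand, compHatDeriv, compHat, contour, List.map_nil, List.prod_nil, one_mul]
    ring
  · dsimp only
    rw [← hchar]
    simp only [integrand, compHatDeriv, compHat, contour, List.map_nil, List.prod_nil, one_mul,
      proj, Pi.zero_apply, Complex.ofReal_zero, mul_zero, Finset.sum_const_zero, Complex.exp_zero,
      mul_one]
    rw [mul_assoc, inv_mul_cancel_left₀ hpi]

lemma IsAdmissible.ae_g_eq (h : 𝓜.IsAdmissible M) (ν : Fin 3) :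
    ∀ᵐ m, 𝓜.g m = 𝓜.affinePart m + ∑ c, (𝓜.fourierValue c ν [] m).re := by
  have := h.prob
  filter_upwards [ae_all_iff.2 fun c => h.ae_comp_eq ν c] with m hm
  have hlin : ∀ i, Integrable (fun x : Fin d → ℝ => 𝓜.slope i * (x - m) i) 𝓜.law := fun i =>
    ((h.integrable_coord i).sub (integrable_const _)).const_mul _
  simp only [g, loss, affinePart]
  rw [integral_add, integral_add, integral_finsetSum _ fun i _ => hlin i,
    integral_finsetSum _ fun c _ => (hm c).1]
  · congr 1
    · congr 1
      · simp
      · refine Finset.sum_congr rfl fun i _ => ?_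
        rw [integral_const_mul]
        simp only [Pi.sub_apply]
        rw [integral_sub (h.integrable_coord i) (integrable_const _)]
        simp
    · refine Finset.sum_congr rfl fun c _ => ?_
      rw [← (hm c).2, Complex.ofReal_re]
  · exact integrable_const _
  · exact integrable_finsetSum _ fun i _ => hlin i
  · exact (integrable_const _).add (integrable_finsetSum _ fun i _ => hlin i)
  · exact integrable_finsetSum _ fun c _ => (hm c).1

lemma IsAdmissible.continuous_fourierValue (h : 𝓜.IsAdmissible M) (c : C) (ν : Fin 3)
    {α : List (Fin d)} (hα : α.length ≤ 2) : Continuous (𝓜.fourierValue c ν α) := by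
  refine continuous_iff_continuousAt.2 fun m => ?_
  refine continuousAt_of_dominated (bound := fun u => Real.exp (∑ i, |𝓜.damp ν c i|) *
    ‖𝓜.integrand c (𝓜.damp ν c) α m u‖)
    (Eventually.of_forall fun m => (h.damp_integrand ν c α hα m).aestronglyMeasurable) ?_
    ((h.damp_integrand ν c α hα m).norm.const_mul _)
    (Eventually.of_forall fun u => (𝓜.hasFDerivAt_integrand c _ α m u).continuousAt)
  filter_upwards [Metric.ball_mem_nhds m one_pos] with m' hm'
  exact Eventually.of_forall fun u => 𝓜.norm_integrand_le_of_mem_ball c _ α hm' u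

lemma IsAdmissible.hasFDerivAt_fourierValue (h : 𝓜.IsAdmissible M) (c : C) (ν : Fin 3)
    {α : List (Fin d)} (hα : α.length ≤ 1) (m : Fin d → ℝ) :
    HasFDerivAt (𝓜.fourierValue c ν α)
      (-∑ j, (ContinuousLinearMap.proj (R := ℝ) (φ := fun _ : Fin d => ℝ) j).smulRight
        (𝓜.fourierValue c ν (j :: α) m)) m := by
  have hint : ∀ j, Integrable (𝓜.integrand c (𝓜.damp ν c) (j :: α) m) := fun j =>
    h.damp_integrand ν c _ (by simpa using hα) m
  have hint' : ∀ j ∈ Finset.univ, Integrable (fun u =>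
      (ContinuousLinearMap.proj (R := ℝ) (φ := fun _ : Fin d => ℝ) j).smulRight
        (𝓜.integrand c (𝓜.damp ν c) (j :: α) m u)) := fun j _ =>
    ((ContinuousLinearMap.smulRightL ℝ (Fin d → ℝ) ℂ
      (ContinuousLinearMap.proj (R := ℝ) (φ := fun _ : Fin d => ℝ) j)).integrable_comp (hint j))
  have key := hasFDerivAt_integral_of_dominated_of_fderiv_le (𝕜 := ℝ)
    (F := fun m u => 𝓜.integrand c (𝓜.damp ν c) α m u)
    (F' := fun m u => -∑ j, (ContinuousLinearMap.proj (R := ℝ)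
      (φ := fun _ : Fin d => ℝ) j).smulRight (𝓜.integrand c (𝓜.damp ν c) (j :: α) m u))
    (x₀ := m) (bound := fun u => ∑ j, ‖ContinuousLinearMap.proj (R := ℝ)
      (φ := fun _ : Fin d => ℝ) j‖ * (Real.exp (∑ i, |𝓜.damp ν c i|) *
        ‖𝓜.integrand c (𝓜.damp ν c) (j :: α) m u‖)) (μ := volume)
    (Metric.ball_mem_nhds m one_pos)
    (Eventually.of_forall fun m => (h.damp_integrand ν c α (hα.trans one_le_two)
      m).aestronglyMeasurable) (h.damp_integrand ν c α (hα.trans one_le_two) m)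
    (integrable_finsetSum _ hint').neg.aestronglyMeasurable
    (Eventually.of_forall fun u m' hm' => ?_)
    (integrable_finsetSum _ fun j _ => ((hint j).norm.const_mul _).const_mul _)
    (Eventually.of_forall fun u m' _ => 𝓜.hasFDerivAt_integrand c _ α m' u)
  · refine key.congr_fderiv ?_
    rw [integral_neg, integral_finsetSum _ hint']
    congr 1
    refine Finset.sum_congr rfl fun j _ => ?_
    exact (ContinuousLinearMap.smulRightL ℝ (Fin d → ℝ) ℂ
      (ContinuousLinearMap.proj (R := ℝ) (φ := fun _ : Fin d => ℝ) j)).integral_comp_comm (hint j)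
  · rw [norm_neg]
    refine (norm_sum_le _ _).trans (Finset.sum_le_sum fun j _ => ?_)
    rw [ContinuousLinearMap.norm_smulRight_apply]
    gcongr
    exact 𝓜.norm_integrand_le_of_mem_ball c _ _ hm' u

/-- The Fourier representation of `E[l(X - m)]` is valid for all allocations. -/
theorem IsAdmissible.g_eq (h : 𝓜.IsAdmissible M) (ν : Fin 3) (m : Fin d → ℝ) :
    𝓜.g m = 𝓜.affinePart m + ∑ c, (𝓜.fourierValue c ν [] m).re := by
  -- Continuous functions that agree almost everywhere for Lebesgue measure agree everywhere.
  have h1 : Continuous 𝓜.g := h.convexOn_g.locallyLipschitz.continuous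
  have h2 : Continuous fun m => 𝓜.affinePart m + ∑ c, (𝓜.fourierValue c ν [] m).re :=
    𝓜.continuous_affinePart.add (continuous_finsetSum _ fun c _ =>
      Complex.continuous_re.comp (h.continuous_fourierValue c ν (by simp)))
  exact congrFun ((h1.ae_eq_iff_eq volume h2).1 (h.ae_g_eq ν)) m

end Model

end FourierRQMC

/-! ### Derivatives of the expected loss and independence of the damping vector. -/

namespace FourierRQMC

/-- A locally Lipschitz function on a finite-dimensional space is differentiable almost
everywhere. -/
lemma ae_differentiableAt_of_locallyLipschitz {E : Type*} [NormedAddCommGroup E] [NormedSpace ℝ E]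
    [FiniteDimensional ℝ E] [MeasurableSpace E] [BorelSpace E] {μ : Measure E}
    [μ.IsAddHaarMeasure] {f : E → ℝ} (hf : LocallyLipschitz f) :
    ∀ᵐ x ∂μ, DifferentiableAt ℝ f x := by
  -- Rademacher's theorem on each closed ball, where local Lipschitz continuity becomes uniform by
  -- compactness.
  have hball : ∀ n : ℕ, ∀ᵐ x ∂μ, x ∈ Metric.closedBall (0 : E) n →
      DifferentiableWithinAt ℝ f (Metric.closedBall (0 : E) n) x := by
    intro n
    obtain ⟨K, hK⟩ := (hf.locallyLipschitzOn (s := Metric.closedBall (0 : E) n)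
      ).exists_lipschitzOnWith_of_compact (isCompact_closedBall _ _)
    exact hK.ae_differentiableWithinAt_of_mem
  filter_upwards [ae_all_iff.2 hball] with x hx
  obtain ⟨n, hn⟩ := exists_nat_gt ‖x‖
  have hmem : Metric.closedBall (0 : E) n ∈ 𝓝 x :=
    mem_of_superset (Metric.isOpen_ball.mem_nhds (by simpa using hn)) Metric.ball_subset_closedBall
  exact (hx n (mem_of_mem_nhds hmem)).differentiableAt hmem

namespace Model

variable {d : ℕ} {C : Type*} [Fintype C] {𝓜 : Model d C} {M : Set (Fin d → ℝ)}

lemma IsAdmissible.hasFDerivAt_g (h : 𝓜.IsAdmissible M) (ν : Fin 3) (m : Fin d → ℝ) :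
    HasFDerivAt 𝓜.g (-∑ j, (ContinuousLinearMap.proj (R := ℝ) (φ := fun _ : Fin d => ℝ) j).smulRight
      (𝓜.slope j + ∑ c, (𝓜.fourierValue c ν [j] m).re)) m := by
  have h1 := 𝓜.hasFDerivAt_affinePart m
  have h2 : ∀ c ∈ Finset.univ, HasFDerivAt (fun m => (𝓜.fourierValue c ν [] m).re) _ m :=
    fun c _ => Complex.reCLM.hasFDerivAt.comp m
      (h.hasFDerivAt_fourierValue c ν (α := []) (by simp) m)
  rw [show 𝓜.g = _ from funext (h.g_eq ν)]
  refine (h1.add (HasFDerivAt.fun_sum h2)).congr_fderiv ?_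
  ext x
  simp only [add_apply, neg_apply, sum_apply, ContinuousLinearMap.comp_apply,
    ContinuousLinearMap.smulRight_apply, ContinuousLinearMap.proj_apply, map_neg, map_sum,
    Complex.reCLM_apply, Complex.smul_re, smul_eq_mul, mul_add, Finset.sum_add_distrib,
    Finset.sum_neg_distrib, Finset.mul_sum, neg_add]
  rw [Finset.sum_comm]

lemma IsAdmissible.fderiv_g_single (h : 𝓜.IsAdmissible M) (ν : Fin 3) (m : Fin d → ℝ)
    (i : Fin d) : fderiv ℝ 𝓜.g m (Pi.single i 1) =
      -(𝓜.slope i + ∑ c, (𝓜.fourierValue c ν [i] m).re) := by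
  rw [(h.hasFDerivAt_g ν m).fderiv]
  simp [Pi.single_apply]

/-- First-order Fourier values do not depend on the damping vector. -/
lemma IsAdmissible.gFou1_eq (h : 𝓜.IsAdmissible M) (ν : Fin 3) (m : Fin d → ℝ) (i : Fin d) :
    𝓜.gFou1 m i = 𝓜.slope i + ∑ c, (𝓜.fourierValue c ν [i] m).re := by
  -- Either side is minus a partial derivative of the same function `g`, represented with different
  -- damping vectors.
  have h1 := h.fderiv_g_single 1 m i
  rw [h.fderiv_g_single ν m i] at h1
  exact (neg_injective h1).symm

lemma IsAdmissible.hasFDerivAt_gFou1 (h : 𝓜.IsAdmissible M) (ν : Fin 3) (m : Fin d → ℝ)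
    (i : Fin d) : HasFDerivAt (fun m => 𝓜.gFou1 m i)
      (-∑ j, (ContinuousLinearMap.proj (R := ℝ) (φ := fun _ : Fin d => ℝ) j).smulRight
        (∑ c, (𝓜.fourierValue c ν [j, i] m).re)) m := by
  have h2 : ∀ c ∈ Finset.univ, HasFDerivAt (fun m => (𝓜.fourierValue c ν [i] m).re) _ m :=
    fun c _ => Complex.reCLM.hasFDerivAt.comp m
      (h.hasFDerivAt_fourierValue c ν (α := [i]) (by simp) m)
  rw [show (fun m => 𝓜.gFou1 m i) = _ from funext fun m => h.gFou1_eq ν m i]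
  refine ((HasFDerivAt.fun_sum h2).const_add (𝓜.slope i)).congr_fderiv ?_
  ext x
  simp only [neg_apply, sum_apply, ContinuousLinearMap.comp_apply,
    ContinuousLinearMap.smulRight_apply, ContinuousLinearMap.proj_apply, map_neg, map_sum,
    Complex.reCLM_apply, Complex.smul_re, smul_eq_mul, Finset.sum_neg_distrib, Finset.mul_sum]
  rw [Finset.sum_comm]

/-- Second-order Fourier values do not depend on the damping vector. -/
lemma IsAdmissible.gFou2_eq (h : 𝓜.IsAdmissible M) (ν : Fin 3) (m : Fin d → ℝ) (i j : Fin d) :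
    𝓜.gFou2 m i j = ∑ c, (𝓜.fourierValue c ν [j, i] m).re := by
  have h1 := congrArg (fun L => L (Pi.single j 1))
    ((h.hasFDerivAt_gFou1 2 m i).unique (h.hasFDerivAt_gFou1 ν m i))
  simp only [neg_apply, sum_apply, ContinuousLinearMap.smulRight_apply,
    ContinuousLinearMap.proj_apply, Pi.single_apply, smul_eq_mul, ite_mul, one_mul, zero_mul,
    Finset.sum_ite_eq', Finset.mem_univ, if_true, neg_inj] at h1
  rw [← h1]
  simp only [gFou2, Matrix.of_apply, fourierValue, 𝓜.integrand_swap _ _ i j]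

lemma IsAdmissible.ae_differentiableAt_loss_sub (h : 𝓜.IsAdmissible M) (m : Fin d → ℝ) :
    ∀ᵐ x ∂𝓜.law, DifferentiableAt ℝ 𝓜.loss (x - m) := by
  have h1 : ∀ᵐ x : Fin d → ℝ, DifferentiableAt ℝ 𝓜.loss x :=
    ae_differentiableAt_of_locallyLipschitz h.isLoss.convex.locallyLipschitz
  exact h.density ((measurePreserving_sub_right volume m).quasiMeasurePreserving.ae h1)

/-- The expected gradient of the loss is minus the gradient of the expected loss, and is given by
the Fourier representation. -/
theorem IsAdmissible.gGrad_eq (h : 𝓜.IsAdmissible M) (m : Fin d → ℝ) : 𝓜.gGrad m = 𝓜.gFou1 m := by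
  ext i
  set e : Fin d → ℝ := Pi.single i 1 with he
  have hint := h.integrable_loss_sub
  have hsub : ∀ (x : Fin d → ℝ) (t : ℝ), x - (m - t • e) = x - m + t • e := fun x t => by
    abel
  have hint' : ∀ t : ℝ, Integrable (fun x => 𝓜.loss (x - m + t • e)) 𝓜.law := fun t =>
    (hint (m - t • e)).congr (Eventually.of_forall fun x => by simp only [hsub])
  -- Right difference quotients of the loss are nonnegative by monotonicity and, by convexity, at
  -- most the quotient with step 1. They converge for almost every `x`, since the loss is
  -- differentiable almost everywhere and the law has a density.
  have hlim : Tendsto (fun t : ℝ => ∫ x, t⁻¹ • (𝓜.loss (x - m + t • e) - 𝓜.loss (x - m)) ∂𝓜.law)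
      (𝓝[>] 0) (𝓝 (𝓜.gGrad m i)) := by
    refine tendsto_integral_filter_of_dominated_convergence
      (fun x => 𝓜.loss (x - m + (1:ℝ) • e) - 𝓜.loss (x - m))
      (Eventually.of_forall fun t => (((hint' t).sub (hint m)).smul t⁻¹).aestronglyMeasurable) ?_
      ((hint' 1).sub (hint m)) ?_
    · filter_upwards [Ioc_mem_nhdsGT (zero_lt_one (α := ℝ))] with t ht
      refine Eventually.of_forall fun x => ?_
      have hmono : 𝓜.loss (x - m) ≤ 𝓜.loss (x - m + t • e) := by
        refine h.isLoss.mono (le_add_of_nonneg_right ?_)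
        exact smul_nonneg ht.1.le (Pi.single_nonneg.2 zero_le_one)
      have hconv := h.isLoss.convex.2 (Set.mem_univ (x - m)) (Set.mem_univ (x - m + (1:ℝ) • e))
        (sub_nonneg.2 ht.2) ht.1.le (sub_add_cancel _ _)
      have e1 : (1 - t) • (x - m) + t • (x - m + (1:ℝ) • e) = x - m + t • e := by
        module
      rw [e1] at hconv
      simp only [smul_eq_mul] at hconv ⊢
      rw [Real.norm_of_nonneg (mul_nonneg (inv_nonneg.2 ht.1.le) (sub_nonneg.2 hmono)),
        inv_mul_le_iff₀ ht.1]
      linarith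
    · filter_upwards [h.ae_differentiableAt_loss_sub m] with x hx
      have := hx.hasFDerivAt.hasLineDerivAt e
      have := this.tendsto_slope_zero_right
      simpa using this
  -- The direction is `-e` because `g` depends on the allocation through `x - m`.
  have hg : HasLineDerivAt ℝ 𝓜.g (fderiv ℝ 𝓜.g m (-e)) m (-e) :=
    (h.hasFDerivAt_g 1 m).differentiableAt.hasFDerivAt.hasLineDerivAt (-e)
  have hg' := hg.tendsto_slope_zero_right
  have heq : ∀ t : ℝ, ∫ x, t⁻¹ • (𝓜.loss (x - m + t • e) - 𝓜.loss (x - m)) ∂𝓜.law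
      = t⁻¹ • (𝓜.g (m + t • -e) - 𝓜.g m) := by
    intro t
    rw [integral_smul, integral_sub (hint' t) (hint m)]
    simp only [g, smul_neg, ← sub_eq_add_neg, hsub]
  simp only [heq] at hlim
  rw [tendsto_nhds_unique hlim hg', map_neg, he, h.fderiv_g_single 1 m i, neg_neg]
  rfl

end Model

end FourierRQMC

namespace FourierRQMC

/-! ### Averages over independent randomizations -/

section Averages

variable {Ω E : Type*} {Y : ℕ → ℕ → Ω → E}

/-- The average of `F` over the first `N` points of each of the first `S` randomizations. -/
noncomputable def replicatedMean (Y : ℕ → ℕ → Ω → E) (F : E → ℝ) (N S : ℕ) (ω : Ω) : ℝ :=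
  (S : ℝ)⁻¹ * ∑ s ∈ Finset.range S, (N : ℝ)⁻¹ * ∑ n ∈ Finset.range N, F (Y s n ω)

lemma abs_replicatedMean_le (F : E → ℝ) (N S : ℕ) (ω : Ω) :
    |replicatedMean Y F N S ω| ≤ replicatedMean Y (fun y => |F y|) N S ω := by
  simp only [replicatedMean, abs_mul, abs_inv, Nat.abs_cast]
  gcongr
  refine (Finset.abs_sum_le_sum_abs _ _).trans (Finset.sum_le_sum fun s _ => ?_)
  rw [abs_mul, abs_inv, Nat.abs_cast]
  gcongr
  exact Finset.abs_sum_le_sum_abs _ _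

lemma replicatedMean_add (F G : E → ℝ) (N S : ℕ) (ω : Ω) :
    replicatedMean Y (fun y => F y + G y) N S ω =
      replicatedMean Y F N S ω + replicatedMean Y G N S ω := by
  simp only [replicatedMean, Finset.sum_add_distrib, mul_add]

variable [MeasurableSpace Ω] {P : Measure Ω}

/-- Mean square error of an average of pairwise independent variables with common mean. -/
lemma integral_sq_average_sub_le [IsProbabilityMeasure P] {X : ℕ → Ω → ℝ} (hX : ∀ s, MemLp (X s) 2 P)
    (hind : Pairwise fun s s' => IndepFun (X s) (X s') P) {a V : ℝ} (ha : ∀ s, ∫ ω, X s ω ∂P = a)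
    (hV : ∀ s, variance (X s) P ≤ V) {S : ℕ} (hS : 1 ≤ S) :
    ∫ ω, ((S : ℝ)⁻¹ * ∑ s ∈ Finset.range S, X s ω - a) ^ 2 ∂P ≤ (S : ℝ)⁻¹ * V := by
  have hS0 : (S : ℝ) ≠ 0 := by positivity
  have hsum : MemLp (∑ s ∈ Finset.range S, X s) 2 P := memLp_finsetSum' _ fun s _ => hX s
  have hmean : ∫ ω, (∑ s ∈ Finset.range S, X s) ω ∂P = S * a := by
    simp only [Finset.sum_apply]
    rw [integral_finsetSum _ fun s _ => (hX s).integrable one_le_two]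
    simp [ha]
  have h1 : variance (∑ s ∈ Finset.range S, X s) P ≤ S * V := by
    rw [IndepFun.variance_sum (fun s _ => hX s) fun s _ s' _ hss => hind hss]
    exact (Finset.sum_le_sum fun s _ => hV s).trans (by simp)
  rw [variance_eq_integral hsum.aestronglyMeasurable.aemeasurable, hmean] at h1
  have h2 : ∀ ω, ((S : ℝ)⁻¹ * ∑ s ∈ Finset.range S, X s ω - a) ^ 2 =
      ((S : ℝ)⁻¹) ^ 2 * ((∑ s ∈ Finset.range S, X s) ω - S * a) ^ 2 := by
    intro ω
    rw [← mul_pow, mul_sub, inv_mul_cancel_left₀ hS0, Finset.sum_apply]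
  simp_rw [h2]
  rw [integral_const_mul]
  calc ((S : ℝ)⁻¹) ^ 2 * ∫ ω, ((∑ s ∈ Finset.range S, X s) ω - S * a) ^ 2 ∂P
      ≤ ((S : ℝ)⁻¹) ^ 2 * (S * V) := by gcongr
    _ = (S : ℝ)⁻¹ * V := by field_simp

variable [MeasurableSpace E] {μ : Measure E}

lemma integrable_replicatedMean (hY : ∀ s n, MeasurePreserving (Y s n) P μ) {F : E → ℝ}
    (hF : Integrable F μ) (N S : ℕ) : Integrable (replicatedMean Y F N S) P :=
  (integrable_finsetSum _ fun s _ => (integrable_finsetSum _ fun n _ =>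
    (hY s n).integrable_comp_of_integrable hF).const_mul _).const_mul _

lemma integral_replicatedMean (hY : ∀ s n, MeasurePreserving (Y s n) P μ) {F : E → ℝ}
    (hF : Integrable F μ) {N S : ℕ} (hN : 1 ≤ N) (hS : 1 ≤ S) :
    ∫ ω, replicatedMean Y F N S ω ∂P = ∫ y, F y ∂μ := by
  have hc : ∀ s n, ∫ ω, F (Y s n ω) ∂P = ∫ y, F y ∂μ := fun s n => by
    rw [← (hY s n).map_eq, integral_map (hY s n).aemeasurable
      (by rw [(hY s n).map_eq]; exact hF.aestronglyMeasurable)]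
  have hi : ∀ s n, Integrable (fun ω => F (Y s n ω)) P := fun s n =>
    (hY s n).integrable_comp_of_integrable hF
  have hN0 : (N : ℝ) ≠ 0 := by positivity
  have hS0 : (S : ℝ) ≠ 0 := by positivity
  simp only [replicatedMean]
  rw [integral_const_mul, integral_finsetSum _ fun s _ =>
    (integrable_finsetSum _ fun n _ => hi s n).const_mul _]
  simp only [integral_const_mul, integral_finsetSum _ fun n _ => hi _ n, hc, Finset.sum_const,
    Finset.card_range, nsmul_eq_mul, inv_mul_cancel_left₀ hN0, inv_mul_cancel_left₀ hS0]

/-- Inside a randomization the dependence is arbitrary, and Cauchy–Schwarz bounds the second moment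
of the inner average by that of one point. The factor `1 / S` comes from independence between
randomizations. -/
lemma integral_sq_replicatedMean_sub_le [IsProbabilityMeasure P] [IsProbabilityMeasure μ]
    (hY : ∀ s n, MeasurePreserving (Y s n) P μ)
    (hind : Pairwise fun s s' => IndepFun (fun ω n => Y s n ω) (fun ω n => Y s' n ω) P)
    {G : E → ℝ} (hGm : Measurable G) (hG : MemLp G 2 μ) {N S : ℕ} (hN : 1 ≤ N) (hS : 1 ≤ S) :
    ∫ ω, (replicatedMean Y G N S ω - ∫ y, G y ∂μ) ^ 2 ∂P ≤ (S : ℝ)⁻¹ * ∫ y, G y ^ 2 ∂μ := by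
  have hN0 : (N : ℝ) ≠ 0 := by positivity
  have hmem : ∀ s n, MemLp (fun ω => G (Y s n ω)) 2 P := fun s n =>
    hG.comp_measurePreserving (hY s n)
  have hmem' : ∀ s, MemLp (fun ω => (N : ℝ)⁻¹ * ∑ n ∈ Finset.range N, G (Y s n ω)) 2 P :=
    fun s => (memLp_finsetSum _ fun n _ => hmem s n).const_mul _
  have hc : ∀ {F : E → ℝ}, Integrable F μ → ∀ s n, ∫ ω, F (Y s n ω) ∂P = ∫ y, F y ∂μ := by
    intro F hF s n
    rw [← (hY s n).map_eq, integral_map (hY s n).aemeasurable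
      (by rw [(hY s n).map_eq]; exact hF.aestronglyMeasurable)]
  refine integral_sq_average_sub_le hmem' (fun s s' hss => ?_) (fun s => ?_) (fun s => ?_) hS
  · have hm : Measurable fun y : ℕ → E => (N : ℝ)⁻¹ * ∑ n ∈ Finset.range N, G (y n) :=
      (Finset.measurable_fun_sum _ fun n _ => hGm.comp (measurable_pi_apply n)).const_mul _
    exact (hind hss).comp hm hm
  · rw [integral_const_mul, integral_finsetSum _ fun n _ => (hmem s n).integrable one_le_two]
    simp only [hc (hG.integrable one_le_two), Finset.sum_const, Finset.card_range, nsmul_eq_mul,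
      inv_mul_cancel_left₀ hN0]
  · refine (variance_le_expectation_sq (hmem' s).aestronglyMeasurable).trans ?_
    have hint : ∀ n, Integrable (fun ω => G (Y s n ω) ^ 2) P := fun n => (hmem s n).integrable_sq
    calc ∫ ω, ((N : ℝ)⁻¹ * ∑ n ∈ Finset.range N, G (Y s n ω)) ^ 2 ∂P
        ≤ ∫ ω, (N : ℝ)⁻¹ * ∑ n ∈ Finset.range N, G (Y s n ω) ^ 2 ∂P := by
          refine integral_mono (hmem' s).integrable_sq
            ((integrable_finsetSum _ fun n _ => hint n).const_mul _) fun ω => ?_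
          have := sq_sum_le_card_mul_sum_sq (s := Finset.range N) (f := fun n => G (Y s n ω))
          rw [Finset.card_range] at this
          dsimp only
          rw [mul_pow]
          calc ((N : ℝ)⁻¹) ^ 2 * (∑ n ∈ Finset.range N, G (Y s n ω)) ^ 2
              ≤ ((N : ℝ)⁻¹) ^ 2 * (N * ∑ n ∈ Finset.range N, G (Y s n ω) ^ 2) := by gcongr
            _ = _ := by field_simp
      _ = ∫ y, G y ^ 2 ∂μ := by
          rw [integral_const_mul, integral_finsetSum _ fun n _ => hint n]
          simp only [hc (F := fun y => G y ^ 2) hG.integrable_sq, Finset.sum_const,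
            Finset.card_range, nsmul_eq_mul, inv_mul_cancel_left₀ hN0]

/-- Weak law of large numbers in `L¹` for replicated averages, without any condition on the
dependence within a randomization. -/
theorem tendsto_integral_abs_replicatedMean_sub [IsProbabilityMeasure P] [IsProbabilityMeasure μ]
    (hY : ∀ s n, MeasurePreserving (Y s n) P μ)
    (hind : Pairwise fun s s' => IndepFun (fun ω n => Y s n ω) (fun ω n => Y s' n ω) P)
    {F : E → ℝ} (hF : Integrable F μ) {Nseq Sseq : ℕ → ℕ} (hN : ∀ᶠ j in atTop, 1 ≤ Nseq j)
    (hS : Tendsto Sseq atTop atTop) :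
    Tendsto (fun j => ∫ ω, |replicatedMean Y F (Nseq j) (Sseq j) ω - ∫ y, F y ∂μ| ∂P)
      atTop (𝓝 0) := by
  rw [Metric.tendsto_atTop']
  intro ε hε
  -- Truncation: a simple function is square integrable, so the variance bound applies to `G`, while
  -- the remainder is small in `L¹` uniformly in `N` and `S`.
  obtain ⟨G, hG, -⟩ := (memLp_one_iff_integrable.2 hF).exists_simpleFunc_eLpNorm_sub_lt
    ENNReal.one_ne_top (ε := ENNReal.ofReal (ε / 4)) (by simpa using hε)
  have hG2 : MemLp G 2 μ := G.memLp_of_isFiniteMeasure 2 μ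
  have hR : Integrable (fun y => F y - G y) μ := hF.sub (hG2.integrable one_le_two)
  have hRlt : ∫ y, |F y - G y| ∂μ < ε / 4 := by
    rw [eLpNorm_one_eq_lintegral_enorm] at hG
    have h1 := ofReal_integral_norm_eq_lintegral_enorm hR
    have h2 : ENNReal.ofReal (∫ y, ‖F y - G y‖ ∂μ) < ENNReal.ofReal (ε / 4) := by
      rw [h1]; exact hG
    exact (ENNReal.ofReal_lt_ofReal_iff (by positivity)).1 h2
  have hlim : Tendsto (fun j => 4 / ε * ((Sseq j : ℝ)⁻¹ * ∫ y, G y ^ 2 ∂μ)) atTop (𝓝 0) := by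
    have := (((tendsto_inv_atTop_nhds_zero_nat (𝕜 := ℝ)).comp hS).mul_const
      (∫ y, G y ^ 2 ∂μ)).const_mul (4 / ε)
    simpa using this
  have hev := ((hlim.eventually (gt_mem_nhds (show (0:ℝ) < ε / 4 by positivity))).and
    (hN.and (hS.eventually_ge_atTop 1)))
  obtain ⟨j₀, hj₀⟩ := eventually_atTop.1 hev
  refine ⟨j₀, fun j hj => ?_⟩
  obtain ⟨h1, hNj, hSj⟩ := hj₀ j hj.le
  rw [Real.dist_eq, sub_zero, abs_of_nonneg (integral_nonneg fun ω => abs_nonneg _)]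
  have hTG : MemLp (replicatedMean Y G (Nseq j) (Sseq j)) 2 P :=
    (memLp_finsetSum _ fun s _ => (memLp_finsetSum _ fun n _ =>
      hG2.comp_measurePreserving (hY s n)).const_mul _).const_mul _
  have hsq : Integrable (fun ω => (replicatedMean Y G (Nseq j) (Sseq j) ω - ∫ y, G y ∂μ) ^ 2) P :=
    (hTG.sub (memLp_const _)).integrable_sq
  have hTR := integrable_replicatedMean hY hR.abs (Nseq j) (Sseq j)
  have hpt : ∀ ω, |replicatedMean Y F (Nseq j) (Sseq j) ω - ∫ y, F y ∂μ| ≤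
      (ε / 4 + 4 / ε * (replicatedMean Y G (Nseq j) (Sseq j) ω - ∫ y, G y ∂μ) ^ 2) +
      (replicatedMean Y (fun y => |F y - G y|) (Nseq j) (Sseq j) ω + ∫ y, |F y - G y| ∂μ) := by
    intro ω
    have e1 : replicatedMean Y F (Nseq j) (Sseq j) ω = replicatedMean Y G (Nseq j) (Sseq j) ω +
        replicatedMean Y (fun y => F y - G y) (Nseq j) (Sseq j) ω := by
      rw [← replicatedMean_add]
      simp
    have e2 : ∫ y, F y ∂μ = ∫ y, G y ∂μ + ∫ y, (F y - G y) ∂μ := by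
      rw [integral_sub hF (hG2.integrable one_le_two)]
      ring
    have e3 := abs_replicatedMean_le (Y := Y) (fun y => F y - G y) (Nseq j) (Sseq j) ω
    have e4 : |∫ y, (F y - G y) ∂μ| ≤ ∫ y, |F y - G y| ∂μ := abs_integral_le_integral_abs
    set x := replicatedMean Y G (Nseq j) (Sseq j) ω - ∫ y, G y ∂μ with hx
    -- Completing the square trades the absolute value for a second moment. The four contributions
    -- to the final bound are then each at most `ε / 4`, two of them strictly smaller.
    have e5 : |x| ≤ ε / 4 + 4 / ε * x ^ 2 := by
      have h3 : 0 ≤ 4 / ε * (|x| - ε / 4) ^ 2 := by positivity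
      have h4 : 4 / ε * (|x| - ε / 4) ^ 2 = 4 / ε * x ^ 2 - 2 * |x| + ε / 4 := by
        rw [← sq_abs x]; field_simp; ring
      have := abs_nonneg x
      linarith
    rw [e1, e2]
    have e6 : replicatedMean Y G (Nseq j) (Sseq j) ω +
        replicatedMean Y (fun y => F y - G y) (Nseq j) (Sseq j) ω -
        (∫ y, G y ∂μ + ∫ y, (F y - G y) ∂μ) = x +
        (replicatedMean Y (fun y => F y - G y) (Nseq j) (Sseq j) ω - ∫ y, (F y - G y) ∂μ) := by
      rw [hx]; ring
    rw [e6]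
    exact (abs_add_le _ _).trans (add_le_add e5 ((abs_sub _ _).trans (add_le_add e3 e4)))
  have hint1 : Integrable (fun ω => ε / 4 + 4 / ε *
      (replicatedMean Y G (Nseq j) (Sseq j) ω - ∫ y, G y ∂μ) ^ 2) P :=
    (integrable_const _).add (hsq.const_mul _)
  have hint2 : Integrable (fun ω => replicatedMean Y (fun y => |F y - G y|) (Nseq j) (Sseq j) ω +
      ∫ y, |F y - G y| ∂μ) P := hTR.add (integrable_const _)
  have hmain := integral_mono (((integrable_replicatedMean hY hF (Nseq j) (Sseq j)).sub
    (integrable_const (∫ y, F y ∂μ))).abs) (hint1.add hint2) hpt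
  refine hmain.trans_lt ?_
  simp only [Pi.add_apply]
  rw [integral_add hint1 hint2, integral_add (integrable_const _) (hsq.const_mul _),
    integral_add hTR (integrable_const _), integral_const_mul,
    integral_replicatedMean hY hR.abs hNj hSj]
  have hb := integral_sq_replicatedMean_sub_le hY hind G.measurable hG2 hNj hSj
  have hb' := mul_le_mul_of_nonneg_left hb (show 0 ≤ 4 / ε by positivity)
  simp only [integral_const, probReal_univ, smul_eq_mul, one_mul]
  linarith

end Averages

end FourierRQMC

namespace FourierRQMC

namespace Model

/-! ### The scrambled points of the model -/

section Sampling

variable {d : ℕ} {C : Type*} {𝓜 : Model d C} {Ω : Type*}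
  {v : (k : ℕ) → ℕ → Fin (𝓜.dim k) → ℝ}
  {ξ : ℕ → (k : ℕ) → Fin (𝓜.dim k) → List Bool → Ω → Bool}

/-- The random bits of the `s`-th randomization. -/
def bitBlock (ξ : ℕ → (k : ℕ) → Fin (𝓜.dim k) → List Bool → Ω → Bool) (s : ℕ) (ω : Ω)
    (q : (Σ k : ℕ, Fin (𝓜.dim k)) × List Bool) : Bool := ξ s q.1.1 q.1.2 q.2 ω

/-- The `n`-th scrambled point as a function of a block of bits. -/
noncomputable def blockPoint (v : (k : ℕ) → ℕ → Fin (𝓜.dim k) → ℝ) (k n : ℕ)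
    (b : (Σ k : ℕ, Fin (𝓜.dim k)) × List Bool → Bool) : Fin (𝓜.dim k) → ℝ :=
  fun j => scrambleCoord (fun w => b (⟨k, j⟩, w)) (v k n j)

lemma measurable_blockPoint (k n : ℕ) : Measurable (blockPoint (𝓜 := 𝓜) v k n) :=
  measurable_pi_lambda _ fun j => measurable_bitValue.comp (measurable_pi_lambda _ fun i =>
    (measurable_of_countable (fun c : Bool => xor (binaryDigit (v k n j) i) c)).comp
      (measurable_pi_apply _))

variable [MeasurableSpace Ω] {P : Measure Ω} (hξ : IsUniformScrambling P ξ)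
include hξ

lemma isFairBits_of_isUniformScrambling : IsFairBits P
    (fun (q : ℕ × (Σ k : ℕ, Fin (𝓜.dim k)) × List Bool) => ξ q.1 q.2.1.1 q.2.1.2 q.2.2) :=
  ⟨fun _ => hξ.measurable _ _ _ _, fun _ => hξ.fair _ _ _ _, hξ.indep⟩

lemma measurable_bitBlock (s : ℕ) : Measurable (bitBlock ξ s) :=
  measurable_pi_lambda _ fun _ => hξ.measurable _ _ _ _

lemma isFairBits_point (s k : ℕ) :
    IsFairBits P (fun q : Fin (𝓜.dim k) × List Bool => ξ s k q.1 q.2) :=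
  (isFairBits_of_isUniformScrambling hξ).precomp (g := fun q : Fin (𝓜.dim k) × List Bool => (s, ((⟨k, q.1⟩ : Σ k : ℕ, Fin (𝓜.dim k)), q.2)))
    fun a b hab => by
      simp only [Prod.mk.injEq, Sigma.mk.injEq, true_and, heq_eq_eq] at hab
      exact Prod.ext hab.1 hab.2

lemma measurePreserving_point (s k n : ℕ) : MeasurePreserving (𝓜.point v ξ s k n) P
    (volume.restrict (openCube (𝓜.dim k))) :=
  (isFairBits_point hξ s k).measurePreserving (v k n)

lemma pairwise_indepFun_bitBlock :
    Pairwise fun s s' => IndepFun (bitBlock ξ s) (bitBlock ξ s') P := fun _ _ hss =>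
  (isFairBits_of_isUniformScrambling hξ).iIndepFun_curry.indepFun hss

lemma map_bitBlock (s : ℕ) : P.map (bitBlock ξ s) = P.map (bitBlock ξ 0) := by
  have hb := isFairBits_of_isUniformScrambling hξ
  have hs : ∀ s : ℕ, IsFairBits P
      (fun (q : (Σ k : ℕ, Fin (𝓜.dim k)) × List Bool) => ξ s q.1.1 q.1.2 q.2) := fun s =>
    hb.precomp (g := fun q => (s, q)) fun a b hab => by simpa using hab
  exact (hs s).map_fun_eq (hs 0) fun q => hb.map_eq (s, q) (0, q)

lemma pairwise_indepFun_point (k : ℕ) : Pairwise fun s s' =>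
    IndepFun (fun ω n => 𝓜.point v ξ s k n ω) (fun ω n => 𝓜.point v ξ s' k n ω) P := by
  intro s s' hss
  have hm : Measurable fun (b : (Σ k : ℕ, Fin (𝓜.dim k)) × List Bool → Bool) n =>
      blockPoint (𝓜 := 𝓜) v k n b := measurable_pi_lambda _ fun n => measurable_blockPoint k n
  exact (pairwise_indepFun_bitBlock hξ hss).comp hm hm

end Sampling

/-! ### The integrands on the unit cube -/

section Integrands

variable {d : ℕ} {C : Type*} [Fintype C] {𝓜 : Model d C} {M : Set (Fin d → ℝ)}

lemma IsAdmissible.continuous_charFn (h : 𝓜.IsAdmissible M) (ν : Fin 3) (c : C) :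
    Continuous fun u => 𝓜.charFn c (𝓜.contour c (𝓜.damp ν c) u) := by
  have := h.prob
  refine continuous_of_dominated (F := fun u x => Complex.exp (Complex.I *
    ∑ i, 𝓜.contour c (𝓜.damp ν c) u i * (𝓜.proj c x i : ℂ)))
    (fun u => Continuous.aestronglyMeasurable (by unfold proj; fun_prop)) (fun u => ?_)
    (h.damp_law ν c)
    (Eventually.of_forall fun x => by unfold contour; fun_prop)
  refine Eventually.of_forall fun x => le_of_eq ?_
  rw [Complex.norm_exp]
  congr 1
  simp [contour, Complex.mul_re, Complex.mul_im]

lemma IsAdmissible.continuous_compHat (h : 𝓜.IsAdmissible M) (ν : Fin 3) (c : C) :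
    Continuous fun u => 𝓜.compHat c (𝓜.contour c (𝓜.damp ν c) u) := by
  have hre : ∀ u x : 𝓜.supp c → ℝ, ‖Complex.exp (-(Complex.I *
      ∑ i, 𝓜.contour c (𝓜.damp ν c) u i * (x i : ℂ)))‖
        = Real.exp (∑ i, 𝓜.damp ν c i * x i) := by
    intro u x
    rw [Complex.norm_exp]
    congr 1
    simp [contour, Complex.mul_re, Complex.mul_im]
  have hcomp : AEStronglyMeasurable (𝓜.comp c) volume := by
    have h1 := (Continuous.aestronglyMeasurable (μ := volume) (f := fun x : 𝓜.supp c → ℝ =>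
      Real.exp (-∑ i, 𝓜.damp ν c i * x i)) (by fun_prop)).mul
      (h.damp_comp ν c).aestronglyMeasurable
    refine h1.congr (Eventually.of_forall fun x => ?_)
    simp only [Pi.mul_apply]
    rw [← mul_assoc, ← Real.exp_add, neg_add_cancel, Real.exp_zero, one_mul]
  refine continuous_of_dominated (F := fun u x => Complex.exp (-(Complex.I *
    ∑ i, 𝓜.contour c (𝓜.damp ν c) u i * (x i : ℂ))) * (𝓜.comp c x : ℂ))
    (fun u => (Continuous.aestronglyMeasurable (by fun_prop)).mul
      (Complex.continuous_ofReal.comp_aestronglyMeasurable hcomp)) (fun u => ?_)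
    (h.damp_comp ν c).norm
    (Eventually.of_forall fun x => by unfold contour; fun_prop)
  refine Eventually.of_forall fun x => le_of_eq ?_
  rw [norm_mul, norm_mul, hre, Complex.norm_real, Real.norm_of_nonneg (Real.exp_pos _).le]

omit [Fintype C] in
lemma continuous_symb (c : C) (K : 𝓜.supp c → ℝ) (j : Fin d) :
    Continuous fun u => 𝓜.symb c (𝓜.contour c K u) j := by
  unfold symb contour
  split_ifs <;> fun_prop

lemma IsAdmissible.continuous_integrand (h : 𝓜.IsAdmissible M) (ν : Fin 3) (c : C)
    (α : List (Fin d)) (m : Fin d → ℝ) : Continuous (𝓜.integrand c (𝓜.damp ν c) α m) := by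
  have h1 : Continuous fun u => (α.map (𝓜.symb c (𝓜.contour c (𝓜.damp ν c) u))).prod := by
    induction α with
    | nil => simpa using continuous_const
    | cons j α ih =>
      simp only [List.map_cons, List.prod_cons]
      exact (continuous_symb c _ j).mul ih
  exact ((Continuous.mul continuous_const (by fun_prop)).mul (h.continuous_charFn ν c)).mul
    (h1.mul (h.continuous_compHat ν c))

lemma IsAdmissible.measurable_tIntegrand (h : 𝓜.IsAdmissible M) (ν : Fin 3) (c : C)
    (α : List (Fin d)) (m : Fin d → ℝ) : Measurable (𝓜.tIntegrand c (𝓜.damp ν c) α m) :=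
  ((Complex.continuous_re.comp (h.continuous_integrand ν c α m)).measurable.comp
    (h.trans_measurable c)).mul (h.weight_measurable c)

/-- Change of variables from the frequency space to the unit cube. -/
lemma IsAdmissible.integral_trans (h : 𝓜.IsAdmissible M) (c : C) {f : (𝓜.supp c → ℝ) → ℝ}
    (hf : Integrable f) :
    Integrable (fun w => f (𝓜.trans c w) * 𝓜.weight c w)
      (volume.restrict (openCube (𝓜.dim (𝓜.supp c).card))) ∧
    ∫ w in openCube (𝓜.dim (𝓜.supp c).card), f (𝓜.trans c w) * 𝓜.weight c w = ∫ u, f u := by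
  have hw : Measurable fun w => ENNReal.ofReal (𝓜.weight c w) :=
    (h.weight_measurable c).ennreal_ofReal
  have hT := (h.trans_measurable c).aemeasurable (μ := (volume.restrict
    (openCube (𝓜.dim (𝓜.supp c).card))).withDensity fun w => ENNReal.ofReal (𝓜.weight c w))
  have hlt : ∀ᵐ w ∂(volume.restrict (openCube (𝓜.dim (𝓜.supp c).card))),
      ENNReal.ofReal (𝓜.weight c w) < ⊤ := Eventually.of_forall fun _ => ENNReal.ofReal_lt_top
  have e : ∀ w, (ENNReal.ofReal (𝓜.weight c w)).toReal • f (𝓜.trans c w)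
      = f (𝓜.trans c w) * 𝓜.weight c w := fun w => by
    rw [ENNReal.toReal_ofReal (h.weight_nonneg c w), smul_eq_mul, mul_comm]
  have hf' := hf
  rw [← h.change_of_variables c] at hf'
  constructor
  · have h1 := hf'.comp_aemeasurable hT
    rw [integrable_withDensity_iff_integrable_smul' hw hlt] at h1
    exact h1.congr (Eventually.of_forall e)
  · calc ∫ w in openCube (𝓜.dim (𝓜.supp c).card), f (𝓜.trans c w) * 𝓜.weight c w
        = ∫ w, f (𝓜.trans c w) ∂((volume.restrict
            (openCube (𝓜.dim (𝓜.supp c).card))).withDensity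
              fun w => ENNReal.ofReal (𝓜.weight c w)) := by
          rw [integral_withDensity_eq_integral_toReal_smul hw hlt]
          simp only [e]
      _ = ∫ u, f u ∂((volume.restrict (openCube (𝓜.dim (𝓜.supp c).card))).withDensity
              fun w => ENNReal.ofReal (𝓜.weight c w)).map (𝓜.trans c) :=
          (integral_map hT hf'.aestronglyMeasurable).symm
      _ = ∫ u, f u := by rw [h.change_of_variables c]

lemma IsAdmissible.integrable_tIntegrand (h : 𝓜.IsAdmissible M) (ν : Fin 3) (c : C)
    {α : List (Fin d)} (hα : α.length ≤ 2) (m : Fin d → ℝ) :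
    Integrable (𝓜.tIntegrand c (𝓜.damp ν c) α m)
      (volume.restrict (openCube (𝓜.dim (𝓜.supp c).card))) :=
  (h.integral_trans c (h.damp_integrand ν c α hα m).re).1

lemma IsAdmissible.integral_tIntegrand (h : 𝓜.IsAdmissible M) (ν : Fin 3) (c : C)
    {α : List (Fin d)} (hα : α.length ≤ 2) (m : Fin d → ℝ) :
    ∫ w in openCube (𝓜.dim (𝓜.supp c).card), 𝓜.tIntegrand c (𝓜.damp ν c) α m w
      = (𝓜.fourierValue c ν α m).re :=
  ((h.integral_trans c (h.damp_integrand ν c α hα m).re).2).trans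
    (integral_re (h.damp_integrand ν c α hα m))

/-- A modulus of continuity in the allocation for the integrands. -/
noncomputable def modulus (𝓜 : Model d C) (c : C) (ν : Fin 3) (α : List (Fin d)) (m : Fin d → ℝ)
    (δ : ℝ) (u : 𝓜.supp c → ℝ) : ℝ :=
  ‖𝓜.integrand c (𝓜.damp ν c) α m u‖ * ((Real.exp ((∑ i, |𝓜.damp ν c i|) * δ) - 1) +
    Real.exp ((∑ i, |𝓜.damp ν c i|) * δ) * min 2 ((∑ i, |u i|) * δ))

-- The shift multiplies the integrand by exp(a + ib), and |exp(a + ib) - 1| ≤ |exp a - 1| + exp a ·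
-- |exp(ib) - 1|. Capping the last factor at 2 keeps the modulus dominated by the integrand itself,
-- without a further moment in `u`.
omit [Fintype C] in
lemma norm_integrand_sub_le (c : C) (ν : Fin 3) (α : List (Fin d)) {m m' : Fin d → ℝ} {δ : ℝ}
    (hm : ‖m' - m‖ ≤ δ) (u : 𝓜.supp c → ℝ) :
    ‖𝓜.integrand c (𝓜.damp ν c) α m' u - 𝓜.integrand c (𝓜.damp ν c) α m u‖
      ≤ 𝓜.modulus c ν α m δ u := by
  have h1 := 𝓜.integrand_add c (𝓜.damp ν c) α m (m' - m) u
  rw [add_sub_cancel] at h1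
  rw [h1, ← mul_sub_one, norm_mul, modulus]
  gcongr
  rw [← integrand_zero_exponent]
  set a : ℝ := ∑ i, 𝓜.damp ν c i * 𝓜.proj c (m' - m) i with ha
  set b : ℝ := -∑ i, u i * 𝓜.proj c (m' - m) i with hb
  have hδ : 0 ≤ δ := (norm_nonneg _).trans hm
  have hsum : ∀ x : 𝓜.supp c → ℝ, |∑ i, x i * 𝓜.proj c (m' - m) i| ≤ (∑ i, |x i|) * δ := by
    intro x
    rw [Finset.sum_mul]
    refine (Finset.abs_sum_le_sum_abs _ _).trans (Finset.sum_le_sum fun i _ => ?_)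
    rw [abs_mul]
    gcongr
    exact (norm_le_pi_norm (m' - m) (i : Fin d)).trans hm
  have e1 : ∑ i, ((𝓜.damp ν c i : ℂ) - Complex.I * (u i : ℂ)) * (𝓜.proj c (m' - m) i : ℂ)
      = (a : ℂ) + (b : ℂ) * Complex.I := by
    rw [ha, hb]
    push_cast
    rw [neg_mul, Finset.sum_mul, ← sub_eq_add_neg, ← Finset.sum_sub_distrib]
    exact Finset.sum_congr rfl fun i _ => by ring
  rw [e1, Complex.exp_add]
  have e2 : Complex.exp a * Complex.exp (b * Complex.I) - 1 =
      (Complex.exp a - 1) + Complex.exp a * (Complex.exp (b * Complex.I) - 1) := by ring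
  rw [e2]
  have hab : |a| ≤ (∑ i, |𝓜.damp ν c i|) * δ := hsum _
  have hbb : |b| ≤ (∑ i, |u i|) * δ := by rw [hb, abs_neg]; exact hsum _
  refine (norm_add_le _ _).trans (add_le_add ?_ ?_)
  · rw [← Complex.ofReal_exp, ← Complex.ofReal_one, ← Complex.ofReal_sub, Complex.norm_real,
      Real.norm_eq_abs]
    have h2 : Real.exp a ≤ Real.exp |a| := Real.exp_le_exp.2 (le_abs_self a)
    have h3 : Real.exp |a| ≤ Real.exp ((∑ i, |𝓜.damp ν c i|) * δ) := Real.exp_le_exp.2 hab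
    have h4 : Real.exp (-|a|) ≤ Real.exp a := Real.exp_le_exp.2 (neg_abs_le a)
    have h5 : 2 ≤ Real.exp |a| + Real.exp (-|a|) := by
      have := Real.one_le_cosh |a|
      rw [Real.cosh_eq] at this
      linarith
    rw [abs_le]
    constructor <;> linarith
  · rw [norm_mul, Complex.norm_exp_ofReal]
    gcongr
    · exact (le_abs_self a).trans hab
    · refine le_min ?_ ?_
      · refine (norm_sub_le _ _).trans ?_
        rw [Complex.norm_exp_ofReal_mul_I]
        norm_num
      · rw [mul_comm]
        exact (Real.norm_exp_I_mul_ofReal_sub_one_le).trans hbb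

lemma IsAdmissible.aestronglyMeasurable_modulus (h : 𝓜.IsAdmissible M) (c : C) (ν : Fin 3)
    (α : List (Fin d)) (m : Fin d → ℝ) (δ : ℝ) :
    AEStronglyMeasurable (𝓜.modulus c ν α m δ) volume :=
  (Continuous.mul (h.continuous_integrand ν c α m).norm
    (by fun_prop)).aestronglyMeasurable

omit [Fintype C] in
lemma norm_modulus_le (c : C) (ν : Fin 3) (α : List (Fin d)) (m : Fin d → ℝ) {δ : ℝ}
    (hδ : 0 ≤ δ) (hδ1 : δ ≤ 1) (u : 𝓜.supp c → ℝ) : ‖𝓜.modulus c ν α m δ u‖ ≤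
      ‖𝓜.integrand c (𝓜.damp ν c) α m u‖ * (3 * Real.exp (∑ i, |𝓜.damp ν c i|)) := by
  have hκ : 0 ≤ ∑ i, |𝓜.damp ν c i| := Finset.sum_nonneg fun _ _ => abs_nonneg _
  have h1 : Real.exp ((∑ i, |𝓜.damp ν c i|) * δ) ≤ Real.exp (∑ i, |𝓜.damp ν c i|) :=
    Real.exp_le_exp.2 (mul_le_of_le_one_right hκ hδ1)
  have h2 : 1 ≤ Real.exp ((∑ i, |𝓜.damp ν c i|) * δ) := Real.one_le_exp (by positivity)
  have h3 : 0 ≤ min 2 ((∑ i, |u i|) * δ) := le_min (by norm_num)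
    (mul_nonneg (Finset.sum_nonneg fun _ _ => abs_nonneg _) hδ)
  have h4 : min 2 ((∑ i, |u i|) * δ) ≤ 2 := min_le_left _ _
  rw [modulus, norm_mul, norm_norm]
  gcongr
  rw [Real.norm_of_nonneg (add_nonneg (by linarith) (by positivity))]
  nlinarith

lemma IsAdmissible.integrable_modulus (h : 𝓜.IsAdmissible M) (c : C) (ν : Fin 3)
    {α : List (Fin d)} (hα : α.length ≤ 2) (m : Fin d → ℝ) {δ : ℝ} (hδ : 0 ≤ δ) (hδ1 : δ ≤ 1) :
    Integrable (𝓜.modulus c ν α m δ) :=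
  ((h.damp_integrand ν c α hα m).norm.mul_const _).mono'
    (h.aestronglyMeasurable_modulus c ν α m δ)
    (Eventually.of_forall fun u => norm_modulus_le c ν α m hδ hδ1 u)

lemma IsAdmissible.tendsto_integral_modulus (h : 𝓜.IsAdmissible M) (c : C) (ν : Fin 3)
    {α : List (Fin d)} (hα : α.length ≤ 2) (m : Fin d → ℝ) :
    Tendsto (fun δ => ∫ u, 𝓜.modulus c ν α m δ u) (𝓝[>] 0) (𝓝 0) := by
  have := tendsto_integral_filter_of_dominated_convergence (l := 𝓝[>] (0:ℝ)) (μ := volume)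
    (F := fun δ => 𝓜.modulus c ν α m δ) (f := fun _ => (0:ℝ))
    (fun u => ‖𝓜.integrand c (𝓜.damp ν c) α m u‖ * (3 * Real.exp (∑ i, |𝓜.damp ν c i|)))
    (Eventually.of_forall fun δ => h.aestronglyMeasurable_modulus c ν α m δ) ?_
    ((h.damp_integrand ν c α hα m).norm.mul_const _) ?_
  · simpa using this
  · filter_upwards [Ioc_mem_nhdsGT (zero_lt_one (α := ℝ))] with δ hδ
    exact Eventually.of_forall fun u => norm_modulus_le c ν α m hδ.1.le hδ.2 u
  · refine Eventually.of_forall fun u => ?_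
    have hc : Continuous fun δ => 𝓜.modulus c ν α m δ u := by
      unfold modulus
      fun_prop
    have h0 : 𝓜.modulus c ν α m 0 u = 0 := by simp [modulus]
    have := hc.tendsto 0
    rw [h0] at this
    exact this.mono_left nhdsWithin_le_nhds

end Integrands

end Model

end FourierRQMC

namespace FourierRQMC

/-! ### Uniform laws of large numbers -/

lemma measure_mono_of_ae_imp {Ω : Type*} [MeasurableSpace Ω] {P : Measure Ω} {s t : Set Ω}
    (h : ∀ᵐ ω ∂P, ω ∈ s → ω ∈ t) : P s ≤ P t :=
  measure_mono_ae h

lemma tendsto_measure_ge_of_tendsto_integral {Ω : Type*} [MeasurableSpace Ω] {P : Measure Ω}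
    [IsProbabilityMeasure P] {f : ℕ → Ω → ℝ} (h0 : ∀ j ω, 0 ≤ f j ω)
    (hf : ∀ j, Integrable (f j) P)
    (hlim : Tendsto (fun j => ∫ ω, f j ω ∂P) atTop (𝓝 0)) {ε : ℝ} (hε : 0 < ε) :
    Tendsto (fun j => P {ω | ε ≤ f j ω}) atTop (𝓝 0) := by
  have h1 : ∀ j, P {ω | ε ≤ f j ω} ≤ ENNReal.ofReal (ε⁻¹ * ∫ ω, f j ω ∂P) := by
    intro j
    have := mul_meas_ge_le_integral_of_nonneg (Eventually.of_forall (h0 j)) (hf j) ε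
    rw [← ofReal_measureReal]
    refine ENNReal.ofReal_le_ofReal ?_
    rwa [← div_eq_inv_mul, le_div_iff₀' hε]
  refine tendsto_of_tendsto_of_tendsto_of_le_of_le tendsto_const_nhds ?_ (fun _ => zero_le) h1
  have h2 := ENNReal.tendsto_ofReal (hlim.const_mul ε⁻¹)
  simpa using h2

lemma abs_replicatedMean_sub_le {Ω E : Type*} {Y : ℕ → ℕ → Ω → E} {F G H : E → ℝ}
    (h : ∀ y, |F y - G y| ≤ H y) (N S : ℕ) (ω : Ω) :
    |replicatedMean Y F N S ω - replicatedMean Y G N S ω| ≤ replicatedMean Y H N S ω := by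
  have e : replicatedMean Y F N S ω - replicatedMean Y G N S ω =
      replicatedMean Y (fun y => F y - G y) N S ω := by
    simp only [replicatedMean, Finset.sum_sub_distrib, mul_sub]
  rw [e]
  refine (abs_replicatedMean_le _ _ _ _).trans ?_
  unfold replicatedMean
  gcongr
  exact h _

namespace Model

variable {d : ℕ} {C : Type*} [Fintype C] {𝓜 : Model d C} {M : Set (Fin d → ℝ)} {Ω : Type*}
  {v : (k : ℕ) → ℕ → Fin (𝓜.dim k) → ℝ}
  {ξ : ℕ → (k : ℕ) → Fin (𝓜.dim k) → List Bool → Ω → Bool}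

/-- The average over all points and randomizations of a transformed integrand. -/
noncomputable def sampleMean (𝓜 : Model d C) (v : (k : ℕ) → ℕ → Fin (𝓜.dim k) → ℝ)
    (ξ : ℕ → (k : ℕ) → Fin (𝓜.dim k) → List Bool → Ω → Bool) (c : C) (ν : Fin 3)
    (α : List (Fin d)) (N S : ℕ) (ω : Ω) (m : Fin d → ℝ) : ℝ :=
  replicatedMean (fun s n => 𝓜.point v ξ s (𝓜.supp c).card n)
    (𝓜.tIntegrand c (𝓜.damp ν c) α m) N S ω

lemma IsAdmissible.abs_tIntegrand_sub_le (h : 𝓜.IsAdmissible M) (c : C) (ν : Fin 3)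
    (α : List (Fin d)) {m m' : Fin d → ℝ} {δ : ℝ} (hm : ‖m' - m‖ ≤ δ)
    (w : Fin (𝓜.dim (𝓜.supp c).card) → ℝ) :
    |𝓜.tIntegrand c (𝓜.damp ν c) α m' w - 𝓜.tIntegrand c (𝓜.damp ν c) α m w| ≤
      𝓜.modulus c ν α m δ (𝓜.trans c w) * 𝓜.weight c w := by
  rw [tIntegrand, tIntegrand, ← sub_mul, abs_mul, abs_of_nonneg (h.weight_nonneg c w),
    ← Complex.sub_re]
  exact mul_le_mul_of_nonneg_right ((Complex.abs_re_le_norm _).trans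
    (norm_integrand_sub_le c ν α hm _)) (h.weight_nonneg c w)

variable [MeasurableSpace Ω] {P : Measure Ω} [IsProbabilityMeasure P]

/-- Uniform weak law of large numbers for the transformed integrands near an allocation. -/
theorem IsAdmissible.tendsto_measure_sampleMean (h : 𝓜.IsAdmissible M)
    (hξ : IsUniformScrambling P ξ) (c : C) (ν : Fin 3) {α : List (Fin d)} (hα : α.length ≤ 2)
    (m : Fin d → ℝ) {Nseq Sseq : ℕ → ℕ} (hN : ∀ᶠ j in atTop, 1 ≤ Nseq j)
    (hS : Tendsto Sseq atTop atTop) {η : ℝ} (hη : 0 < η) :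
    ∀ᶠ δ in 𝓝[>] (0 : ℝ), Tendsto (fun j => P {ω | ∃ m', ‖m' - m‖ ≤ δ ∧
      η ≤ |𝓜.sampleMean v ξ c ν α (Nseq j) (Sseq j) ω m' - (𝓜.fourierValue c ν α m).re|})
      atTop (𝓝 0) := by
  have hY : ∀ s n, MeasurePreserving (𝓜.point v ξ s (𝓜.supp c).card n) P
      (volume.restrict (openCube (𝓜.dim (𝓜.supp c).card))) := fun s n =>
    measurePreserving_point hξ s _ n
  have hind := pairwise_indepFun_point (v := v) hξ (𝓜.supp c).card
  -- With δ chosen so that the modulus has integral below `η / 3`, a deviation `η` anywhere in the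
  -- δ-ball forces a deviation `η / 3` of one of two fixed averages: the integrand at `m` or the
  -- modulus. The weak law applies to each.
  filter_upwards [(h.tendsto_integral_modulus c ν hα m).eventually
    (gt_mem_nhds (show (0:ℝ) < η / 3 by positivity)),
    Ioc_mem_nhdsGT (zero_lt_one (α := ℝ))] with δ hδ hδ1
  obtain ⟨hmod, hmodint⟩ := h.integral_trans c (h.integrable_modulus c ν hα m hδ1.1.le hδ1.2)
  set H := fun w => 𝓜.modulus c ν α m δ (𝓜.trans c w) * 𝓜.weight c w with hH
  have hF := h.integrable_tIntegrand ν c hα m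
  have key : ∀ {F : (Fin (𝓜.dim (𝓜.supp c).card) → ℝ) → ℝ}, Integrable F
      (volume.restrict (openCube (𝓜.dim (𝓜.supp c).card))) →
      Tendsto (fun j => P {ω | η / 3 ≤ |replicatedMean (fun s n => 𝓜.point v ξ s
        (𝓜.supp c).card n) F (Nseq j) (Sseq j) ω - ∫ w in openCube
          (𝓜.dim (𝓜.supp c).card), F w|}) atTop (𝓝 0) := fun hF =>
    tendsto_measure_ge_of_tendsto_integral (fun _ _ => abs_nonneg _)
      (fun j => ((integrable_replicatedMean hY hF _ _).sub (integrable_const _)).abs)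
      (tendsto_integral_abs_replicatedMean_sub hY hind hF hN hS) (by positivity)
  have hlim := (key hF).add (key hmod)
  rw [add_zero] at hlim
  refine tendsto_of_tendsto_of_tendsto_of_le_of_le tendsto_const_nhds hlim (fun _ => zero_le)
    fun j => (measure_mono ?_).trans (measure_union_le _ _)
  rintro ω ⟨m', hm', hlt⟩
  by_contra hnot
  simp only [Set.mem_union, Set.mem_ofPred_eq, not_or, not_le] at hnot
  obtain ⟨h1, h2⟩ := hnot
  rw [h.integral_tIntegrand ν c hα m] at h1
  rw [hmodint] at h2
  have h3 := abs_replicatedMean_sub_le (Y := fun s n => 𝓜.point v ξ s (𝓜.supp c).card n)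
    (h.abs_tIntegrand_sub_le c ν α hm') (Nseq j) (Sseq j) ω
  have h4 := (abs_lt.1 h2).2
  have h5 := abs_sub_le (𝓜.sampleMean v ξ c ν α (Nseq j) (Sseq j) ω m')
    (𝓜.sampleMean v ξ c ν α (Nseq j) (Sseq j) ω m) (𝓜.fourierValue c ν α m).re
  simp only [sampleMean] at h5 hlt
  linarith

end Model

end FourierRQMC

namespace FourierRQMC

namespace Model

/-! ### The estimated first-order system as a function of the sample means -/

variable {d : ℕ} {C : Type*} [Fintype C] {𝓜 : Model d C} {M : Set (Fin d → ℝ)} {Ω : Type*}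
  {v : (k : ℕ) → ℕ → Fin (𝓜.dim k) → ℝ}
  {ξ : ℕ → (k : ℕ) → Fin (𝓜.dim k) → List Bool → Ω → Bool}

/-- Indices of the Fourier integrals: component, damping vector, derivative of order at most 2. -/
abbrev FourierIndex (d : ℕ) (C : Type*) := C × Fin 3 × {α : List (Fin d) // α.length ≤ 2}

/-- The exact values of the Fourier integrals. -/
noncomputable def fourierVec (𝓜 : Model d C) (m : Fin d → ℝ) (q : FourierIndex d C) : ℝ :=
  (𝓜.fourierValue q.1 q.2.1 q.2.2 m).re

/-- The estimated values of the Fourier integrals. -/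
noncomputable def sampleVec (𝓜 : Model d C) (v : (k : ℕ) → ℕ → Fin (𝓜.dim k) → ℝ)
    (ξ : ℕ → (k : ℕ) → Fin (𝓜.dim k) → List Bool → Ω → Bool) (N S : ℕ) (ω : Ω)
    (m : Fin d → ℝ) (q : FourierIndex d C) : ℝ :=
  𝓜.sampleMean v ξ q.1 q.2.1 q.2.2 N S ω m

/-- The gradient of the Lagrangian in terms of the values of the Fourier integrals. -/
noncomputable def gradOf (𝓜 : Model d C) (z : PD d → ℝ) (t : FourierIndex d C → ℝ) : PD d → ℝ :=
  lagrangianGrad (z (Sum.inr ()))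
    (𝓜.affinePart (z ∘ Sum.inl) + ∑ c, t (c, 0, ⟨[], by simp⟩))
    (fun i => 𝓜.slope i + ∑ c, t (c, 1, ⟨[i], by simp⟩))

/-- The derivative of the gradient in terms of the values of the Fourier integrals. -/
noncomputable def derivOf (𝓜 : Model d C) (z : PD d → ℝ) (t : FourierIndex d C → ℝ) :
    Matrix (PD d) (PD d) ℝ :=
  Matrix.fromBlocks (Matrix.of fun i j => z (Sum.inr ()) * ∑ c, t (c, 1, ⟨[j, i], by simp⟩))
    (Matrix.of fun i _ => -(𝓜.slope i + ∑ c, t (c, 1, ⟨[i], by simp⟩)))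
    (Matrix.of fun _ j => -(𝓜.slope j + ∑ c, t (c, 0, ⟨[j], by simp⟩))) 0

lemma continuous_gradOf : Continuous fun p : (PD d → ℝ) × (FourierIndex d C → ℝ) =>
    𝓜.gradOf p.1 p.2 := by
  refine continuous_pi fun a => ?_
  rcases a with i | u
  · simp only [gradOf, lagrangianGrad, Sum.elim_inl]
    fun_prop
  · simp only [gradOf, lagrangianGrad, Sum.elim_inr, affinePart, Function.comp_apply]
    fun_prop

lemma continuous_derivOf : Continuous fun p : (PD d → ℝ) × (FourierIndex d C → ℝ) =>
    𝓜.derivOf p.1 p.2 := by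
  refine continuous_pi fun a => continuous_pi fun b => ?_
  rcases a with i | u <;> rcases b with j | w <;>
    simp only [derivOf, Matrix.fromBlocks_apply₁₁, Matrix.fromBlocks_apply₁₂,
      Matrix.fromBlocks_apply₂₁, Matrix.fromBlocks_apply₂₂, Matrix.of_apply, Matrix.zero_apply] <;>
    fun_prop

/-- The system is affine in the integrals, so averaging over randomizations passes inside. `1 ≤ S`
is needed because an empty average would erase the constant terms. -/
lemma rqmcGrad_eq_gradOf {N S : ℕ} (hS : 1 ≤ S) (ω : Ω) (z : PD d → ℝ) :
    𝓜.rqmcGrad v ξ N S ω z = 𝓜.gradOf z (𝓜.sampleVec v ξ N S ω (z ∘ Sum.inl)) := by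
  have hS0 : (S : ℝ) ≠ 0 := by positivity
  have hsum : ∀ (ν : Fin 3) (α : List (Fin d)), (S : ℝ)⁻¹ * ∑ s ∈ Finset.range S,
      𝓜.pointAverage v ξ N s ω ν α (z ∘ Sum.inl) =
      ∑ c, 𝓜.sampleMean v ξ c ν α N S ω (z ∘ Sum.inl) := by
    intro ν α
    simp only [pointAverage, sampleMean, replicatedMean]
    rw [Finset.sum_comm, Finset.mul_sum]
  ext a
  rcases a with i | u
  · simp only [rqmcGrad, replicateGrad, gradOf, lagrangianGrad, Pi.smul_apply, Finset.sum_apply,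
      Sum.elim_inl, smul_eq_mul, sampleVec, ← hsum, Finset.sum_sub_distrib, ← Finset.mul_sum,
      Finset.sum_add_distrib, Finset.sum_const, Finset.card_range, nsmul_eq_mul]
    field_simp
  · simp only [rqmcGrad, replicateGrad, gradOf, lagrangianGrad, Pi.smul_apply, Finset.sum_apply,
      Sum.elim_inr, smul_eq_mul, sampleVec, ← hsum,
      Finset.sum_add_distrib, Finset.sum_const, Finset.card_range, nsmul_eq_mul]
    field_simp

omit [Fintype C] in
lemma hasFDerivAt_sampleMean (c : C) (ν : Fin 3) (α : List (Fin d)) (N S : ℕ) (ω : Ω)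
    (m : Fin d → ℝ) : HasFDerivAt (𝓜.sampleMean v ξ c ν α N S ω)
      (-∑ j, (ContinuousLinearMap.proj (R := ℝ) (φ := fun _ : Fin d => ℝ) j).smulRight
        (𝓜.sampleMean v ξ c ν (j :: α) N S ω m)) m := by
  have h1 : ∀ w, HasFDerivAt (fun m => 𝓜.tIntegrand c (𝓜.damp ν c) α m w)
      (-∑ j, (ContinuousLinearMap.proj (R := ℝ) (φ := fun _ : Fin d => ℝ) j).smulRight
        (𝓜.tIntegrand c (𝓜.damp ν c) (j :: α) m w)) m := by
    intro w
    have h2 := (Complex.reCLM.hasFDerivAt.comp m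
      (𝓜.hasFDerivAt_integrand c (𝓜.damp ν c) α m (𝓜.trans c w))).mul_const (𝓜.weight c w)
    refine h2.congr_fderiv ?_
    ext x
    simp only [tIntegrand, smul_apply, neg_apply, sum_apply, ContinuousLinearMap.comp_apply,
      ContinuousLinearMap.smulRight_apply, ContinuousLinearMap.proj_apply, map_neg, map_sum,
      Complex.reCLM_apply, Complex.smul_re, smul_eq_mul, mul_neg, Finset.mul_sum]
    congr 1
    exact Finset.sum_congr rfl fun j _ => by ring
  have h3 := HasFDerivAt.const_mul (HasFDerivAt.fun_sum (u := Finset.range S) fun s _ =>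
    HasFDerivAt.const_mul (HasFDerivAt.fun_sum (u := Finset.range N) fun n _ =>
      h1 (𝓜.point v ξ s (𝓜.supp c).card n ω)) (N : ℝ)⁻¹) (S : ℝ)⁻¹
  refine h3.congr_fderiv ?_
  ext x
  simp only [sampleMean, replicatedMean, smul_apply, neg_apply, sum_apply,
    ContinuousLinearMap.smulRight_apply, ContinuousLinearMap.proj_apply, smul_eq_mul,
    Finset.sum_neg_distrib, mul_neg, Finset.mul_sum]
  congr 1
  symm
  rw [Finset.sum_comm]
  refine Finset.sum_congr rfl fun s _ => ?_
  rw [Finset.sum_comm]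
  exact Finset.sum_congr rfl fun n _ => Finset.sum_congr rfl fun j _ => by ring

/-- The continuous linear map of a matrix. -/
noncomputable def matrixCLM (A : Matrix (PD d) (PD d) ℝ) : (PD d → ℝ) →L[ℝ] (PD d → ℝ) :=
  LinearMap.toContinuousLinearMap (Matrix.toLin' A)

lemma continuous_matrixCLM : Continuous (matrixCLM (d := d)) :=
  LinearMap.continuous_of_finiteDimensional
    (LinearMap.toContinuousLinearMap.toLinearMap ∘ₗ (Matrix.toLin' (R := ℝ)).toLinearMap)

lemma hasFDerivAt_gradOf_sampleVec (N S : ℕ) (ω : Ω) (z : PD d → ℝ) :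
    HasFDerivAt (fun z => 𝓜.gradOf z (𝓜.sampleVec v ξ N S ω (z ∘ Sum.inl)))
      (matrixCLM (𝓜.derivOf z (𝓜.sampleVec v ξ N S ω (z ∘ Sum.inl)))) z := by
  set Lm : (PD d → ℝ) →L[ℝ] (Fin d → ℝ) :=
    ContinuousLinearMap.pi fun i => ContinuousLinearMap.proj (Sum.inl i) with hLm
  have hT : ∀ c ν α, HasFDerivAt (fun z : PD d → ℝ => 𝓜.sampleMean v ξ c ν α N S ω (z ∘ Sum.inl))
      _ z := fun c ν α =>
    (hasFDerivAt_sampleMean (v := v) (ξ := ξ) c ν α N S ω (Lm z)).comp z Lm.hasFDerivAt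
  refine hasFDerivAt_pi'.2 fun a => ?_
  rcases a with i | u
  · have h1 := HasFDerivAt.const_sub (c := (1:ℝ)) (HasFDerivAt.mul
      ((ContinuousLinearMap.proj (R := ℝ) (φ := fun _ : PD d => ℝ) (Sum.inr ())).hasFDerivAt
        (x := z)) ((HasFDerivAt.fun_sum (u := Finset.univ) fun c _ => hT c 1 [i]).const_add
          (𝓜.slope i)))
    refine h1.congr_fderiv ?_
    ext x
    have e : (fun i => z (Sum.inl i)) = z ∘ Sum.inl := rfl
    simp [matrixCLM, derivOf, Matrix.toLin'_apply, Matrix.mulVec, dotProduct, hLm, sampleVec, e]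
    rw [Finset.sum_comm, add_comm]
    simp only [Finset.mul_sum, Finset.sum_mul]
    congr 1
    · exact Finset.sum_congr rfl fun j _ => Finset.sum_congr rfl fun c _ => by ring
    · ring
  · have h1 : HasFDerivAt (fun z : PD d → ℝ => 𝓜.affinePart (z ∘ Sum.inl))
        (-∑ j, (ContinuousLinearMap.proj (R := ℝ) (φ := fun _ : PD d => ℝ)
          (Sum.inl j)).smulRight (𝓜.slope j)) z := by
      refine ((𝓜.hasFDerivAt_affinePart (Lm z)).comp z Lm.hasFDerivAt).congr_fderiv ?_
      ext x
      simp [hLm]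
    refine (h1.add (HasFDerivAt.fun_sum (u := Finset.univ) fun c _ => hT c 0 [])).congr_fderiv ?_
    ext x
    have e : (fun i => z (Sum.inl i)) = z ∘ Sum.inl := rfl
    simp [matrixCLM, derivOf, Matrix.toLin'_apply, Matrix.mulVec, dotProduct, hLm, sampleVec, e]
    rw [Finset.sum_comm, ← neg_add, ← Finset.sum_add_distrib, ← Finset.sum_neg_distrib]
    refine Finset.sum_congr rfl fun j _ => ?_
    rw [← Finset.mul_sum]
    ring

/-- At the exact solution, the derivative is the Fourier Hessian up to its sign. -/
lemma IsAdmissible.derivOf_fourierVec (h : 𝓜.IsAdmissible M) (z : PD d → ℝ) :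
    𝓜.derivOf z (𝓜.fourierVec (z ∘ Sum.inl)) = -𝓜.hessFou z := by
  -- Differentiating the estimator keeps the damping vectors 1 and 0 of its rows, while the Fourier
  -- Hessian is built with 2 and 1. Independence of the damping identifies the entries.
  ext a b
  rcases a with i | u <;> rcases b with j | w
  · simp [derivOf, hessFou, lagrangianHess, h.gFou2_eq 1, fourierVec]
  · simp [derivOf, hessFou, lagrangianHess, h.gFou1_eq 1, fourierVec]
  · simp [derivOf, hessFou, lagrangianHess, h.gFou1_eq 0, fourierVec]
  · simp [derivOf, hessFou, lagrangianHess]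

lemma IsAdmissible.gradOf_fourierVec (h : 𝓜.IsAdmissible M) (z : PD d → ℝ) :
    𝓜.gradOf z (𝓜.fourierVec (z ∘ Sum.inl)) = lagrangianGrad (z (Sum.inr ()))
      (𝓜.g (z ∘ Sum.inl)) (𝓜.gGrad (z ∘ Sum.inl)) := by
  rw [h.g_eq 0, h.gGrad_eq]
  rfl

section Probability

variable [MeasurableSpace Ω] {P : Measure Ω} [IsProbabilityMeasure P]

/-- Uniform convergence in probability of the estimated values of the Fourier integrals. -/
theorem IsAdmissible.exists_nhds_tendsto_measure_sampleVec (h : 𝓜.IsAdmissible M)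
    (hξ : IsUniformScrambling P ξ) (z : PD d → ℝ) {Nseq Sseq : ℕ → ℕ}
    (hN : ∀ᶠ j in atTop, 1 ≤ Nseq j) (hS : Tendsto Sseq atTop atTop)
    {W : Set ((PD d → ℝ) × (FourierIndex d C → ℝ))}
    (hW : W ∈ 𝓝 (z, 𝓜.fourierVec (z ∘ Sum.inl))) :
    ∃ V ∈ 𝓝 z, Tendsto (fun j => P {ω | ∃ y ∈ V,
      (y, 𝓜.sampleVec v ξ (Nseq j) (Sseq j) ω (y ∘ Sum.inl)) ∉ W}) atTop (𝓝 0) := by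
  obtain ⟨V, hV, U, hU, hVU⟩ := mem_nhds_prod_iff.1 hW
  -- A basic neighbourhood in the product topology restricts finitely many Fourier values, so
  -- finitely many uniform weak laws and a union bound suffice.
  rw [nhds_pi, Filter.mem_pi] at hU
  obtain ⟨I, hI, t, ht, hIt⟩ := hU
  have hη : ∀ q, ∃ η > 0, Metric.ball (𝓜.fourierVec (z ∘ Sum.inl) q) η ⊆ t q := fun q =>
    Metric.mem_nhds_iff.1 (ht q)
  choose η hη0 hηt using hη
  have hδ : ∀ᶠ δ in 𝓝[>] (0 : ℝ), ∀ q ∈ I, Tendsto (fun j => P {ω | ∃ m', ‖m' - z ∘ Sum.inl‖ ≤ δ ∧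
      η q ≤ |𝓜.sampleMean v ξ q.1 q.2.1 q.2.2 (Nseq j) (Sseq j) ω m' -
        (𝓜.fourierValue q.1 q.2.1 q.2.2 (z ∘ Sum.inl)).re|}) atTop (𝓝 0) :=
    (eventually_all_finite hI).2 fun q _ =>
      h.tendsto_measure_sampleMean hξ q.1 q.2.1 q.2.2.2 (z ∘ Sum.inl) hN hS (hη0 q)
  obtain ⟨δ, hδ, hδ0⟩ := (hδ.and self_mem_nhdsWithin).exists
  have hδ0 : 0 < δ := hδ0
  refine ⟨V ∩ Metric.closedBall z δ, inter_mem hV (Metric.closedBall_mem_nhds z hδ0), ?_⟩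
  have hsum := tendsto_finsetSum hI.toFinset fun q hq => hδ q (hI.mem_toFinset.1 hq)
  rw [Finset.sum_const_zero] at hsum
  refine tendsto_of_tendsto_of_tendsto_of_le_of_le tendsto_const_nhds hsum (fun _ => zero_le)
    fun j => (measure_mono ?_).trans (measure_biUnion_finset_le _ _)
  rintro ω ⟨y, ⟨hyV, hyδ⟩, hnot⟩
  by_contra hno
  simp only [Set.mem_iUnion, Set.mem_ofPred_eq, not_exists, not_and, not_le,
    Set.Finite.mem_toFinset] at hno
  refine hnot (hVU ⟨hyV, hIt fun q hq => hηt q ?_⟩)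
  rw [Metric.mem_ball, Real.dist_eq]
  refine hno q hq (y ∘ Sum.inl) ?_
  rw [mem_closedBall_iff_norm, pi_norm_le_iff_of_nonneg hδ0.le] at hyδ
  exact (pi_norm_le_iff_of_nonneg hδ0.le).2 fun i => hyδ (Sum.inl i)

end Probability

end Model

end FourierRQMC

namespace FourierRQMC

namespace Model

/-! ### Consistency and linearization of the estimated solutions -/

variable {d : ℕ} {C : Type*} [Fintype C] {𝓜 : Model d C} {M : Set (Fin d → ℝ)} {Ω : Type*}
  {v : (k : ℕ) → ℕ → Fin (𝓜.dim k) → ℝ}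
  {ξ : ℕ → (k : ℕ) → Fin (𝓜.dim k) → List Bool → Ω → Bool}

lemma approximatesLinearOn_rqmcGrad {N S : ℕ} (hS : 1 ≤ S) {ω : Ω}
    {s : Set (PD d → ℝ)} (hs : Convex ℝ s) {L : (PD d → ℝ) →L[ℝ] (PD d → ℝ)} {c : NNReal}
    (hL : ∀ y ∈ s, ‖matrixCLM (𝓜.derivOf y (𝓜.sampleVec v ξ N S ω (y ∘ Sum.inl))) - L‖ ≤ c) :
    ApproximatesLinearOn (𝓜.rqmcGrad v ξ N S ω) L s c := by
  intro x hx y hy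
  rw [show 𝓜.rqmcGrad v ξ N S ω = _ from funext (rqmcGrad_eq_gradOf hS ω)]
  exact hs.norm_image_sub_le_of_norm_hasFDerivWithin_le'
    (fun z _ => (hasFDerivAt_gradOf_sampleVec N S ω z).hasFDerivWithinAt) hL hy hx

/-- Without coordinates the Hessian is the 1 × 1 zero matrix. A coordinate is needed later to rule
out the multiplier 0. -/
lemma pos_of_isUnit_det_hessFou {z : PD d → ℝ} (hz : IsUnit (𝓜.hessFou z).det) :
    0 < d := by
  rcases Nat.eq_zero_or_pos d with rfl | hd
  · exfalso
    refine hz.ne_zero (Matrix.det_eq_zero_of_column_eq_zero (Sum.inr ()) fun a => ?_)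
    rcases a with i | u
    · exact i.elim0
    · simp [hessFou, lagrangianHess]
  · exact hd

/-- The search set omits the multiplier 0; adding it gives the compact set required for a finite
covering. -/
lemma isCompact_closedPdSet (hM : IsCompact M) (lamMax : ℝ) :
    IsCompact {z : PD d → ℝ | (z ∘ Sum.inl) ∈ M ∧ z (Sum.inr ()) ∈ Set.Icc 0 lamMax} := by
  have h1 : IsCompact (M ×ˢ (Set.univ.pi fun _ : Unit => Set.Icc (0:ℝ) lamMax)) :=
    hM.prod (isCompact_univ_pi fun _ => isCompact_Icc)
  have h2 := (Homeomorph.sumArrowHomeomorphProdArrow (ι := Fin d) (ι' := Unit)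
    (X := ℝ)).isCompact_preimage.2 h1
  convert h2 using 1
  ext z
  simp only [Homeomorph.sumArrowHomeomorphProdArrow, Equiv.sumArrowEquivProdArrow,
    Set.mem_ofPred_eq, Set.mem_preimage, Homeomorph.homeomorph_mk_coe, Equiv.coe_fn_mk,
    Set.mem_prod, Set.mem_pi, Set.mem_univ, forall_true_left, Function.comp_apply]
  exact and_congr_right fun _ => ⟨fun hz _ => hz, fun hz => hz ()⟩

variable [MeasurableSpace Ω] {P : Measure Ω} [IsProbabilityMeasure P]

/-- With probability tending to one, a neighbourhood of an allocation and a multiplier that do not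
solve the exact system contains no zero of the estimated system. -/
lemma IsAdmissible.exists_nhds_tendsto_measure_zero (h : 𝓜.IsAdmissible M)
    (hξ : IsUniformScrambling P ξ) {z : PD d → ℝ} {Nseq Sseq : ℕ → ℕ}
    (hN : ∀ᶠ j in atTop, 1 ≤ Nseq j) (hS : Tendsto Sseq atTop atTop)
    (hz : 𝓜.gradOf z (𝓜.fourierVec (z ∘ Sum.inl)) ≠ 0) :
    ∃ V ∈ 𝓝 z, Tendsto (fun j => P {ω | ∃ y ∈ V,
      𝓜.rqmcGrad v ξ (Nseq j) (Sseq j) ω y = 0}) atTop (𝓝 0) := by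
  have hW := (continuous_gradOf (𝓜 := 𝓜)).continuousAt.eventually_ne
    (x := (z, 𝓜.fourierVec (z ∘ Sum.inl))) hz
  obtain ⟨V, hV, hlim⟩ := h.exists_nhds_tendsto_measure_sampleVec (v := v) hξ z hN hS hW
  refine ⟨V, hV, tendsto_of_tendsto_of_tendsto_of_le_of_le' tendsto_const_nhds hlim
    (Eventually.of_forall fun _ => zero_le) ?_⟩
  filter_upwards [hS.eventually_ge_atTop 1] with j hj
  refine measure_mono ?_
  rintro ω ⟨y, hy, hy0⟩
  refine ⟨y, hy, fun hne => hne ?_⟩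
  rw [rqmcGrad_eq_gradOf hj] at hy0
  exact hy0

/-- The zeros of the estimated system concentrate at the exact solution. -/
lemma IsAdmissible.tendsto_measure_zero_compl_ball (h : 𝓜.IsAdmissible M) (hM : IsCompact M)
    (hξ : IsUniformScrambling P ξ) {lamMax : ℝ} {zstar : PD d → ℝ}
    (huniq : ∀ z ∈ pdSet M lamMax, 𝓜.IsKKT z → z = zstar) (hd : 0 < d)
    {Nseq Sseq : ℕ → ℕ} (hN : ∀ᶠ j in atTop, 1 ≤ Nseq j) (hS : Tendsto Sseq atTop atTop)
    {ρ : ℝ} (hρ : 0 < ρ) :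
    Tendsto (fun j => P {ω | ∃ y ∈ pdSet M lamMax \ Metric.ball zstar ρ,
      𝓜.rqmcGrad v ξ (Nseq j) (Sseq j) ω y = 0}) atTop (𝓝 0) := by
  have hK := (isCompact_closedPdSet hM lamMax).diff (Metric.isOpen_ball (x := zstar) (ε := ρ))
  -- Compactness: the probability of a zero in a set is monotone and subadditive in the set, so it
  -- is enough to treat a neighbourhood of each point.
  have key := hK.induction_on (p := fun s => Tendsto (fun j => P {ω | ∃ y ∈ s,
    𝓜.rqmcGrad v ξ (Nseq j) (Sseq j) ω y = 0}) atTop (𝓝 0)) (by simp) ?_ ?_ ?_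
  · refine tendsto_of_tendsto_of_tendsto_of_le_of_le tendsto_const_nhds key (fun _ => zero_le)
      fun j => measure_mono ?_
    rintro ω ⟨y, ⟨hy, hyb⟩, hy0⟩
    exact ⟨y, ⟨⟨hy.1, hy.2.1.le, hy.2.2⟩, hyb⟩, hy0⟩
  · intro s t hst ht
    refine tendsto_of_tendsto_of_tendsto_of_le_of_le tendsto_const_nhds ht (fun _ => zero_le)
      fun j => measure_mono ?_
    rintro ω ⟨y, hy, hy0⟩
    exact ⟨y, hst hy, hy0⟩
  · intro s t hs ht
    have := hs.add ht
    rw [add_zero] at this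
    refine tendsto_of_tendsto_of_tendsto_of_le_of_le tendsto_const_nhds this (fun _ => zero_le)
      fun j => (measure_mono ?_).trans (measure_union_le _ _)
    rintro ω ⟨y, hy | hy, hy0⟩
    · exact Or.inl ⟨y, hy, hy0⟩
    · exact Or.inr ⟨y, hy, hy0⟩
  · rintro z ⟨⟨hzM, hzl⟩, hzb⟩
    have hne : 𝓜.gradOf z (𝓜.fourierVec (z ∘ Sum.inl)) ≠ 0 := by
      intro h0
      rw [h.gradOf_fourierVec] at h0
      -- At multiplier 0 a first-order entry of the exact system equals 1; at a positive multiplier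
      -- uniqueness excludes a zero away from `zstar`.
      rcases hzl.1.eq_or_lt with hl | hl
      · have := congrFun h0 (Sum.inl ⟨0, hd⟩)
        simp [lagrangianGrad, ← hl] at this
      · have := huniq z ⟨hzM, hl, hzl.2⟩ h0
        exact hzb (this ▸ Metric.mem_ball_self hρ)
    obtain ⟨V, hV, hlim⟩ := h.exists_nhds_tendsto_measure_zero (v := v) hξ hN hS hne
    exact ⟨V, mem_nhdsWithin_of_mem_nhds hV, hlim⟩

/-- With probability tending to one, the estimation error is controlled by the estimated gradient
at the exact solution. -/
theorem IsAdmissible.exists_tendsto_measure_norm_sub (h : 𝓜.IsAdmissible M) (hM : IsCompact M)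
    (hξ : IsUniformScrambling P ξ) {lamMax : ℝ} {zstar : PD d → ℝ} (hkkt : 𝓜.IsKKT zstar)
    (huniq : ∀ z ∈ pdSet M lamMax, 𝓜.IsKKT z → z = zstar)
    (hint : (zstar ∘ Sum.inl) ∈ interior M) (hlam : zstar (Sum.inr ()) ∈ Set.Ioo 0 lamMax)
    (hhess : IsUnit (𝓜.hessFou zstar).det)
    {zhat : ℕ → ℕ → Ω → PD d → ℝ}
    (hzhat : ∀ N S, ∀ᵐ ω ∂P, (∃ z ∈ pdSet M lamMax, 𝓜.rqmcGrad v ξ N S ω z = 0) →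
      zhat N S ω ∈ pdSet M lamMax ∧ 𝓜.rqmcGrad v ξ N S ω (zhat N S ω) = 0)
    {Nseq Sseq : ℕ → ℕ} (hN : ∀ᶠ j in atTop, 1 ≤ Nseq j) (hS : Tendsto Sseq atTop atTop) :
    ∃ K : ℝ, 0 < K ∧ Tendsto (fun j => P {ω | K * ‖𝓜.rqmcGrad v ξ (Nseq j) (Sseq j) ω zstar‖ <
      ‖zhat (Nseq j) (Sseq j) ω - zstar‖}) atTop (𝓝 0) := by
  have hd := pos_of_isUnit_det_hessFou hhess
  have hdet : IsUnit (-𝓜.hessFou zstar).det := by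
    rw [Matrix.det_neg]
    exact (isUnit_one.neg.pow _).mul hhess
  -- The derivative of the exact first-order system at `zstar`, invertible by assumption.
  set L : (PD d → ℝ) ≃L[ℝ] (PD d → ℝ) := (Matrix.toLinearEquiv' (-𝓜.hessFou zstar)
    (Matrix.invertibleOfIsUnitDet _ hdet)).toContinuousLinearEquiv with hL
  have hLcoe : (L : (PD d → ℝ) →L[ℝ] (PD d → ℝ)) = matrixCLM (-𝓜.hessFou zstar) := by
    ext x
    rfl
  set n : NNReal := ‖(L.symm : (PD d → ℝ) →L[ℝ] (PD d → ℝ))‖₊ with hn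
  have hn0 : 0 < n := by
    have := L.symm.norm_pos
    exact this
  -- Maps within `c < ‖L⁻¹‖⁻¹` of the linear map `L` remain quantitatively invertible.
  set c : NNReal := n⁻¹ / 2 with hc
  have hn1 : 0 < n⁻¹ := inv_pos.2 hn0
  have hc0 : 0 < c := half_pos hn1
  have hcn : c < n⁻¹ := half_lt_self hn1
  -- the neighbourhood on which the derivative is controlled
  have hW1 : {p : (PD d → ℝ) × (FourierIndex d C → ℝ) |
      ‖matrixCLM (𝓜.derivOf p.1 p.2) - (L : (PD d → ℝ) →L[ℝ] (PD d → ℝ))‖ < c} ∈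
      𝓝 (zstar, 𝓜.fourierVec (zstar ∘ Sum.inl)) := by
    have hcont : Continuous fun p : (PD d → ℝ) × (FourierIndex d C → ℝ) =>
        ‖matrixCLM (𝓜.derivOf p.1 p.2) - (L : (PD d → ℝ) →L[ℝ] (PD d → ℝ))‖ :=
      ((continuous_matrixCLM.comp continuous_derivOf).sub continuous_const).norm
    refine hcont.continuousAt.eventually (gt_mem_nhds ?_)
    dsimp only
    rw [h.derivOf_fourierVec, hLcoe, sub_self, norm_zero]
    exact hc0
  obtain ⟨V, hV, hV1⟩ := h.exists_nhds_tendsto_measure_sampleVec (v := v) hξ zstar hN hS hW1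
  have hpd : pdSet M lamMax ∈ 𝓝 zstar := by
    have h1 : Continuous fun z : PD d → ℝ => z ∘ (Sum.inl : Fin d → PD d) := by fun_prop
    have h2 : Continuous fun z : PD d → ℝ => z (Sum.inr ()) := by fun_prop
    exact inter_mem (h1.continuousAt.preimage_mem_nhds (mem_interior_iff_mem_nhds.1 hint))
      (h2.continuousAt.preimage_mem_nhds (Ioc_mem_nhds hlam.1 hlam.2))
  obtain ⟨ρ, hρ, hball⟩ := Metric.nhds_basis_closedBall.mem_iff.1 (inter_mem hV hpd)
  -- The image of the ball of radius `ρ` about `zstar` covers the ball of this radius about the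
  -- value at `zstar`.
  have hε : (0:ℝ) < ((n:ℝ)⁻¹ - c) * ρ := by
    refine mul_pos (sub_pos.2 ?_) hρ
    exact_mod_cast hcn
  have hW2 : {p : (PD d → ℝ) × (FourierIndex d C → ℝ) |
      ‖𝓜.gradOf p.1 p.2‖ < ((n:ℝ)⁻¹ - c) * ρ} ∈ 𝓝 (zstar, 𝓜.fourierVec (zstar ∘ Sum.inl)) := by
    refine (continuous_gradOf (𝓜 := 𝓜)).norm.continuousAt.eventually (gt_mem_nhds ?_)
    dsimp only
    rw [h.gradOf_fourierVec, hkkt, norm_zero]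
    exact hε
  obtain ⟨V', hV', hV2⟩ := h.exists_nhds_tendsto_measure_sampleVec (v := v) hξ zstar hN hS hW2
  have hV3 := h.tendsto_measure_zero_compl_ball (v := v) hM hξ huniq hd hN hS hρ
  -- `K` is the Lipschitz constant of the local inverse. The three exceptional events are a
  -- derivative far from `L`, a large gradient at `zstar`, and a zero outside the ball.
  refine ⟨(((n⁻¹ - c)⁻¹ : NNReal) : ℝ), by simpa using hcn, ?_⟩
  have hsum := (hV1.add hV2).add hV3
  simp only [add_zero] at hsum
  refine tendsto_of_tendsto_of_tendsto_of_le_of_le' tendsto_const_nhds hsum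
    (Eventually.of_forall fun _ => zero_le) ?_
  filter_upwards [hS.eventually_ge_atTop 1] with j hj
  refine le_trans (measure_mono_of_ae_imp ?_) ((measure_union_le _ _).trans
    (add_le_add_left (measure_union_le _ _) _))
  filter_upwards [hzhat (Nseq j) (Sseq j)] with ω hω hlt
  by_contra hnot
  simp only [Set.mem_union, Set.mem_ofPred_eq, not_or, not_exists, not_and, not_not] at hnot
  obtain ⟨⟨h1, h2⟩, h3⟩ := hnot
  have happ : ApproximatesLinearOn (𝓜.rqmcGrad v ξ (Nseq j) (Sseq j) ω)
      (L : (PD d → ℝ) →L[ℝ] (PD d → ℝ)) (Metric.closedBall zstar ρ) c :=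
    approximatesLinearOn_rqmcGrad hj (convex_closedBall _ _)
      fun y hy => (h1 y (hball hy).1).le
  have hF := h2 zstar (mem_of_mem_nhds hV')
  rw [← rqmcGrad_eq_gradOf hj] at hF
  -- Local surjectivity produces a zero in the search set, and only then is the estimator known to
  -- be a zero.
  obtain ⟨y, hy, hy0⟩ := happ.surjOn_closedBall_of_nonlinearRightInverse
    L.toNonlinearRightInverse hρ.le subset_rfl
    (show (0 : PD d → ℝ) ∈ Metric.closedBall _ _ by
      rw [mem_closedBall_iff_norm, zero_sub, norm_neg]
      exact hF.le)
  obtain ⟨hz1, hz2⟩ := hω ⟨y, (hball hy).2, hy0⟩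
  have hzb : zhat (Nseq j) (Sseq j) ω ∈ Metric.ball zstar ρ := by
    by_contra hzb
    exact h3 _ ⟨hz1, hzb⟩ hz2
  -- The estimator is a zero inside the ball, so the inverse Lipschitz bound compares it with
  -- `zstar`.
  have hanti := (happ.antilipschitz (Or.inr hcn)).le_mul_dist
    ⟨_, Metric.ball_subset_closedBall hzb⟩ ⟨zstar, Metric.mem_closedBall_self hρ.le⟩
  rw [Subtype.dist_eq, Set.domRestrict_apply, Set.domRestrict_apply, hz2, dist_eq_norm,
    dist_eq_norm, zero_sub, norm_neg] at hanti
  exact absurd hanti (not_le.2 hlt)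

end Model

end FourierRQMC

namespace FourierRQMC

namespace Model

/-! ### Second moments of the estimated gradient at the exact solution -/

variable {d : ℕ} {C : Type*} [Fintype C] {𝓜 : Model d C} {M : Set (Fin d → ℝ)} {Ω : Type*}
  {v : (k : ℕ) → ℕ → Fin (𝓜.dim k) → ℝ}
  {ξ : ℕ → (k : ℕ) → Fin (𝓜.dim k) → List Bool → Ω → Bool}

/-- The error of the average over one randomization of a transformed integrand. -/
noncomputable def replicateError (𝓜 : Model d C) (v : (k : ℕ) → ℕ → Fin (𝓜.dim k) → ℝ)
    (ξ : ℕ → (k : ℕ) → Fin (𝓜.dim k) → List Bool → Ω → Bool) (N s : ℕ) (ω : Ω) (c : C) (ν : Fin 3)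
    (α : List (Fin d)) (m : Fin d → ℝ) : ℝ :=
  (N : ℝ)⁻¹ * ∑ n ∈ Finset.range N, 𝓜.tIntegrand c (𝓜.damp ν c) α m
    (𝓜.point v ξ s (𝓜.supp c).card n ω) - (𝓜.fourierValue c ν α m).re

lemma le_worstExponent (A : Fin 2 → ∀ c, Fin (𝓜.dim (𝓜.supp c).card) → ℝ) (ν : Fin 2) (c : C)
    (j : Fin (𝓜.dim (𝓜.supp c).card)) : A ν c j ≤ 𝓜.worstExponent A :=
  le_ciSup (f := fun q : Fin 2 × (Σ c, Fin (𝓜.dim (𝓜.supp c).card)) => A q.1 q.2.1 q.2.2)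
    (Set.finite_range _).bddAbove (ν, ⟨c, j⟩)

/-- Without components the supremum over the empty index set is 0 by convention. -/
lemma worstExponent_nonneg {A : Fin 2 → ∀ c, Fin (𝓜.dim (𝓜.supp c).card) → ℝ}
    {m : Fin d → ℝ} (hA : 𝓜.HasGrowthExponents A m) : 0 ≤ 𝓜.worstExponent A :=
  Real.iSup_nonneg fun _ => (hA.1 _ _ _).le

/-- At a solution of the exact system, each component of the estimated gradient is a multiple of
the sum of the integration errors of the components of the loss. -/
lemma exists_replicateGrad_eq {z : PD d → ℝ}
    (hz : 𝓜.gradOf z (𝓜.fourierVec (z ∘ Sum.inl)) = 0)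
    {A : Fin 2 → ∀ c, Fin (𝓜.dim (𝓜.supp c).card) → ℝ}
    (hA : 𝓜.HasGrowthExponents A (z ∘ Sum.inl)) (a : PD d) :
    ∃ (κ : ℝ) (ν : Fin 3) (ν' : Fin 2) (α : List (Fin d)), α.length ≤ 2 ∧
      (∀ c, HasBoundaryGrowth (𝓜.tIntegrand c (𝓜.damp ν c) α (z ∘ Sum.inl)) (A ν' c)) ∧
      ∀ (v : (k : ℕ) → ℕ → Fin (𝓜.dim k) → ℝ)
        (ξ : ℕ → (k : ℕ) → Fin (𝓜.dim k) → List Bool → Ω → Bool) N s ω,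
        𝓜.replicateGrad v ξ N s ω z a =
          κ * ∑ c, 𝓜.replicateError v ξ N s ω c ν α (z ∘ Sum.inl) := by
  -- The exact equation cancels the affine terms and leaves integration errors, with factor minus
  -- the multiplier in the first-order rows and 1 in the last row.
  have h0 := congrFun hz a
  rcases a with i | u
  · refine ⟨-z (Sum.inr ()), 1, 1, [i], by simp, fun c => hA.2.2 c i, fun v ξ N s ω => ?_⟩
    simp only [gradOf, lagrangianGrad, Sum.elim_inl, fourierVec, Pi.zero_apply] at h0
    simp only [replicateGrad, lagrangianGrad, Sum.elim_inl, pointAverage, replicateError,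
      Finset.sum_sub_distrib]
    linear_combination h0
  · refine ⟨1, 0, 0, [], by simp, hA.2.1, fun v ξ N s ω => ?_⟩
    simp only [gradOf, lagrangianGrad, Sum.elim_inr, fourierVec, Pi.zero_apply] at h0
    simp only [replicateGrad, lagrangianGrad, Sum.elim_inr, pointAverage, replicateError,
      Finset.sum_sub_distrib]
    linear_combination h0

variable [MeasurableSpace Ω] {P : Measure Ω} [IsProbabilityMeasure P]

lemma IsAdmissible.memLp_replicateError (h : 𝓜.IsAdmissible M) (hξ : IsUniformScrambling P ξ)
    (N s : ℕ) (c : C) (ν : Fin 3) {α : List (Fin d)} (hα : α.length ≤ 2) {m : Fin d → ℝ}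
    (hm : m ∈ M) : MemLp (fun ω => 𝓜.replicateError v ξ N s ω c ν α m) 2 P :=
  ((memLp_finsetSum _ fun n _ => (h.square_integrable ν c α hα m hm).comp_measurePreserving
    (measurePreserving_point hξ s _ n)).const_mul _).sub (memLp_const _)

lemma IsAdmissible.integral_replicateError (h : 𝓜.IsAdmissible M) (hξ : IsUniformScrambling P ξ)
    {N : ℕ} (hN : 1 ≤ N) (s : ℕ) (c : C) (ν : Fin 3) {α : List (Fin d)} (hα : α.length ≤ 2)
    (m : Fin d → ℝ) : ∫ ω, 𝓜.replicateError v ξ N s ω c ν α m ∂P = 0 := by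
  have hN0 : (N : ℝ) ≠ 0 := by positivity
  have hF := h.integrable_tIntegrand ν c hα m
  have hi : ∀ n, Integrable (fun ω => 𝓜.tIntegrand c (𝓜.damp ν c) α m
      (𝓜.point v ξ s (𝓜.supp c).card n ω)) P := fun n =>
    (measurePreserving_point hξ s _ n).integrable_comp_of_integrable hF
  have hc : ∀ n, ∫ ω, 𝓜.tIntegrand c (𝓜.damp ν c) α m
      (𝓜.point v ξ s (𝓜.supp c).card n ω) ∂P = (𝓜.fourierValue c ν α m).re := fun n => by
    rw [← h.integral_tIntegrand ν c hα m]
    exact (isFairBits_point hξ s _).integral_comp _ hF.aestronglyMeasurable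
  simp only [replicateError]
  rw [integral_sub ((integrable_finsetSum _ fun n _ => hi n).const_mul _) (integrable_const _),
    integral_const_mul, integral_finsetSum _ fun n _ => hi n]
  simp [hc, inv_mul_cancel_left₀ hN0]

lemma IsAdmissible.tendsto_integral_sq_replicateError (h : 𝓜.IsAdmissible M)
    (hξ : IsUniformScrambling P ξ) (hv : ∀ k, ∃ t, IsDyadicSequence t (v k))
    {A : Fin 2 → ∀ c, Fin (𝓜.dim (𝓜.supp c).card) → ℝ} {m : Fin d → ℝ} (hm : m ∈ M)
    (hA : 𝓜.HasGrowthExponents A m) {r : ℝ} (hr : r < 1 - 𝓜.worstExponent A)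
    (c : C) (ν : Fin 3) (ν' : Fin 2) {α : List (Fin d)} (hα : α.length ≤ 2)
    (hg : HasBoundaryGrowth (𝓜.tIntegrand c (𝓜.damp ν c) α m) (A ν' c)) :
    Tendsto (fun q : ℕ => ((2 ^ q : ℕ) : ℝ) ^ (2 * r) *
      ∫ ω, 𝓜.replicateError v ξ (2 ^ q) 0 ω c ν α m ^ 2 ∂P) atTop (𝓝 0) := by
  obtain ⟨t, ht⟩ := hv (𝓜.supp c).card
  have key := (isFairBits_point hξ 0 (𝓜.supp c).card).tendsto_meanSquareError ht hg
    (h.square_integrable ν c α hα m hm) (le_worstExponent A ν' c) (worstExponent_nonneg hA) hr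
  refine key.congr fun q => ?_
  rw [meanSquareError, h.integral_tIntegrand ν c hα m]
  rfl

lemma IsAdmissible.memLp_replicateGrad (h : 𝓜.IsAdmissible M) (hξ : IsUniformScrambling P ξ)
    {z : PD d → ℝ} (hz : 𝓜.gradOf z (𝓜.fourierVec (z ∘ Sum.inl)) = 0)
    {A : Fin 2 → ∀ c, Fin (𝓜.dim (𝓜.supp c).card) → ℝ}
    (hA : 𝓜.HasGrowthExponents A (z ∘ Sum.inl)) (hm : z ∘ Sum.inl ∈ M) (N s : ℕ) (a : PD d) :
    MemLp (fun ω => 𝓜.replicateGrad v ξ N s ω z a) 2 P := by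
  obtain ⟨κ, ν, ν', α, hα, -, hrep⟩ := exists_replicateGrad_eq (Ω := Ω) hz hA a
  simp only [hrep]
  exact (memLp_finsetSum _ fun c _ => h.memLp_replicateError hξ N s c ν hα hm).const_mul _

lemma IsAdmissible.integral_replicateGrad (h : 𝓜.IsAdmissible M) (hξ : IsUniformScrambling P ξ)
    {z : PD d → ℝ} (hz : 𝓜.gradOf z (𝓜.fourierVec (z ∘ Sum.inl)) = 0)
    {A : Fin 2 → ∀ c, Fin (𝓜.dim (𝓜.supp c).card) → ℝ}
    (hA : 𝓜.HasGrowthExponents A (z ∘ Sum.inl)) (hm : z ∘ Sum.inl ∈ M) {N : ℕ} (hN : 1 ≤ N)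
    (s : ℕ) (a : PD d) : ∫ ω, 𝓜.replicateGrad v ξ N s ω z a ∂P = 0 := by
  obtain ⟨κ, ν, ν', α, hα, -, hrep⟩ := exists_replicateGrad_eq (Ω := Ω) hz hA a
  simp only [hrep]
  rw [integral_const_mul, integral_finsetSum _ fun c _ =>
    (h.memLp_replicateError hξ N s c ν hα hm).integrable one_le_two]
  simp [h.integral_replicateError hξ hN s _ ν hα]

/-- Along the powers of two the scaled variances of the estimated gradient vanish. -/
theorem IsAdmissible.tendsto_variance_replicateGrad (h : 𝓜.IsAdmissible M)
    (hξ : IsUniformScrambling P ξ) (hv : ∀ k, ∃ t, IsDyadicSequence t (v k))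
    {z : PD d → ℝ} (hz : 𝓜.gradOf z (𝓜.fourierVec (z ∘ Sum.inl)) = 0)
    {A : Fin 2 → ∀ c, Fin (𝓜.dim (𝓜.supp c).card) → ℝ}
    (hA : 𝓜.HasGrowthExponents A (z ∘ Sum.inl)) (hm : z ∘ Sum.inl ∈ M)
    {r : ℝ} (hr : r < 1 - 𝓜.worstExponent A) (a : PD d) :
    Tendsto (fun q : ℕ => ((2 ^ q : ℕ) : ℝ) ^ (2 * r) *
      variance (fun ω => 𝓜.replicateGrad v ξ (2 ^ q) 0 ω z a) P) atTop (𝓝 0) := by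
  obtain ⟨κ, ν, ν', α, hα, hg, hrep⟩ := exists_replicateGrad_eq (Ω := Ω) hz hA a
  have hlim := (tendsto_finsetSum Finset.univ fun c _ =>
    h.tendsto_integral_sq_replicateError hξ hv hm hA hr c ν ν' hα (hg c)).const_mul
      (κ ^ 2 * Fintype.card C)
  rw [Finset.sum_const_zero, mul_zero] at hlim
  refine tendsto_of_tendsto_of_tendsto_of_le_of_le tendsto_const_nhds hlim
    (fun q => mul_nonneg (by positivity) (variance_nonneg _ _)) fun q => ?_
  dsimp only
  rw [← Finset.mul_sum, mul_left_comm]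
  gcongr
  have hmem := fun c => h.memLp_replicateError (v := v) hξ (2 ^ q) 0 c ν hα hm
  refine (variance_le_expectation_sq
    (h.memLp_replicateGrad hξ hz hA hm _ 0 a).aestronglyMeasurable).trans ?_
  rw [← integral_finsetSum _ fun c _ => (hmem c).integrable_sq, ← integral_const_mul]
  refine integral_mono (h.memLp_replicateGrad hξ hz hA hm _ 0 a).integrable_sq
    ((integrable_finsetSum _ fun c _ => (hmem c).integrable_sq).const_mul _) fun ω => ?_
  dsimp only
  simp only [Pi.pow_apply]
  rw [hrep, mul_pow, mul_assoc]
  gcongr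
  exact sq_sum_le_card_mul_sum_sq

lemma IsAdmissible.measurable_replicateGrad_bits (h : 𝓜.IsAdmissible M) (N : ℕ) (z : PD d → ℝ)
    (a : PD d) : Measurable fun b : (Σ k : ℕ, Fin (𝓜.dim k)) × List Bool → Bool =>
      𝓜.replicateGrad v (fun _ k j w b => b (⟨k, j⟩, w)) N 0 b z a := by
  have hp : ∀ ν α, Measurable fun b : (Σ k : ℕ, Fin (𝓜.dim k)) × List Bool → Bool =>
      𝓜.pointAverage v (fun _ k j w b => b (⟨k, j⟩, w)) N 0 b ν α (z ∘ Sum.inl) := fun ν α =>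
    Finset.measurable_fun_sum _ fun c _ => (Finset.measurable_fun_sum _ fun n _ =>
      (h.measurable_tIntegrand ν c α _).comp (measurable_blockPoint (v := v) _ n)).const_mul _
  rcases a with i | u
  · exact measurable_const.sub (((hp 1 [i]).const_add _).const_mul _)
  · exact (hp 0 []).const_add _

/-- At the exact solution the single-randomization estimators are centred; as one function of
independent, identically distributed blocks of bits they share a variance. -/
lemma IsAdmissible.integral_sq_rqmcGrad_le (h : 𝓜.IsAdmissible M)
    (hξ : IsUniformScrambling P ξ)
    {z : PD d → ℝ} (hz : 𝓜.gradOf z (𝓜.fourierVec (z ∘ Sum.inl)) = 0)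
    {A : Fin 2 → ∀ c, Fin (𝓜.dim (𝓜.supp c).card) → ℝ}
    (hA : 𝓜.HasGrowthExponents A (z ∘ Sum.inl)) (hm : z ∘ Sum.inl ∈ M) {N S : ℕ} (hN : 1 ≤ N)
    (hS : 1 ≤ S) (a : PD d) : ∫ ω, 𝓜.rqmcGrad v ξ N S ω z a ^ 2 ∂P ≤
      (S : ℝ)⁻¹ * variance (fun ω => 𝓜.replicateGrad v ξ N 0 ω z a) P := by
  have hmeas := h.measurable_replicateGrad_bits (v := v) N z a
  have key := integral_sq_average_sub_le (P := P)
    (X := fun s ω => 𝓜.replicateGrad v ξ N s ω z a)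
    (fun s => h.memLp_replicateGrad hξ hz hA hm N s a)
    (fun s s' hss => (pairwise_indepFun_bitBlock hξ hss).comp hmeas hmeas)
    (fun s => h.integral_replicateGrad hξ hz hA hm hN s a)
    (V := variance (fun ω => 𝓜.replicateGrad v ξ N 0 ω z a) P) (fun s => le_of_eq ?_) hS
  · simpa [rqmcGrad] using key
  · have hid : IdentDistrib (bitBlock ξ s) (bitBlock ξ 0) P P :=
      ⟨(measurable_bitBlock hξ s).aemeasurable, (measurable_bitBlock hξ 0).aemeasurable,
        map_bitBlock hξ s⟩
    exact (hid.comp hmeas).variance_eq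

end Model

end FourierRQMC

namespace FourierRQMC

/-! ### Limit law -/

open scoped MatrixOrder in
lemma multivariateGaussian_zero_cov {ι : Type*} [Fintype ι] [DecidableEq ι]
    (μ : EuclideanSpace ℝ ι) : multivariateGaussian μ (0 : Matrix ι ι ℝ) = Measure.dirac μ := by
  rw [multivariateGaussian, CFC.sqrt_zero]
  simp

/-- Convergence in probability to zero is convergence in law to the degenerate Gaussian. -/
lemma tendstoInDistribution_gaussian_zero {ι Ω : Type*} [Fintype ι] [DecidableEq ι]
    [MeasurableSpace Ω] {P : Measure Ω} [IsProbabilityMeasure P]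
    {X : ℕ → Ω → EuclideanSpace ℝ ι} (hX : ∀ j, AEMeasurable (X j) P)
    (h : TendstoInMeasure P X atTop fun _ => 0) :
    TendstoInDistribution X atTop id (fun _ => P)
      (multivariateGaussian 0 (0 : Matrix ι ι ℝ)) := by
  have h1 := h.tendstoInDistribution hX
  refine ⟨hX, aemeasurable_id, ?_⟩
  convert h1.tendsto using 1
  refine congrArg 𝓝 (Subtype.ext ?_)
  change Measure.map id _ = Measure.map _ _
  rw [Measure.map_id, Measure.map_const, measure_univ, one_smul, multivariateGaussian_zero_cov]

lemma norm_toLp_two_le {ι : Type*} [Fintype ι] (x : ι → ℝ) :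
    ‖(WithLp.toLp 2 x : EuclideanSpace ℝ ι)‖ ≤ Fintype.card ι * ‖x‖ := by
  rw [EuclideanSpace.norm_eq]
  refine Real.sqrt_le_iff.2 ⟨by positivity, ?_⟩
  calc ∑ i, ‖x i‖ ^ 2 ≤ ∑ _i : ι, ‖x‖ ^ 2 := by
        gcongr with i _
        exact norm_le_pi_norm x i
    _ = Fintype.card ι * ‖x‖ ^ 2 := by simp
    _ ≤ (Fintype.card ι) ^ 2 * ‖x‖ ^ 2 := by
        gcongr
        exact_mod_cast Nat.le_self_pow two_ne_zero _
    _ = (Fintype.card ι * ‖x‖) ^ 2 := by ring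

end FourierRQMC

/-! ### Degeneracy of the limit covariance and smallness of the scaled gradient. -/

namespace FourierRQMC.Model

variable {d : ℕ} {C : Type*} [Fintype C] {𝓜 : Model d C} {M : Set (Fin d → ℝ)} {Ω : Type*}
  {v : (k : ℕ) → ℕ → Fin (𝓜.dim k) → ℝ}
  {ξ : ℕ → (k : ℕ) → Fin (𝓜.dim k) → List Bool → Ω → Bool}
  [MeasurableSpace Ω] {P : Measure Ω} [IsProbabilityMeasure P]

/-- The limit of the scaled covariance matrices vanishes. -/
theorem IsAdmissible.eq_zero_of_tendsto_covariance (h : 𝓜.IsAdmissible M)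
    (hξ : IsUniformScrambling P ξ) (hv : ∀ k, ∃ t, IsDyadicSequence t (v k))
    {z : PD d → ℝ} (hz : 𝓜.gradOf z (𝓜.fourierVec (z ∘ Sum.inl)) = 0)
    {A : Fin 2 → ∀ c, Fin (𝓜.dim (𝓜.supp c).card) → ℝ}
    (hA : 𝓜.HasGrowthExponents A (z ∘ Sum.inl)) (hm : z ∘ Sum.inl ∈ M)
    {r : ℝ} (hr : r < 1 - 𝓜.worstExponent A) {H : Matrix (PD d) (PD d) ℝ} (hH : H.PosSemidef)
    (hvar : ∀ a, Tendsto (fun N : ℕ => (N : ℝ) ^ (2 * r) *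
      variance (fun ω => 𝓜.replicateGrad v ξ N 0 ω z a) P) atTop (𝓝 (H a a))) : H = 0 := by
  -- A positive semidefinite matrix with zero trace is zero. Each diagonal entry is a limit along
  -- all `N`, hence along `2 ^ q`, where the limit is 0.
  refine hH.trace_eq_zero_iff.1 (Finset.sum_eq_zero fun a _ => ?_)
  have hpow : Tendsto (fun q : ℕ => 2 ^ q) atTop atTop :=
    tendsto_pow_atTop_atTop_of_one_lt one_lt_two
  exact tendsto_nhds_unique ((hvar a).comp hpow)
    (h.tendsto_variance_replicateGrad hξ hv hz hA hm hr a)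

/-- If the scaled variances vanish, so does the scaled estimated gradient, in probability. -/
lemma IsAdmissible.tendsto_measure_rqmcGrad (h : 𝓜.IsAdmissible M)
    (hξ : IsUniformScrambling P ξ)
    {z : PD d → ℝ} (hz : 𝓜.gradOf z (𝓜.fourierVec (z ∘ Sum.inl)) = 0)
    {A : Fin 2 → ∀ c, Fin (𝓜.dim (𝓜.supp c).card) → ℝ}
    (hA : 𝓜.HasGrowthExponents A (z ∘ Sum.inl)) (hm : z ∘ Sum.inl ∈ M) {r : ℝ} {a : PD d}
    (hvar : Tendsto (fun N : ℕ => (N : ℝ) ^ (2 * r) *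
      variance (fun ω => 𝓜.replicateGrad v ξ N 0 ω z a) P) atTop (𝓝 0))
    {Nseq Sseq : ℕ → ℕ} (hN : Tendsto Nseq atTop atTop) (hS : Tendsto Sseq atTop atTop)
    {ε : ℝ} (hε : 0 < ε) :
    Tendsto (fun j => P {ω | ε ≤ |√(Sseq j : ℝ) * (Nseq j : ℝ) ^ r *
      𝓜.rqmcGrad v ξ (Nseq j) (Sseq j) ω z a|}) atTop (𝓝 0) := by
  have hmem : ∀ N S, MemLp (fun ω => 𝓜.rqmcGrad v ξ N S ω z a) 2 P := fun N S => by
    have := (memLp_finsetSum (Finset.range S) fun s _ =>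
      h.memLp_replicateGrad (v := v) hξ hz hA hm N s a).const_mul (S : ℝ)⁻¹
    refine this.ae_eq (Eventually.of_forall fun ω => ?_)
    simp [rqmcGrad]
  have hsq : ∀ j ω, (√(Sseq j : ℝ) * (Nseq j : ℝ) ^ r *
      𝓜.rqmcGrad v ξ (Nseq j) (Sseq j) ω z a) ^ 2 = (Sseq j * (Nseq j : ℝ) ^ (2 * r)) *
        𝓜.rqmcGrad v ξ (Nseq j) (Sseq j) ω z a ^ 2 := by
    intro j ω
    rw [mul_pow, mul_pow, Real.sq_sqrt (Nat.cast_nonneg _), ← Real.rpow_natCast,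
      ← Real.rpow_mul (Nat.cast_nonneg _), mul_comm r]
    norm_num
  -- The factor `S` from the scaling cancels the `1 / S` from independent averaging, leaving the
  -- scaled variance of one randomization.
  have hint : Tendsto (fun j => ∫ ω, (√(Sseq j : ℝ) * (Nseq j : ℝ) ^ r *
      𝓜.rqmcGrad v ξ (Nseq j) (Sseq j) ω z a) ^ 2 ∂P) atTop (𝓝 0) := by
    refine tendsto_of_tendsto_of_tendsto_of_le_of_le' tendsto_const_nhds (hvar.comp hN)
      (Eventually.of_forall fun j => integral_nonneg fun ω => sq_nonneg _) ?_
    filter_upwards [hN.eventually_ge_atTop 1, hS.eventually_ge_atTop 1] with j hj1 hj2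
    have hS0 : (Sseq j : ℝ) ≠ 0 := by positivity
    simp_rw [hsq]
    rw [integral_const_mul]
    calc (Sseq j * (Nseq j : ℝ) ^ (2 * r)) *
          ∫ ω, 𝓜.rqmcGrad v ξ (Nseq j) (Sseq j) ω z a ^ 2 ∂P
        ≤ (Sseq j * (Nseq j : ℝ) ^ (2 * r)) * ((Sseq j : ℝ)⁻¹ *
          variance (fun ω => 𝓜.replicateGrad v ξ (Nseq j) 0 ω z a) P) := by
          gcongr
          exact h.integral_sq_rqmcGrad_le hξ hz hA hm hj1 hj2 a
      _ = _ := by simp only [Function.comp_apply]; field_simp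
  have key := tendsto_measure_ge_of_tendsto_integral (P := P)
    (f := fun j ω => (√(Sseq j : ℝ) * (Nseq j : ℝ) ^ r *
      𝓜.rqmcGrad v ξ (Nseq j) (Sseq j) ω z a) ^ 2) (fun _ _ => sq_nonneg _)
    (fun j => ((hmem _ _).const_mul _).integrable_sq) hint (pow_pos hε 2)
  refine tendsto_of_tendsto_of_tendsto_of_le_of_le tendsto_const_nhds key (fun _ => zero_le)
    fun j => measure_mono fun ω hω => ?_
  have hω' : ε ≤ _ := hω
  change ε ^ 2 ≤ _
  rw [← sq_abs (_ * _)]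
  gcongr

end FourierRQMC.Model

/-! ### Assembly of the limit theorem. -/

theorem theorem5p7 {d : ℕ} {C : Type*} [Fintype C] (𝓜 : FourierRQMC.Model d C)
    -- the allocation set, the bound for the multiplier, and the standing assumptions
    (M : Set (Fin d → ℝ)) (hM : IsCompact M) (lamMax : ℝ)
    (hadm : 𝓜.IsAdmissible M)
    -- the exact solution `zstar = (mstar, lamstar)`
    (zstar : FourierRQMC.PD d → ℝ)
    (hz_kkt : 𝓜.IsKKT zstar)
    (hz_unique : ∀ z ∈ FourierRQMC.pdSet M lamMax, 𝓜.IsKKT z → z = zstar)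
    (hz_int : (zstar ∘ Sum.inl) ∈ interior M)
    (hz_lam : zstar (Sum.inr ()) ∈ Set.Ioo 0 lamMax)
    (hz_hess : IsUnit (𝓜.hessFou zstar).det)
    -- the rate exponent
    (A : Fin 2 → ∀ c, Fin (𝓜.dim (𝓜.supp c).card) → ℝ)
    (hA : 𝓜.HasGrowthExponents A (zstar ∘ Sum.inl))
    (ς : ℝ) (hς : 0 < ς) (r : ℝ) (hr : r = 1 - 𝓜.worstExponent A - ς)
    -- the scrambled point sets
    (v : (k : ℕ) → ℕ → Fin (𝓜.dim k) → ℝ)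
    (hv : ∀ k, ∃ t, FourierRQMC.IsDyadicSequence t (v k))
    {Ω : Type*} [MeasurableSpace Ω] (P : MeasureTheory.Measure Ω)
    [MeasureTheory.IsProbabilityMeasure P]
    (ξ : ℕ → (k : ℕ) → Fin (𝓜.dim k) → List Bool → Ω → Bool)
    (hξ : FourierRQMC.IsUniformScrambling P ξ)
    -- the Fourier-RQMC solutions: zeros in `M × (0, lamMax]` of the estimated gradient
    (zhat : ℕ → ℕ → Ω → FourierRQMC.PD d → ℝ)
    (hzhat_meas : ∀ N S, AEMeasurable (zhat N S) P)
    (hzhat : ∀ N S, ∀ᵐ ω ∂P,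
      (∃ z ∈ FourierRQMC.pdSet M lamMax, 𝓜.rqmcGrad v ξ N S ω z = 0) →
        zhat N S ω ∈ FourierRQMC.pdSet M lamMax ∧ 𝓜.rqmcGrad v ξ N S ω (zhat N S ω) = 0)
    -- the limit solutions for infinitely many randomizations
    (zinf : ℕ → FourierRQMC.PD d → ℝ)
    (hzinf : ∀ N, 1 ≤ N → zinf N ∈ FourierRQMC.pdSet M lamMax ∧
      ∀ a, ∫ ω, 𝓜.replicateGrad v ξ N 0 ω (zinf N) a ∂P = 0)
    -- joint growth of the number of points and of the number of randomizations
    (Nseq Sseq : ℕ → ℕ) (hN : Tendsto Nseq atTop atTop) (hS : Tendsto Sseq atTop atTop)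
    (hgrowth : Tendsto (fun j => √(Sseq j : ℝ) * (Nseq j : ℝ) ^ r *
      ‖WithLp.toLp 2 (zinf (Nseq j) - zstar)‖) atTop (𝓝 0))
    -- limiting scaled covariance of the single-randomization gradient estimator
    (H : Matrix (FourierRQMC.PD d) (FourierRQMC.PD d) ℝ) (hH : H.PosSemidef)
    (hcov : ∀ a b, Tendsto (fun N : ℕ => (N : ℝ) ^ (2 * r) *
      cov[fun ω => 𝓜.replicateGrad v ξ N 0 ω zstar a,
        fun ω => 𝓜.replicateGrad v ξ N 0 ω zstar b; P]) atTop (𝓝 (H a b))) :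
    TendstoInDistribution
      (fun j ω => (√(Sseq j : ℝ) * (Nseq j : ℝ) ^ r) •
        (WithLp.toLp 2 (zhat (Nseq j) (Sseq j) ω - zstar) :
          EuclideanSpace ℝ (FourierRQMC.PD d)))
      atTop id (fun _ => P)
      (multivariateGaussian 0 ((𝓜.hessFou zstar)⁻¹ * H * (𝓜.hessFou zstar)⁻¹)) := by
  have hm : zstar ∘ Sum.inl ∈ M := interior_subset hz_int
  have hz : 𝓜.gradOf zstar (𝓜.fourierVec (zstar ∘ Sum.inl)) = 0 := by
    rw [hadm.gradOf_fourierVec]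
    exact hz_kkt
  have hr' : r < 1 - 𝓜.worstExponent A := by linarith
  have hvar : ∀ a, Tendsto (fun N : ℕ => (N : ℝ) ^ (2 * r) *
      variance (fun ω => 𝓜.replicateGrad v ξ N 0 ω zstar a) P) atTop (𝓝 (H a a)) := fun a => by
    refine (hcov a a).congr fun N => ?_
    rw [covariance_self
      (hadm.memLp_replicateGrad hξ hz hA hm N 0 a).aestronglyMeasurable.aemeasurable]
  -- The rate is strictly below the attainable one, so the limiting covariance is zero and the
  -- target law is the point mass at 0.
  have hH0 := hadm.eq_zero_of_tendsto_covariance hξ hv hz hA hm hr' hH hvar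
  subst hH0
  obtain ⟨K, hK, hbad⟩ := hadm.exists_tendsto_measure_norm_sub hM hξ hz_kkt hz_unique hz_int hz_lam
    hz_hess hzhat (hN.eventually_ge_atTop 1) hS
  rw [Matrix.mul_zero, Matrix.zero_mul]
  refine FourierRQMC.tendstoInDistribution_gaussian_zero (fun j => ?_) ?_
  · have h1 : Measurable fun x : FourierRQMC.PD d → ℝ =>
        (√(Sseq j : ℝ) * (Nseq j : ℝ) ^ r) •
          (WithLp.toLp 2 (x - zstar) : EuclideanSpace ℝ (FourierRQMC.PD d)) := by
      fun_prop
    exact h1.comp_aemeasurable (hzhat_meas _ _)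
  rw [tendstoInMeasure_iff_norm]
  intro ε hε
  set B : ℝ := (Fintype.card (FourierRQMC.PD d) : ℝ) with hB
  have hB0 : 0 < B := by
    rw [hB]
    exact_mod_cast Fintype.card_pos
  -- The threshold divides out `K` from the solution bound and `B` from comparing Euclidean and
  -- supremum norms.
  have hgrad := tendsto_finsetSum Finset.univ fun a _ =>
    hadm.tendsto_measure_rqmcGrad (v := v) hξ hz hA hm (hvar a) hN hS
      (show 0 < ε / (B * K) by positivity)
  have hsum := hbad.add hgrad
  rw [Finset.sum_const_zero, add_zero] at hsum
  refine tendsto_of_tendsto_of_tendsto_of_le_of_le tendsto_const_nhds hsum (fun _ => zero_le)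
    fun j => (measure_mono ?_).trans ((measure_union_le _ _).trans
      (add_le_add_right (measure_biUnion_finset_le _ _) _))
  intro ω hω
  by_contra hnot
  simp only [Set.mem_union, Set.mem_ofPred_eq, Set.mem_iUnion, Finset.mem_univ, exists_true_left,
    not_or, not_lt, not_exists, not_le] at hnot hω
  obtain ⟨h1, h2⟩ := hnot
  set ρ : ℝ := √(Sseq j : ℝ) * (Nseq j : ℝ) ^ r with hρ
  have hρ0 : 0 ≤ ρ := by positivity
  have h3 : ρ * ‖𝓜.rqmcGrad v ξ (Nseq j) (Sseq j) ω zstar‖ < ε / (B * K) := by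
    rw [← Real.norm_of_nonneg hρ0, ← norm_smul]
    exact (pi_norm_lt_iff (by positivity)).2 fun a => h2 a
  rw [sub_zero, norm_smul, Real.norm_of_nonneg hρ0] at hω
  have h4 := mul_le_mul_of_nonneg_left
    ((FourierRQMC.norm_toLp_two_le (zhat (Nseq j) (Sseq j) ω - zstar)).trans
      (mul_le_mul_of_nonneg_left h1 hB0.le)) hρ0
  have h5 : ρ * (B * (K * ‖𝓜.rqmcGrad v ξ (Nseq j) (Sseq j) ω zstar‖)) < ε := by
    have := (lt_div_iff₀ (by positivity)).1 h3
    linarith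
  linarith
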